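/- Let $\Omega\subset\mathbb C$ be an open convex set, $\Omega\neq\mathbb C$, which contains a sector of angle $2\alpha$ with $0<\alpha\le\pi/2$, i.e. for some $a\in\mathbb C$, $\beta\in\mathbb R$ it contains $\{z\neq a : |\arg((z-a)e^{-i\beta})|<\alpha\}$. Let $ds$ be arclength on $\partial\Omega$, $\nu$ the unit outward normal (defined $ds$-a.e.), $\omega(z)$ the interior angle of $\Omega$ at $z\in\partial\Omega$ ($\omega(z)=\pi$ unless $z$ is a corner), and $$\mu(\sigma,z)=\frac1{2\pi}\Big(\frac{\nu}{\sigma-z}+\frac{\bar\nu}{\bar\sigma-\bar z}\Big)\qquad(\sigma\in\partial\Omega,\ z\in\overline\Omega\setminus\{\sigma\}).$$ Let $C(\partial\Omega)$ be the space of bounded continuous functions $\partial\Omega\to\mathbb C$ with the supremum norm. For $g\in C(\partial\Omega)$ and $z\in\partial\Omega$ put $$Pg(z)=\int_{\partial\Omega\setminus\{z\}}g(\sigma)\,\mu(\sigma,z)\,ds+\Big(1-\frac{\omega(z)}\pi\Big)g(z).$$ Then the following hold. 1. The C. Neumann problem for the double-layer potential is well posed: for every $r$ that is continuous on $\overline\Omega$,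 harmonic in $\Omega$ and bounded in $\Omega$ there is exactly one $g\in C(\partial\Omega)$ with $$r(z)=\frac12\int_{\partial\Omega}g(\sigma)\,\mu(\sigma,z)\,ds\qquad\text{for all }z\in\Omega,$$ and there is a constant $K$ (independent of $r$) with $\|g\|_{L^\infty(\partial\Omega)}\le K\,\|r\|_{L^\infty(\partial\Omega)}$ for all such $r$. Moreover $P$ maps $C(\partial\Omega)$ into itself and $I+P$ is invertible on $C(\partial\Omega)$. 2. $C_N(\Omega)\le\dfrac{\pi}{\alpha}$, where $$C_N(\Omega)=\sup\{\,\|2(I+P)^{-1}r\|_{L^\infty(\partial\Omega)} : r \text{ a rational function},\ |r|\le1\text{ in }\Omega\,\}.$$ 3. $C_{cb}(\Omega)\le\dfrac{\pi-\alpha}{\alpha}$, where $$C_{cb}(\Omega)=\sup\|R(A)\|,$$ the supremum being over all complex Hilbert spaces $H$, all bounded operators $A$ on $H$ whose numerical range $W(A)=\{\langle Ax,x\rangle:\|x\|=1\}$ satisfies $\overline{W(A)}\subset\Omega$, all $m,n$, and all $m\times n$ matrices $R$ of rational functions with $\|R(z)\|\le1$ for all $z\in\Omega$ (operator norm between Euclidean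 spaces). -/

import Mathlib

open MeasureTheory
open scoped BoundedContinuousFunction ENNReal

universe u

noncomputable section

namespace CNeumann

/-! ### Geometry of a planar convex domain -/

/-- The open sector of opening `2α` with vertex `a`, symmetric about the direction `e^{iβ}`. -/
def sector (a : ℂ) (β α : ℝ) : Set ℂ :=
  {z | z ≠ a ∧ |Complex.arg ((z - a) * Complex.exp (-(β * Complex.I)))| < α}

/-- `ν` is a unit outward normal of (a supporting line of) the convex set `Ω` at `σ`. -/
def IsOuterNormal (Ω : Set ℂ) (σ ν : ℂ) : Prop :=
  ‖ν‖ = 1 ∧ ∀ w ∈ Ω, ((starRingEnd ℂ) ν * (w - σ)).re ≤ 0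

open Classical in
/-- The unit outward normal of the boundary of a convex `Ω` at `σ`. It is the unique unit outward
normal where there is exactly one, that is, where the boundary has a tangent; at the
(at most countably many) corners it has the value `0`. -/
def outerNormal (Ω : Set ℂ) (σ : ℂ) : ℂ :=
  if h : ∃! ν, IsOuterNormal Ω σ ν then h.choose else 0

/-- The interior angle of `Ω` at `z`: the measure of the set of directions that enter `Ω`
from `z`. For a convex domain and a boundary point `z` it is `π` unless `z` is a corner. -/
def interiorAngle (Ω : Set ℂ) (z : ℂ) : ℝ :=
  (volume {θ : ℝ | θ ∈ Set.Ioc (-Real.pi) Real.pi ∧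
    ∃ t : ℝ, 0 < t ∧ z + t * Complex.exp (θ * Complex.I) ∈ Ω}).toReal

/-! ### The double-layer potential -/

/-- The kernel `μ(σ, z) = (1 / 2π) (ν / (σ - z) + ν̄ / (σ̄ - z̄))`, with `ν` the unit outward normal
at the boundary point `σ`. -/
def kernel (Ω : Set ℂ) (σ z : ℂ) : ℂ :=
  1 / (2 * Real.pi) * (outerNormal Ω σ / (σ - z)
    + (starRingEnd ℂ) (outerNormal Ω σ) / ((starRingEnd ℂ) σ - (starRingEnd ℂ) z))

/-- The double-layer potential `∫_{∂Ω} g(σ) μ(σ, z) ds`. The arclength `ds` on `∂Ω` is the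
one-dimensional Hausdorff measure. -/
def doubleLayer (Ω : Set ℂ) (g : frontier Ω →ᵇ ℂ) (z : ℂ) : ℂ :=
  ∫ σ : frontier Ω, g σ * kernel Ω σ z ∂Measure.hausdorffMeasure 1

/-- `g` solves the C. Neumann problem with datum `r`:
`r(z) = (1 / 2) ∫_{∂Ω} g(σ) μ(σ, z) ds` for all `z` in `Ω`. -/
def IsNeumannSolution (Ω : Set ℂ) (r : ℂ → ℂ) (g : frontier Ω →ᵇ ℂ) : Prop :=
  ∀ z ∈ Ω, r z = 1 / 2 * doubleLayer Ω g z

/-- Admissible data: continuous on the closure, harmonic and bounded in `Ω`. -/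
structure IsDatum (Ω : Set ℂ) (r : ℂ → ℂ) : Prop where
  continuousOn : ContinuousOn r (closure Ω)
  harmonic : InnerProductSpace.HarmonicOnNhd r Ω
  bounded : ∃ M : ℝ, ∀ z ∈ Ω, ‖r z‖ ≤ M

/-- The C. Neumann problem is well posed: every admissible datum has exactly one solution, and the
solution depends continuously on the datum, in the norms of `L^∞(∂Ω)`. -/
structure IsWellPosed (Ω : Set ℂ) : Prop where
  existsUnique : ∀ r : ℂ → ℂ, IsDatum Ω r → ∃! g : frontier Ω →ᵇ ℂ, IsNeumannSolution Ω r g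
  stable : ∃ K : ℝ, ∀ r : ℂ → ℂ, IsDatum Ω r → ∀ g : frontier Ω →ᵇ ℂ, IsNeumannSolution Ω r g →
    ∀ M : ℝ, (∀ z ∈ frontier Ω, ‖r z‖ ≤ M) → ‖g‖ ≤ K * M

/-- The boundary operator `P`:
`Pg(z) = (1 / π) ∫_{∂Ω ∖ {z}} g(σ) d arg(σ - z) + (1 - ω(z) / π) g(z)`, where `ω(z)` is the interior
angle at `z` and `(1 / π) d arg(σ - z) = μ(σ, z) ds`. The last term vanishes unless `z` is a corner
of `∂Ω`; it is the contribution to `(1 / π) d arg(σ - z)` of the jump by `π - ω(z)` at `σ = z`. -/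
def boundaryOp (Ω : Set ℂ) (g : frontier Ω →ᵇ ℂ) (z : frontier Ω) : ℂ :=
  (∫ σ in ({z}ᶜ : Set (frontier Ω)), g σ * kernel Ω σ z ∂Measure.hausdorffMeasure 1)
    + (1 - interiorAngle Ω z / Real.pi : ℝ) * g z

/-- `P` maps the space of bounded continuous functions on `∂Ω` into itself, and `I + P` is
invertible on that space. -/
structure IsInvertibleIdAddP (Ω : Set ℂ) : Prop where
  mapsTo : ∀ g : frontier Ω →ᵇ ℂ, ∃ h : frontier Ω →ᵇ ℂ, ∀ z, h z = boundaryOp Ω g z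
  bijective : ∀ h : frontier Ω →ᵇ ℂ, ∃! g : frontier Ω →ᵇ ℂ, ∀ z, g z + boundaryOp Ω g z = h z

/-- The value of a complex rational function at a point that is not a pole. -/
def ratEval (r : RatFunc ℂ) (z : ℂ) : ℂ := RatFunc.eval (RingHom.id ℂ) z r

/-- `C_N(Ω)`: the supremum of `‖2 (I + P)⁻¹ r‖` in `L^∞(∂Ω)` over all rational `r` with `|r| ≤ 1`
in `Ω`. Here `g = 2 (I + P)⁻¹ r` is expressed by `(I + P) g = 2 r` on `∂Ω`. -/
def constN (Ω : Set ℂ) : ℝ≥0∞ :=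
  ⨆ (r : RatFunc ℂ) (_ : ∀ z ∈ Ω, ‖ratEval r z‖ ≤ 1) (g : frontier Ω →ᵇ ℂ)
    (_ : ∀ z : frontier Ω, g z + boundaryOp Ω g z = 2 * ratEval r z), ENNReal.ofReal ‖g‖

/-! ### The complete bound of the rational functional calculus -/

section Operators

variable {H : Type*} [NormedAddCommGroup H] [InnerProductSpace ℂ H]

/-- The numerical range of a bounded operator. -/
def numRange (A : H →L[ℂ] H) : Set ℂ := {w | ∃ x : H, ‖x‖ = 1 ∧ inner ℂ x (A x) = w}

/-- `r(A) = p(A) q(A)⁻¹` for the rational function `r = p / q` in lowest terms; meaningful when no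
pole of `r` lies in the spectrum of `A`. -/
def ratApply (r : RatFunc ℂ) (A : H →L[ℂ] H) : H →L[ℂ] H :=
  Polynomial.aeval A r.num * Ring.inverse (Polynomial.aeval A r.denom)

/-- The operator from `H ⊕ ⋯ ⊕ H` (`n` Hilbert space summands) to `H ⊕ ⋯ ⊕ H` (`m` summands) with
block matrix `T`. -/
def blockOp {m n : ℕ} (T : Matrix (Fin m) (Fin n) (H →L[ℂ] H)) :
    PiLp 2 (fun _ : Fin n => H) →L[ℂ] PiLp 2 (fun _ : Fin m => H) :=
  (PiLp.continuousLinearEquiv 2 ℂ (fun _ : Fin m => H)).symm.toContinuousLinearMap ∘L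
    ContinuousLinearMap.pi (fun i => ∑ j, T i j ∘L PiLp.proj 2 (fun _ : Fin n => H) j)

end Operators

open scoped Matrix.Norms.L2Operator in
/-- `C_cb(Ω)`: the supremum of `‖R(A)‖` over all complex Hilbert spaces `H`, all bounded operators
`A` on `H` whose numerical range has its closure in `Ω`, and all matrices `R` (of any size) of
rational functions with `‖R(z)‖ ≤ 1` (operator norm between Euclidean spaces) for `z` in `Ω`. -/
def constCb (Ω : Set ℂ) : ℝ≥0∞ :=
  ⨆ (H : Type u) (_ : NormedAddCommGroup H) (_ : InnerProductSpace ℂ H) (_ : CompleteSpace H)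
    (A : H →L[ℂ] H) (_ : closure (numRange A) ⊆ Ω)
    (m : ℕ) (n : ℕ) (R : Matrix (Fin m) (Fin n) (RatFunc ℂ))
    (_ : ∀ z ∈ Ω, ‖R.map (fun r => ratEval r z)‖ ≤ 1),
    ENNReal.ofReal ‖blockOp (R.map (fun r => ratApply r A))‖

end CNeumann

end

open Set Filter Topology
open scoped NNReal Measure

noncomputable section

namespace CNeumann

/-! The kernel is an angle: `μ(σ, z) ds = (1/π) d arg(σ - z)`. For `z ∈ Ω` the boundary is a curve
in polar coordinates about `z`, its reciprocal radius is the gauge of `Ω - z`, hence Lipschitz, and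
a change of variables from arclength to `θ` (`norm_deriv_mul_kernel`, `integral_mul_kernel_eq`)
turns the double-layer potential of `g` into `Tg(z)`, which is `1/π` times the integral of `g` at
the ends of the rays from `z` that leave `Ω` (`angularAverage`). The directions in which a ray never
leaves are the recession directions of `closure Ω`. They are the same for all `z`, and a sector of
opening `2α` supplies a set of them of measure at least `2α`. So `T` is positive with constant total
mass `τ = vol / π ≤ 2 - 2α/π`, where `vol` is the measure of the directions that are hit.

`Tg` makes sense on `closure Ω` and is continuous there by dominated convergence: the end of a ray
varies continuously with `z` except in at most two tangent directions. At a boundary point the rays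
of length zero have total angle `2π - ω(z)` and contribute `(2 - ω(z)/π) g(z)`; the other rays give
the kernel integral. Hence `Tg = (I + P)g` on the boundary
(`integral_mul_kernel_add_eq_angularAverage`), which also shows that `Pg` is continuous. Since `ω(z)
≤ π`, both terms of `P` are positive, and `P` has norm at most `τ - 1 ≤ 1 - 2α/π < 1`. The Neumann
series inverts `I + P` with `‖(I + P)⁻¹‖ ≤ π/(2α)`. A maximum principle of Phragmén-Lindelöf type
(`harmonic_nonpos`) identifies solutions of the Neumann problem with solutions of `(I + P)g = 2r`,
so parts 1 and 2 follow, the factor 2 giving `π/α`.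

For part 3, the potential of `g` is a constant plus a Cauchy transform of `g` plus the conjugate of
a Cauchy transform of `ḡ`, both normalized to vanish at `w`. If the potential is holomorphic, the
conjugated transform is holomorphic together with its conjugate, so it is zero. Analytic
continuation along the segment from `w` to `A` then carries the scalar identity to operators: if `g`
solves the problem for `r`, then `∫ g μ(σ, A) ds = 2 r(A)` (`integral_smul_kernelOp_eq`). The
operators `μ(σ, A)` are positive because the numerical range lies in every supporting half-plane,
and their integral is `τ`. A positive operator measure of mass `τ` integrates a matrix function
bounded by `Γ` to an operator of norm at most `Γτ`. The bound for `(I + P)⁻¹` passes to matrices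
with the same constant, so `Γ = π/α`, and `2‖R(A)‖ ≤ (π/α)(2 - 2α/π)`. -/

section

/-! ### Arclength of an injective curve -/

/-- On a set where `γ` is close to an affine map, length of the image and integral of the speed
agree up to a multiple of the size of the set. -/
theorem hausdorffMeasure_image_of_approximatesLinearOn {γ γ' : ℝ → ℂ} {t : Set ℝ}
    (ht : MeasurableSet t) {A : ℝ →L[ℝ] ℂ} {ε : ℝ≥0}
    (hA : ApproximatesLinearOn γ A t ε) (hγ' : ∀ x ∈ t, ‖γ' x - A 1‖ ≤ 2 * ε) :
    μH[1] (γ '' t) ≤ (∫⁻ x in t, (‖γ' x‖ₑ + 3 * ε)) ∧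
      ∫⁻ x in t, ‖γ' x‖ₑ ≤ μH[1] (γ '' t) + 3 * ε * volume t := by
  set a : ℝ≥0 := ‖A 1‖₊ with ha
  have hAx : ∀ x : ℝ, ‖A x‖ = a * |x| := by
    intro x
    have : A x = x • A 1 := by rw [← map_smul]; simp
    rw [this, norm_smul, Real.norm_eq_abs, mul_comm]; rfl
  constructor
  · have hL : LipschitzOnWith (a + ε) γ t := by
      refine LipschitzOnWith.of_dist_le_mul fun x hx y hy => ?_
      have h1 := hA x hx y hy
      have h2 : ‖γ x - γ y‖ ≤ ‖γ x - γ y - A (x - y)‖ + ‖A (x - y)‖ := by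
        simpa using norm_add_le (γ x - γ y - A (x - y)) (A (x - y))
      rw [hAx] at h2
      rw [dist_eq_norm, dist_eq_norm, Real.norm_eq_abs, NNReal.coe_add]
      rw [Real.norm_eq_abs] at h1
      linarith
    have h1 := hL.hausdorffMeasure_image_le zero_le_one
    rw [ENNReal.rpow_one, hausdorffMeasure_real] at h1
    refine h1.trans ?_
    rw [← setLIntegral_const]
    refine setLIntegral_mono' ht fun x hx => ?_
    have h2 := hγ' x hx
    have h3 : ‖A 1‖ ≤ ‖γ' x‖ + ‖γ' x - A 1‖ := by
      have := norm_sub_le (γ' x) (γ' x - A 1)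
      simpa using this
    have h4 : a + ε ≤ ‖γ' x‖₊ + 3 * ε := by
      rw [← NNReal.coe_le_coe]
      push_cast
      have : (a : ℝ) = ‖A 1‖ := rfl
      linarith
    rw [enorm_eq_nnnorm]
    exact_mod_cast h4
  · have h0 : ∫⁻ x in t, ‖γ' x‖ₑ ≤ (a + 2 * ε : ℝ≥0) * volume t := by
      rw [← setLIntegral_const]
      refine setLIntegral_mono' ht fun x hx => ?_
      have h2 := hγ' x hx
      have h3 : ‖γ' x‖ ≤ ‖A 1‖ + ‖γ' x - A 1‖ := by
        have := norm_add_le (A 1) (γ' x - A 1)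
        simpa using this
      rw [enorm_eq_nnnorm, ENNReal.coe_le_coe, ← NNReal.coe_le_coe]
      push_cast
      have : (a : ℝ) = ‖A 1‖ := rfl
      linarith
    refine h0.trans ?_
    -- If the slope `a` is at most `ε`, the error term `3ε` alone absorbs `a + 2ε`. Otherwise `γ`
    -- expands distances by at least `a - ε`, and the Lipschitz bound for its inverse gives the
    -- lower estimate.
    rcases le_or_gt a ε with hle | hlt
    · refine le_trans ?_ le_add_self
      gcongr
      have : a + 2 * ε ≤ 3 * ε := by
        calc a + 2 * ε ≤ ε + 2 * ε := by gcongr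
          _ = 3 * ε := by ring
      exact_mod_cast this
    · have hpos : (0 : ℝ) < a - ε := by
        have : (ε : ℝ) < a := by exact_mod_cast hlt
        linarith
      have key : ∀ x ∈ t, ∀ y ∈ t, ((a : ℝ) - ε) * |x - y| ≤ ‖γ x - γ y‖ := by
        intro x hx y hy
        have h1 := hA x hx y hy
        have h2 : ‖A (x - y)‖ ≤ ‖γ x - γ y‖ + ‖γ x - γ y - A (x - y)‖ := by
          have := norm_sub_le (γ x - γ y) (γ x - γ y - A (x - y))
          simpa using this
        rw [hAx] at h2
        rw [Real.norm_eq_abs] at h1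
        linarith
      have hinj : InjOn γ t := by
        intro x hx y hy hxy
        have := key x hx y hy
        rw [hxy, sub_self, norm_zero] at this
        have h3 : |x - y| ≤ 0 := by
          by_contra h
          push Not at h
          nlinarith
        have := abs_nonpos_iff.1 h3
        linarith
      have hL : LipschitzOnWith (a - ε)⁻¹ (Function.invFunOn γ t) (γ '' t) := by
        refine LipschitzOnWith.of_dist_le_mul ?_
        rintro _ ⟨x, hx, rfl⟩ _ ⟨y, hy, rfl⟩
        rw [hinj.leftInvOn_invFunOn hx, hinj.leftInvOn_invFunOn hy, NNReal.coe_inv,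
          NNReal.coe_sub hlt.le, dist_eq_norm, dist_eq_norm, Real.norm_eq_abs, inv_mul_eq_div,
          le_div_iff₀ hpos, mul_comm]
        exact key x hx y hy
      have h1 := hL.hausdorffMeasure_image_le zero_le_one
      rw [ENNReal.rpow_one, hausdorffMeasure_real, hinj.invFunOn_image Subset.rfl] at h1
      have hne : a - ε ≠ 0 := (tsub_pos_of_lt hlt).ne'
      rw [ENNReal.coe_inv hne, ← ENNReal.div_eq_inv_mul] at h1
      have h2 : volume t * (a - ε : ℝ≥0) ≤ μH[1] (γ '' t) :=
        ENNReal.mul_le_of_le_div h1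
      have h3 : (a + 2 * ε : ℝ≥0) = (a - ε) + 3 * ε := by
        have : a = (a - ε) + ε := (tsub_add_cancel_of_le hlt.le).symm
        conv_lhs => rw [this]
        ring
      rw [h3, ENNReal.coe_add, add_mul]
      gcongr
      · rwa [mul_comm]
      · push_cast; rfl

/-- Both estimates add up over a countable partition, since injectivity keeps the images disjoint
and measurable. Used for two nested partitions below. -/
theorem hausdorffMeasure_image_of_iUnion {γ γ' : ℝ → ℂ} {s : Set ℝ} {δ : ℝ≥0∞}
    (hc : ContinuousOn γ s) (hinj : InjOn γ s) {ι : Type*} [Countable ι] {v : ι → Set ℝ}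
    (hv : ∀ i, MeasurableSet (v i)) (hd : Pairwise (Function.onFun Disjoint v))
    (hs : s = ⋃ i, v i)
    (h : ∀ i, μH[1] (γ '' v i) ≤ (∫⁻ x in v i, (‖γ' x‖ₑ + δ)) ∧
      ∫⁻ x in v i, ‖γ' x‖ₑ ≤ μH[1] (γ '' v i) + δ * volume (v i)) :
    μH[1] (γ '' s) ≤ (∫⁻ x in s, (‖γ' x‖ₑ + δ)) ∧
      ∫⁻ x in s, ‖γ' x‖ₑ ≤ μH[1] (γ '' s) + δ * volume s := by
  have hsub : ∀ i, v i ⊆ s := fun i => hs ▸ subset_iUnion v i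
  have hH : μH[1] (γ '' s) = ∑' i, μH[1] (γ '' v i) := by
    conv_lhs => rw [hs, image_iUnion]
    refine measure_iUnion ?_ ?_
    · intro i j hij
      refine Set.disjoint_left.2 ?_
      rintro _ ⟨x, hx, rfl⟩ ⟨y, hy, hxy⟩
      have := hinj (hsub j hy) (hsub i hx) hxy
      exact Set.disjoint_left.1 (hd hij) hx (this ▸ hy)
    · intro i
      exact (hv i).image_of_continuousOn_injOn (hc.mono (hsub i)) (hinj.mono (hsub i))
  have hI : ∀ f : ℝ → ℝ≥0∞, ∫⁻ x in s, f x = ∑' i, ∫⁻ x in v i, f x := by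
    intro f
    conv_lhs => rw [hs]
    exact lintegral_iUnion hv hd f
  constructor
  · rw [hH, hI]
    exact ENNReal.tsum_le_tsum fun i => (h i).1
  · rw [hI, hH]
    have : volume s = ∑' i, volume (v i) := by
      conv_lhs => rw [hs]
      exact measure_iUnion hd hv
    rw [this, ← ENNReal.tsum_mul_left, ← ENNReal.tsum_add]
    exact ENNReal.tsum_le_tsum fun i => (h i).2

/-- The length of an injective differentiable curve is the integral of its speed. -/
theorem hausdorffMeasure_image_eq_lintegral {γ γ' : ℝ → ℂ} {s : Set ℝ} (hs : MeasurableSet s)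
    (hγ : ∀ x ∈ s, HasDerivWithinAt γ (γ' x) s x) (hm : Measurable γ') (hinj : InjOn γ s)
    (hfin : volume s ≠ ∞) :
    μH[1] (γ '' s) = ∫⁻ x in s, ‖γ' x‖ₑ := by
  have hc : ContinuousOn γ s := fun x hx => (hγ x hx).continuousWithinAt
  have main : ∀ ε : ℝ≥0, 0 < ε → μH[1] (γ '' s) ≤ (∫⁻ x in s, (‖γ' x‖ₑ + 3 * ε)) ∧
      ∫⁻ x in s, ‖γ' x‖ₑ ≤ μH[1] (γ '' s) + 3 * ε * volume s := by
    intro ε hε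
    -- First split so that `γ'` stays in one ball of radius `ε`, then so that `γ` is nearly affine.
    -- The slope of the affine map is some `γ' y` with `y` in the same piece, so it is within `2ε`
    -- of every `γ' x` there.
    set B : ℕ → Set ℝ := fun k => γ' ⁻¹' Metric.ball (TopologicalSpace.denseSeq ℂ k) ε
    have hBm : ∀ k, MeasurableSet (B k) := fun k => hm Metric.isOpen_ball.measurableSet
    have hBu : ⋃ k, B k = univ := by
      refine eq_univ_of_forall fun x => mem_iUnion.2 ?_
      obtain ⟨k, hk⟩ := (TopologicalSpace.denseRange_denseSeq ℂ).exists_dist_lt (γ' x)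
        (NNReal.coe_pos.2 hε)
      exact ⟨k, hk⟩
    refine hausdorffMeasure_image_of_iUnion (v := fun k => s ∩ disjointed B k) hc hinj
      (fun k => hs.inter (MeasurableSet.disjointed hBm k)) ?_ ?_ ?_
    · intro i j hij
      exact (disjoint_disjointed B hij).mono inter_subset_right inter_subset_right
    · rw [← inter_iUnion, iUnion_disjointed, hBu, inter_univ]
    intro k
    set s' := s ∩ disjointed B k with hs'
    have hs'm : MeasurableSet s' := hs.inter (MeasurableSet.disjointed hBm k)
    have hs's : s' ⊆ s := inter_subset_left
    have hball : ∀ x ∈ s', dist (γ' x) (TopologicalSpace.denseSeq ℂ k) < ε := fun x hx =>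
      disjointed_subset B k hx.2
    rcases s'.eq_empty_or_nonempty with he | hne
    · simp [he]
    obtain ⟨t, A, td, tm, st, tA, hA⟩ :=
      exists_partition_approximatesLinearOn_of_hasFDerivWithinAt γ s'
        (fun x => ContinuousLinearMap.toSpanSingleton ℝ (γ' x))
        (fun x hx => ((hγ x (hs's hx)).mono hs's).hasFDerivWithinAt) (fun _ => ε) (fun _ => hε.ne')
    refine hausdorffMeasure_image_of_iUnion (v := fun n => s' ∩ t n) (hc.mono hs's)
      (hinj.mono hs's) (fun n => hs'm.inter (tm n)) ?_ ?_ ?_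
    · intro i j hij
      exact (td hij).mono inter_subset_right inter_subset_right
    · rw [← inter_iUnion, inter_eq_left.2 st]
    intro n
    refine hausdorffMeasure_image_of_approximatesLinearOn (hs'm.inter (tm n)) (tA n) ?_
    intro x hx
    obtain ⟨y, hy, hy'⟩ := hA hne n
    have h1 := hball x hx.1
    have h2 := hball y hy
    have h3 : A n 1 = γ' y := by rw [hy']; simp
    rw [h3, ← dist_eq_norm]
    have := dist_triangle_right (γ' x) (γ' y) (TopologicalSpace.denseSeq ℂ k)
    linarith
  have hlim : Tendsto (fun n : ℕ => 3 * ((1 / (n + 1) : ℝ≥0) : ℝ≥0∞) * volume s) atTop (𝓝 0) := by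
    have h1 : Tendsto (fun n : ℕ => ((1 / (n + 1) : ℝ≥0) : ℝ≥0∞)) atTop (𝓝 ((0 : ℝ≥0) : ℝ≥0∞)) :=
      ENNReal.tendsto_coe.2 tendsto_one_div_add_atTop_nhds_zero_nat
    have h2 := ENNReal.Tendsto.const_mul (a := 3) h1 (Or.inr (by simp))
    have h3 := ENNReal.Tendsto.mul_const (b := volume s) h2 (Or.inr hfin)
    simpa using h3
  apply le_antisymm
  · have h1 := (tendsto_const_nhds (x := ∫⁻ x in s, ‖γ' x‖ₑ)).add hlim
    rw [add_zero] at h1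
    refine ge_of_tendsto' h1 fun n => ?_
    have h2 := (main (1 / (n + 1)) (by positivity)).1
    rw [lintegral_add_right _ measurable_const, setLIntegral_const] at h2
    exact h2
  · have h1 := (tendsto_const_nhds (x := μH[1] (γ '' s))).add hlim
    rw [add_zero] at h1
    exact ge_of_tendsto' h1 fun n => (main (1 / (n + 1)) (by positivity)).2

/-- Arclength on an injective differentiable curve is the image of the speed measure. -/
theorem map_withDensity_enorm_deriv_eq {γ γ' : ℝ → ℂ} {s : Set ℝ} (hs : MeasurableSet s)
    (hγ : ∀ x ∈ s, HasDerivWithinAt γ (γ' x) s x) (hm : Measurable γ') (hinj : InjOn γ s)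
    (hfin : volume s ≠ ∞) :
    Measure.map (s.domRestrict γ) (Measure.comap (↑) (volume.withDensity fun x => ‖γ' x‖ₑ)) =
      μH[1].restrict (γ '' s) := by
  have hc : ContinuousOn γ s := fun x hx => (hγ x hx).continuousWithinAt
  have hcr : Measurable (s.domRestrict γ) := hc.domRestrict.measurable
  ext t ht
  rw [Measure.map_apply hcr ht, Measure.restrict_apply ht,
    comap_subtype_coe_apply hs, withDensity_apply _ (hs.subtype_image (hcr ht))]
  have h1 : ((↑) : s → ℝ) '' (s.domRestrict γ ⁻¹' t) = s ∩ γ ⁻¹' t := by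
    ext x
    constructor
    · rintro ⟨⟨y, hy⟩, hyt, rfl⟩
      exact ⟨hy, hyt⟩
    · rintro ⟨hx, hxt⟩
      exact ⟨⟨x, hx⟩, hxt, rfl⟩
  have h2 : t ∩ γ '' s = γ '' (s ∩ γ ⁻¹' t) := by
    rw [inter_comm, image_inter_preimage]
  have h3 : MeasurableSet (s ∩ γ ⁻¹' t) := h1 ▸ hs.subtype_image (hcr ht)
  rw [h1, h2, hausdorffMeasure_image_eq_lintegral h3
    (fun x hx => (hγ x hx.1).mono inter_subset_left) hm (hinj.mono inter_subset_left)
    (measure_ne_top_of_subset inter_subset_left hfin)]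

section Curve

variable {γ γ' : ℝ → ℂ} {s : Set ℝ} {F : Type*} [NormedAddCommGroup F]

theorem integrableOn_image_iff_integrableOn_enorm_deriv_smul [NormedSpace ℝ F]
    (hs : MeasurableSet s)
    (hγ : ∀ x ∈ s, HasDerivWithinAt γ (γ' x) s x) (hm : Measurable γ') (hinj : InjOn γ s)
    (hfin : volume s ≠ ∞) (g : ℂ → F) :
    IntegrableOn g (γ '' s) μH[1] ↔ IntegrableOn (fun x => ‖γ' x‖ • g (γ x)) s := by
  have hc : ContinuousOn γ s := fun x hx => (hγ x hx).continuousWithinAt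
  rw [IntegrableOn, ← map_withDensity_enorm_deriv_eq hs hγ hm hinj hfin,
    (hc.measurableEmbedding hs hinj).integrable_map_iff]
  simp only [Set.domRestrict_eq, ← Function.comp_assoc]
  rw [← (MeasurableEmbedding.subtype_coe hs).integrable_map_iff, map_comap_subtype_coe hs,
    restrict_withDensity hs]
  exact integrable_withDensity_iff_integrable_coe_smul₀ (f := fun x => ‖γ' x‖₊)
    hm.nnnorm.aemeasurable

theorem integral_image_eq_integral_norm_deriv_smul [NormedSpace ℝ F] (hs : MeasurableSet s)
    (hγ : ∀ x ∈ s, HasDerivWithinAt γ (γ' x) s x) (hm : Measurable γ') (hinj : InjOn γ s)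
    (hfin : volume s ≠ ∞) (g : ℂ → F) :
    ∫ w in γ '' s, g w ∂μH[1] = ∫ x in s, ‖γ' x‖ • g (γ x) := by
  have hc : ContinuousOn γ s := fun x hx => (hγ x hx).continuousWithinAt
  rw [← map_withDensity_enorm_deriv_eq hs hγ hm hinj hfin,
    (hc.measurableEmbedding hs hinj).integral_map]
  simp only [Set.domRestrict_apply, ← Function.comp_apply (f := g)]
  rw [← (MeasurableEmbedding.subtype_coe hs).integral_map (g := g ∘ γ), map_comap_subtype_coe hs]
  exact setIntegral_withDensity_eq_setIntegral_smul₀ (f := fun x => ‖γ' x‖₊)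
    hm.nnnorm.aemeasurable _ hs

theorem aestronglyMeasurable_restrict_image (hs : MeasurableSet s)
    (hγ : ∀ x ∈ s, HasDerivWithinAt γ (γ' x) s x) (hm : Measurable γ') (hinj : InjOn γ s)
    (hfin : volume s ≠ ∞) {g : ℂ → F}
    (hg : AEStronglyMeasurable (g ∘ γ) (volume.restrict s)) :
    AEStronglyMeasurable g (μH[1].restrict (γ '' s)) := by
  have hc : ContinuousOn γ s := fun x hx => (hγ x hx).continuousWithinAt
  rw [← map_withDensity_enorm_deriv_eq hs hγ hm hinj hfin,
    (hc.measurableEmbedding hs hinj).aestronglyMeasurable_map_iff]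
  simp only [Set.domRestrict_eq, ← Function.comp_assoc]
  rw [← (MeasurableEmbedding.subtype_coe hs).aestronglyMeasurable_map_iff,
    map_comap_subtype_coe hs, restrict_withDensity hs]
  exact hg.mono_ac (withDensity_absolutelyContinuous _ _)

end Curve

end

section

/-! ### Polar parametrization of the boundary from an interior point -/

/-- The reciprocal of the distance from `z` to the boundary in the direction `e^{iθ}`. -/
def rayGauge (Ω : Set ℂ) (z : ℂ) (θ : ℝ) : ℝ :=
  gauge ((fun w => z + w) ⁻¹' Ω) (Complex.exp (θ * Complex.I))

/-- The directions, as angles in `(-π, π]`, in which the boundary is hit from `z`. -/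
def hitAngles (Ω : Set ℂ) (z : ℂ) : Set ℝ := {θ | θ ∈ Ioc (-Real.pi) Real.pi ∧ 0 < rayGauge Ω z θ}

/-- The point of the boundary seen from `z` in the direction `e^{iθ}`. -/
def polarCurve (Ω : Set ℂ) (z : ℂ) (θ : ℝ) : ℂ :=
  z + ((rayGauge Ω z θ)⁻¹ : ℝ) * Complex.exp (θ * Complex.I)

theorem rayGauge_nonneg (Ω : Set ℂ) (z : ℂ) (θ : ℝ) : 0 ≤ rayGauge Ω z θ := gauge_nonneg _

theorem lipschitzWith_exp_mul_I : LipschitzWith 1 (fun θ : ℝ => Complex.exp (θ * Complex.I)) := by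
  refine lipschitzWith_of_nnnorm_deriv_le (𝕜 := ℝ) ?_ ?_
  · fun_prop
  · intro θ
    have : HasDerivAt (fun θ : ℝ => Complex.exp (θ * Complex.I))
        (Complex.exp (θ * Complex.I) * (1 * Complex.I)) θ :=
      ((Complex.ofRealCLM.hasDerivAt (x := θ)).mul_const Complex.I).cexp
    rw [this.deriv, ← NNReal.coe_le_coe]
    simp

section

variable {Ω : Set ℂ} {z : ℂ}

theorem convex_translate (hconv : Convex ℝ Ω) : Convex ℝ ((fun w => z + w) ⁻¹' Ω) :=
  hconv.translate_preimage_right z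

theorem translate_mem_nhds (hopen : IsOpen Ω) (hz : z ∈ Ω) :
    ((fun w => z + w) ⁻¹' Ω) ∈ 𝓝 (0 : ℂ) :=
  (hopen.preimage (by fun_prop)).mem_nhds (by simpa using hz)

theorem gauge_translate_eq_one_iff (hopen : IsOpen Ω) (hconv : Convex ℝ Ω) (hz : z ∈ Ω) (w : ℂ) :
    gauge ((fun w => z + w) ⁻¹' Ω) w = 1 ↔ z + w ∈ frontier Ω := by
  rw [gauge_eq_one_iff_mem_frontier (convex_translate hconv) (translate_mem_nhds hopen hz),
    show (fun w => z + w) = Homeomorph.addLeft z from rfl,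
    ← (Homeomorph.addLeft z).preimage_frontier Ω]
  rfl

theorem gauge_translate_le_one_iff (hopen : IsOpen Ω) (hconv : Convex ℝ Ω) (hz : z ∈ Ω) (w : ℂ) :
    gauge ((fun w => z + w) ⁻¹' Ω) w ≤ 1 ↔ z + w ∈ closure Ω := by
  rw [gauge_le_one_iff_mem_closure (convex_translate hconv) (translate_mem_nhds hopen hz),
    show (fun w => z + w) = Homeomorph.addLeft z from rfl,
    ← (Homeomorph.addLeft z).preimage_closure Ω]
  rfl

theorem gauge_translate_mul_exp {t : ℝ} (ht : 0 ≤ t) (θ : ℝ) :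
    gauge ((fun w => z + w) ⁻¹' Ω) (t * Complex.exp (θ * Complex.I)) = t * rayGauge Ω z θ := by
  rw [← Complex.real_smul, gauge_smul_of_nonneg ht]; rfl

theorem add_mul_exp_mem_closure_iff (hopen : IsOpen Ω) (hconv : Convex ℝ Ω) (hz : z ∈ Ω) {t : ℝ}
    (ht : 0 ≤ t) (θ : ℝ) :
    z + t * Complex.exp (θ * Complex.I) ∈ closure Ω ↔ t * rayGauge Ω z θ ≤ 1 := by
  rw [← gauge_translate_le_one_iff hopen hconv hz, gauge_translate_mul_exp ht]

/-- The translate of `Ω` is a convex neighbourhood of `0`, so its gauge is Lipschitz. By Rademacher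
the polar parametrization is then differentiable at almost every hit angle. -/
theorem exists_lipschitzWith_rayGauge (hopen : IsOpen Ω) (hconv : Convex ℝ Ω) (hz : z ∈ Ω) :
    ∃ K, LipschitzWith K (rayGauge Ω z) := by
  obtain ⟨K, hK⟩ := (convex_translate (z := z) hconv).lipschitz_gauge (translate_mem_nhds hopen hz)
  exact ⟨K * 1, hK.comp lipschitzWith_exp_mul_I⟩

theorem continuous_rayGauge (hopen : IsOpen Ω) (hconv : Convex ℝ Ω) (hz : z ∈ Ω) :
    Continuous (rayGauge Ω z) :=
  (exists_lipschitzWith_rayGauge hopen hconv hz).choose_spec.continuous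

theorem measurableSet_hitAngles (hopen : IsOpen Ω) (hconv : Convex ℝ Ω) (hz : z ∈ Ω) :
    MeasurableSet (hitAngles Ω z) :=
  measurableSet_Ioc.inter
    ((isOpen_Ioi.preimage (continuous_rayGauge hopen hconv hz)).measurableSet)

theorem volume_hitAngles_ne_top : volume (hitAngles Ω z) ≠ ∞ :=
  measure_ne_top_of_subset (show hitAngles Ω z ⊆ Ioc (-Real.pi) Real.pi from fun _ h => h.1)
    measure_Ioc_lt_top.ne

theorem polarCurve_mem_frontier (hopen : IsOpen Ω) (hconv : Convex ℝ Ω) (hz : z ∈ Ω) {θ : ℝ}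
    (hθ : 0 < rayGauge Ω z θ) : polarCurve Ω z θ ∈ frontier Ω := by
  rw [polarCurve, ← gauge_translate_eq_one_iff hopen hconv hz,
    gauge_translate_mul_exp (by positivity), inv_mul_cancel₀ hθ.ne']

theorem image_polarCurve (hopen : IsOpen Ω) (hconv : Convex ℝ Ω) (hz : z ∈ Ω) :
    polarCurve Ω z '' hitAngles Ω z = frontier Ω := by
  apply Subset.antisymm
  · rintro _ ⟨θ, hθ, rfl⟩
    exact polarCurve_mem_frontier hopen hconv hz hθ.2
  · intro σ hσ
    have h1 : gauge ((fun w => z + w) ⁻¹' Ω) (σ - z) = 1 := by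
      rw [gauge_translate_eq_one_iff hopen hconv hz]; simpa using hσ
    have h2 : (σ - z) = (‖σ - z‖ : ℝ) * Complex.exp (Complex.arg (σ - z) * Complex.I) :=
      (Complex.norm_mul_exp_arg_mul_I _).symm
    rw [h2, gauge_translate_mul_exp (norm_nonneg _)] at h1
    have h3 : 0 < rayGauge Ω z (Complex.arg (σ - z)) := by
      refine lt_of_le_of_ne (rayGauge_nonneg _ _ _) fun h => ?_
      rw [← h] at h1; simp at h1
    refine ⟨Complex.arg (σ - z), ⟨Complex.arg_mem_Ioc _, h3⟩, ?_⟩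
    rw [polarCurve, ← eq_inv_of_mul_eq_one_left h1, ← h2]; ring

theorem injOn_polarCurve : InjOn (polarCurve Ω z) (hitAngles Ω z) := by
  intro θ hθ η hη h
  have key : ∀ θ ∈ hitAngles Ω z, Complex.arg (polarCurve Ω z θ - z) = θ := by
    intro θ hθ
    rw [polarCurve, add_sub_cancel_left]
    exact Complex.arg_mul_cos_add_sin_mul_I (inv_pos.2 hθ.2) hθ.1 |> fun h => by
      rwa [← Complex.exp_mul_I] at h
  rw [← key θ hθ, ← key η hη, h]

/-- The angles at which the polar parametrization is differentiable. -/
def smoothAngles (Ω : Set ℂ) (z : ℂ) : Set ℝ :=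
  hitAngles Ω z ∩ {θ | DifferentiableAt ℝ (rayGauge Ω z) θ}

theorem measurableSet_smoothAngles (hopen : IsOpen Ω) (hconv : Convex ℝ Ω) (hz : z ∈ Ω) :
    MeasurableSet (smoothAngles Ω z) :=
  (measurableSet_hitAngles hopen hconv hz).inter (measurableSet_of_differentiableAt ℝ _)

theorem volume_smoothAngles_ne_top : volume (smoothAngles Ω z) ≠ ∞ :=
  measure_ne_top_of_subset inter_subset_left volume_hitAngles_ne_top

theorem volume_hitAngles_diff_smoothAngles (hopen : IsOpen Ω) (hconv : Convex ℝ Ω) (hz : z ∈ Ω) :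
    volume (hitAngles Ω z \ smoothAngles Ω z) = 0 := by
  obtain ⟨K, hK⟩ := exists_lipschitzWith_rayGauge hopen hconv hz
  have h := hK.ae_differentiableAt_real
  rw [ae_iff] at h
  refine measure_mono_null ?_ h
  rintro θ ⟨h1, h2⟩
  exact fun h3 => h2 ⟨h1, h3⟩

theorem smoothAngles_ae_eq (hopen : IsOpen Ω) (hconv : Convex ℝ Ω) (hz : z ∈ Ω) :
    smoothAngles Ω z =ᵐ[volume] hitAngles Ω z := by
  refine (ae_le_set.2 ?_).antisymm (ae_le_set.2 (volume_hitAngles_diff_smoothAngles hopen hconv hz))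
  rw [sdiff_eq_empty.2 (show smoothAngles Ω z ⊆ hitAngles Ω z from inter_subset_left),
    measure_empty]

/-- The velocity of the polar parametrization. -/
theorem hasDerivAt_polarCurve {θ : ℝ} (hθ : θ ∈ smoothAngles Ω z) :
    HasDerivAt (polarCurve Ω z)
      (((-(deriv (rayGauge Ω z) θ) / rayGauge Ω z θ ^ 2 : ℝ) + ((rayGauge Ω z θ)⁻¹ : ℝ) * Complex.I)
        * Complex.exp (θ * Complex.I)) θ := by
  have h1 : HasDerivAt (fun θ : ℝ => Complex.exp (θ * Complex.I))
      (Complex.exp (θ * Complex.I) * (1 * Complex.I)) θ :=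
    ((Complex.ofRealCLM.hasDerivAt (x := θ)).mul_const Complex.I).cexp
  have h2 : HasDerivAt (fun θ => (rayGauge Ω z θ)⁻¹) _ θ :=
    HasDerivAt.fun_inv hθ.2.hasDerivAt hθ.1.2.ne'
  have h3 := (h2.ofReal_comp.mul h1).const_add z
  convert! h3 using 1
  ring

/-- Where the gauge tends to `0` the boundary runs off to infinity and the polar curve is not
Lipschitz. It is Lipschitz on each set where the gauge exceeds `1/(n+1)`, and there it maps null
sets to null sets. -/
theorem hausdorffMeasure_image_nonsmooth (hopen : IsOpen Ω) (hconv : Convex ℝ Ω) (hz : z ∈ Ω) :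
    μH[1] (polarCurve Ω z '' (hitAngles Ω z \ smoothAngles Ω z)) = 0 := by
  obtain ⟨K, hK⟩ := exists_lipschitzWith_rayGauge hopen hconv hz
  have hsub : polarCurve Ω z '' (hitAngles Ω z \ smoothAngles Ω z) ⊆
      ⋃ n : ℕ, polarCurve Ω z ''
        ((hitAngles Ω z \ smoothAngles Ω z) ∩ {θ | 1 / ((n : ℝ) + 1) < rayGauge Ω z θ}) := by
    rintro _ ⟨θ, hθ, rfl⟩
    obtain ⟨n, hn⟩ := exists_nat_one_div_lt hθ.1.2
    exact mem_iUnion.2 ⟨n, θ, ⟨hθ, hn⟩, rfl⟩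
  refine measure_mono_null hsub (measure_iUnion_null fun n => ?_)
  set ε : ℝ := 1 / ((n : ℝ) + 1) with hε
  have hε0 : 0 < ε := by positivity
  have hL : LipschitzOnWith (K * (ε⁻¹ ^ 2).toNNReal + (ε⁻¹).toNNReal) (polarCurve Ω z)
      ((hitAngles Ω z \ smoothAngles Ω z) ∩ {θ | ε < rayGauge Ω z θ}) := by
    refine LipschitzOnWith.of_dist_le_mul fun x hx y hy => ?_
    have hx' : ε < rayGauge Ω z x := hx.2
    have hy' : ε < rayGauge Ω z y := hy.2
    have hx0 : 0 < rayGauge Ω z x := hε0.trans hx'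
    have hy0 : 0 < rayGauge Ω z y := hε0.trans hy'
    have e1 : polarCurve Ω z x - polarCurve Ω z y =
        (((rayGauge Ω z x)⁻¹ - (rayGauge Ω z y)⁻¹ : ℝ) : ℂ) * Complex.exp (x * Complex.I) +
        ((rayGauge Ω z y)⁻¹ : ℝ) * (Complex.exp (x * Complex.I) - Complex.exp (y * Complex.I)) := by
      simp only [polarCurve]; push_cast; ring
    have hexp := lipschitzWith_exp_mul_I.dist_le_mul x y
    have hp := hK.dist_le_mul x y
    rw [dist_eq_norm] at hexp
    have hix : (rayGauge Ω z x)⁻¹ ≤ ε⁻¹ := inv_anti₀ hε0 hx'.le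
    have hiy : (rayGauge Ω z y)⁻¹ ≤ ε⁻¹ := inv_anti₀ hε0 hy'.le
    have e2 : |(rayGauge Ω z x)⁻¹ - (rayGauge Ω z y)⁻¹| ≤ K * dist x y * ε⁻¹ ^ 2 := by
      have : (rayGauge Ω z x)⁻¹ - (rayGauge Ω z y)⁻¹ =
          (rayGauge Ω z y - rayGauge Ω z x) * ((rayGauge Ω z x)⁻¹ * (rayGauge Ω z y)⁻¹) := by
        field_simp
      rw [this, abs_mul, abs_of_pos (a := (rayGauge Ω z x)⁻¹ * (rayGauge Ω z y)⁻¹) (by positivity),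
        abs_sub_comm, ← Real.dist_eq, sq]
      gcongr
    rw [dist_eq_norm, e1]
    refine (norm_add_le _ _).trans ?_
    rw [norm_mul, norm_mul, Complex.norm_exp_ofReal_mul_I, Complex.norm_real, Complex.norm_real,
      Real.norm_eq_abs, Real.norm_eq_abs, abs_of_pos (inv_pos.2 hy0), NNReal.coe_add,
      NNReal.coe_mul, Real.coe_toNNReal _ (by positivity), Real.coe_toNNReal _ (by positivity),
      add_mul, mul_one]
    refine add_le_add (e2.trans (le_of_eq (by ring))) ?_
    have : ‖Complex.exp (x * Complex.I) - Complex.exp (y * Complex.I)‖ ≤ dist x y := by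
      simpa using hexp
    gcongr
  have h1 := hL.hausdorffMeasure_image_le zero_le_one
  rw [hausdorffMeasure_real] at h1
  refine le_antisymm (h1.trans (le_of_eq ?_)) (zero_le)
  rw [measure_mono_null inter_subset_left (volume_hitAngles_diff_smoothAngles hopen hconv hz),
    mul_zero]

theorem restrict_frontier_eq (hopen : IsOpen Ω) (hconv : Convex ℝ Ω) (hz : z ∈ Ω) :
    (μH[1] : Measure ℂ).restrict (frontier Ω) =
      μH[1].restrict (polarCurve Ω z '' smoothAngles Ω z) := by
  refine Measure.restrict_congr_set ?_
  refine (ae_le_set.2 ?_).antisymm (ae_le_set.2 ?_)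
  · refine measure_mono_null ?_ (hausdorffMeasure_image_nonsmooth hopen hconv hz)
    rw [← image_polarCurve hopen hconv hz]
    rintro _ ⟨⟨θ, hθ, rfl⟩, h2⟩
    exact ⟨θ, ⟨hθ, fun h => h2 ⟨θ, h, rfl⟩⟩, rfl⟩
  · rw [sdiff_eq_empty.2, measure_empty]
    rw [← image_polarCurve hopen hconv hz]
    exact image_mono inter_subset_left

/-! ### The outward normal -/

theorem IsOuterNormal.re_le_of_mem_closure {Ω : Set ℂ} {σ ν : ℂ} (h : IsOuterNormal Ω σ ν) {w : ℂ}
    (hw : w ∈ closure Ω) : ((starRingEnd ℂ) ν * (w - σ)).re ≤ 0 := by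
  refine closure_minimal (s := Ω) (t := {w | ((starRingEnd ℂ) ν * (w - σ)).re ≤ 0}) h.2 ?_ hw
  exact isClosed_le (by fun_prop) (by fun_prop)

theorem exists_isOuterNormal (hopen : IsOpen Ω) (hconv : Convex ℝ Ω) (hne : Ω.Nonempty) {σ : ℂ}
    (hσ : σ ∉ Ω) : ∃ ν, IsOuterNormal Ω σ ν := by
  obtain ⟨f, hf⟩ := geometric_hahn_banach_open_point hconv hopen hσ
  -- A real linear functional on `ℂ` is `w ↦ Re (v̄ w)`; the normal is the normalized `v`.
  have hrep : ∀ w : ℂ, f w = ((starRingEnd ℂ) (f 1 + f Complex.I * Complex.I) * w).re := by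
    intro w
    have : w = w.re • (1 : ℂ) + w.im • Complex.I := by
      simp [Complex.re_add_im]
    conv_lhs => rw [this]
    simp only [map_add, map_smul, smul_eq_mul]
    simp [Complex.add_re, Complex.mul_re]
    ring
  set v : ℂ := f 1 + f Complex.I * Complex.I with hv
  have hv0 : v ≠ 0 := by
    rintro h0
    obtain ⟨w, hw⟩ := hne
    have := hf w hw
    rw [hrep, hrep, h0] at this
    simp at this
  have hn : 0 < ‖v‖ := norm_pos_iff.2 hv0
  refine ⟨(‖v‖⁻¹ : ℝ) * v, ?_, fun w hw => ?_⟩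
  · rw [norm_mul, Complex.norm_real, Real.norm_eq_abs, abs_of_pos (inv_pos.2 hn),
      inv_mul_cancel₀ hn.ne']
  · have h1 := hf w hw
    rw [hrep, hrep] at h1
    have : ((starRingEnd ℂ) ((‖v‖⁻¹ : ℝ) * v) * (w - σ)).re =
        ‖v‖⁻¹ * (((starRingEnd ℂ) v * w).re - ((starRingEnd ℂ) v * σ).re) := by
      rw [map_mul, Complex.conj_ofReal, mul_assoc, Complex.re_ofReal_mul, mul_sub, Complex.sub_re]
    rw [this]
    have : 0 < ‖v‖⁻¹ := inv_pos.2 hn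
    nlinarith

theorem isOuterNormal_outerNormal_or_eq_zero (Ω : Set ℂ) (σ : ℂ) :
    IsOuterNormal Ω σ (outerNormal Ω σ) ∨ outerNormal Ω σ = 0 := by
  unfold outerNormal
  split_ifs with h
  · exact Or.inl h.choose_spec.1
  · exact Or.inr rfl

theorem norm_outerNormal_le (Ω : Set ℂ) (σ : ℂ) : ‖outerNormal Ω σ‖ ≤ 1 := by
  rcases isOuterNormal_outerNormal_or_eq_zero Ω σ with h | h
  · exact h.1.le
  · simp [h]

theorem re_conj_outerNormal_mul_le {σ w : ℂ} (hw : w ∈ closure Ω) :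
    ((starRingEnd ℂ) (outerNormal Ω σ) * (w - σ)).re ≤ 0 := by
  rcases isOuterNormal_outerNormal_or_eq_zero Ω σ with h | h
  · exact h.re_le_of_mem_closure hw
  · simp [h]

/-- At a point of differentiability every outward normal is the rotated unit tangent. -/
theorem IsOuterNormal.eq_of_mem_smoothAngles (hopen : IsOpen Ω) (hconv : Convex ℝ Ω) (hz : z ∈ Ω)
    {θ : ℝ} (hθ : θ ∈ smoothAngles Ω z) {ν : ℂ} (hν : IsOuterNormal Ω (polarCurve Ω z θ) ν) :
    ν = -Complex.I * deriv (polarCurve Ω z) θ / ‖deriv (polarCurve Ω z) θ‖ := by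
  have hd := hasDerivAt_polarCurve hθ
  set p := rayGauge Ω z θ with hp
  have hp0 : 0 < p := hθ.1.2
  set e := Complex.exp (θ * Complex.I) with he
  have hne : ‖e‖ = 1 := Complex.norm_exp_ofReal_mul_I θ
  set r' : ℝ := -(deriv (rayGauge Ω z) θ) / p ^ 2 with hr'
  rw [hd.deriv]
  -- The supporting functional is maximal on the curve at `θ`, so the normal is orthogonal to the
  -- velocity. The sign comes from `z`, which lies on the inner side.
  have hloc : IsLocalMax
      (fun η => ((starRingEnd ℂ) ν * (polarCurve Ω z η - polarCurve Ω z θ)).re) θ := by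
    have hev : ∀ᶠ η in 𝓝 θ, 0 < rayGauge Ω z η :=
      (continuous_rayGauge hopen hconv hz).continuousAt.eventually (lt_mem_nhds hp0)
    filter_upwards [hev] with η hη
    rw [sub_self, mul_zero, Complex.zero_re]
    exact hν.re_le_of_mem_closure (polarCurve_mem_frontier hopen hconv hz hη).1
  have hder : HasDerivAt (fun η => ((starRingEnd ℂ) ν * (polarCurve Ω z η - polarCurve Ω z θ)).re)
      (((starRingEnd ℂ) ν * ((r' + (p⁻¹ : ℝ) * Complex.I) * e)).re) θ := by
    have := Complex.reCLM.hasFDerivAt.comp_hasDerivAt θ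
      ((hd.sub_const (polarCurve Ω z θ)).const_mul ((starRingEnd ℂ) ν))
    exact this
  have h0 := hloc.hasDerivAt_eq_zero hder
  have hz' := hν.re_le_of_mem_closure (subset_closure hz)
  have hzz : z - polarCurve Ω z θ = -((p⁻¹ : ℝ) * e) := by
    simp [polarCurve, hp, he]
  rw [hzz] at hz'
  -- In the frame rotated by `e`, orthogonality to `r' + iρ`, a nonnegative real part and modulus
  -- one determine `u`.
  set u : ℂ := (starRingEnd ℂ) ν * e with hu
  have hun : ‖u‖ = 1 := by rw [hu, norm_mul, RCLike.norm_conj, hν.1, hne, mul_one]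
  set ρ : ℝ := p⁻¹ with hρ
  have hρ0 : 0 < ρ := inv_pos.2 hp0
  have h1 : u.re * r' - u.im * ρ = 0 := by
    have : (starRingEnd ℂ) ν * ((r' + (ρ : ℝ) * Complex.I) * e) =
      u * (r' + ρ * Complex.I) := by rw [hu]; ring
    rw [this] at h0
    simpa [Complex.mul_re] using h0
  have h2 : 0 ≤ u.re := by
    have : (starRingEnd ℂ) ν * (-((ρ : ℝ) * e)) = ((-ρ : ℝ) : ℂ) * u := by
      rw [hu]; push_cast; ring
    rw [this, Complex.re_ofReal_mul] at hz'
    nlinarith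
  have h3 : u.re ^ 2 + u.im ^ 2 = 1 := by
    have : ‖u‖ ^ 2 = 1 := by rw [hun]; norm_num
    rw [Complex.sq_norm, Complex.normSq_apply] at this
    nlinarith
  set N : ℝ := ‖((r' : ℂ) + (ρ : ℝ) * Complex.I) * e‖ with hN
  have hN2 : N ^ 2 = r' ^ 2 + ρ ^ 2 := by
    rw [hN, norm_mul, hne, mul_one, Complex.sq_norm, Complex.normSq_add_mul_I]
  have hN0 : 0 < N := by
    have : 0 ≤ N := norm_nonneg _
    rcases this.lt_or_eq with h | h
    · exact h
    · rw [← h] at hN2; nlinarith [sq_nonneg r', sq_pos_of_pos hρ0]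
  have h4 : u.re * N = ρ := by
    have : (u.re * N) ^ 2 = ρ ^ 2 := by
      have : u.im * ρ = u.re * r' := by linarith
      calc (u.re * N) ^ 2 = (u.re * r') ^ 2 + u.re ^ 2 * ρ ^ 2 := by rw [mul_pow, hN2]; ring
        _ = (u.re ^ 2 + u.im ^ 2) * ρ ^ 2 := by rw [← this]; ring
        _ = ρ ^ 2 := by rw [h3, one_mul]
    exact (pow_left_inj₀ (mul_nonneg h2 hN0.le) hρ0.le two_ne_zero).1 this
  have h5 : u.im * N = r' := by
    have : (u.im * N) * ρ = r' * ρ := by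
      calc (u.im * N) * ρ = (u.im * ρ) * N := by ring
        _ = (u.re * r') * N := by rw [show u.im * ρ = u.re * r' by linarith]
        _ = (u.re * N) * r' := by ring
        _ = r' * ρ := by rw [h4]; ring
    exact mul_right_cancel₀ hρ0.ne' this
  have h6 : u * N = ρ + r' * Complex.I := by
    apply Complex.ext <;> simp [h4, h5]
  have h7 : ν * N = (starRingEnd ℂ) (u * N) * e := by
    rw [hu, map_mul, map_mul, Complex.conj_conj, Complex.conj_ofReal]
    have : (starRingEnd ℂ) e * e = 1 := by
      rw [mul_comm, Complex.mul_conj, Complex.normSq_eq_norm_sq, hne]; norm_num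
    linear_combination (-ν * N) * this
  have hNc : (N : ℂ) ≠ 0 := by exact_mod_cast hN0.ne'
  rw [eq_div_iff hNc, h7, h6]
  simp only [map_add, map_mul, Complex.conj_ofReal, Complex.conj_I]
  linear_combination ((ρ : ℂ) * e) * Complex.I_sq

theorem outerNormal_polarCurve (hopen : IsOpen Ω) (hconv : Convex ℝ Ω) (hz : z ∈ Ω)
    {θ : ℝ} (hθ : θ ∈ smoothAngles Ω z) :
    outerNormal Ω (polarCurve Ω z θ) =
      -Complex.I * deriv (polarCurve Ω z) θ / ‖deriv (polarCurve Ω z) θ‖ := by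
  have hσ : polarCurve Ω z θ ∉ Ω := by
    have h := polarCurve_mem_frontier hopen hconv hz hθ.1.2
    rw [hopen.frontier_eq] at h
    exact h.2
  obtain ⟨ν, hν⟩ := exists_isOuterNormal hopen hconv ⟨z, hz⟩ hσ
  have h : ∃! ν, IsOuterNormal Ω (polarCurve Ω z θ) ν :=
    ⟨ν, hν, fun ν' hν' => (hν'.eq_of_mem_smoothAngles hopen hconv hz hθ).trans
      (hν.eq_of_mem_smoothAngles hopen hconv hz hθ).symm⟩
  rw [outerNormal, dif_pos h]
  exact h.choose_spec.1.eq_of_mem_smoothAngles hopen hconv hz hθ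

/-- With `γ' = (r' + iρ)e^{iθ}` and `γ - z = ρe^{iθ}`, the left side is `(1/π) Re(-iγ'/(γ - z)) =
1/π`: the kernel is the differential of the angle. -/
theorem norm_deriv_mul_kernel (hopen : IsOpen Ω) (hconv : Convex ℝ Ω) (hz : z ∈ Ω)
    {θ : ℝ} (hθ : θ ∈ smoothAngles Ω z) :
    ‖deriv (polarCurve Ω z) θ‖ * kernel Ω (polarCurve Ω z θ) z = 1 / Real.pi := by
  have hd := hasDerivAt_polarCurve hθ
  have hp0 : 0 < rayGauge Ω z θ := hθ.1.2
  rw [kernel, outerNormal_polarCurve hopen hconv hz hθ, hd.deriv]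
  set r' : ℝ := -(deriv (rayGauge Ω z) θ) / rayGauge Ω z θ ^ 2 with hr'
  have hzz : polarCurve Ω z θ - z = ((rayGauge Ω z θ)⁻¹ : ℝ) * Complex.exp (θ * Complex.I) := by
    simp [polarCurve]
  set ρ : ℝ := (rayGauge Ω z θ)⁻¹ with hρ
  have hρ0 : 0 < ρ := inv_pos.2 hp0
  rw [← map_sub, hzz]
  set e := Complex.exp (θ * Complex.I) with he
  have hne : ‖e‖ = 1 := Complex.norm_exp_ofReal_mul_I θ
  have he0 : e ≠ 0 := Complex.exp_ne_zero _
  have hce0 : (starRingEnd ℂ) e ≠ 0 := by simpa using he0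
  have hN0 : ‖((r' : ℂ) + (ρ : ℝ) * Complex.I) * e‖ ≠ 0 := by
    rw [norm_ne_zero_iff]
    refine mul_ne_zero (fun h => ?_) he0
    have := congrArg Complex.im h
    simp at this
    exact hρ0.ne' this
  set N : ℝ := ‖((r' : ℂ) + (ρ : ℝ) * Complex.I) * e‖ with hN
  have hNc : (N : ℂ) ≠ 0 := by exact_mod_cast hN0
  have hρc : (ρ : ℂ) ≠ 0 := by exact_mod_cast hρ0.ne'
  have hπ : (Real.pi : ℂ) ≠ 0 := by exact_mod_cast Real.pi_ne_zero
  simp only [map_div₀, map_mul, map_neg, map_add, Complex.conj_ofReal, Complex.conj_I]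
  field_simp
  linear_combination (-2 * (ρ : ℂ)) * Complex.I_sq

/-! ### Integrals over the boundary -/

theorem integrableOn_frontier_iff {F : Type*} [NormedAddCommGroup F] [NormedSpace ℝ F]
    (hopen : IsOpen Ω) (hconv : Convex ℝ Ω) (hz : z ∈ Ω) (g : ℂ → F) :
    IntegrableOn g (frontier Ω) μH[1] ↔
      IntegrableOn (fun θ => ‖deriv (polarCurve Ω z) θ‖ • g (polarCurve Ω z θ))
        (smoothAngles Ω z) := by
  rw [IntegrableOn, restrict_frontier_eq hopen hconv hz]
  exact integrableOn_image_iff_integrableOn_enorm_deriv_smul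
    (measurableSet_smoothAngles hopen hconv hz)
    (fun x hx => (hasDerivAt_polarCurve hx).differentiableAt.hasDerivAt.hasDerivWithinAt)
    (measurable_deriv _) (injOn_polarCurve.mono inter_subset_left) volume_smoothAngles_ne_top g

theorem integral_frontier_eq {F : Type*} [NormedAddCommGroup F] [NormedSpace ℝ F]
    (hopen : IsOpen Ω) (hconv : Convex ℝ Ω) (hz : z ∈ Ω) (g : ℂ → F) :
    ∫ σ in frontier Ω, g σ ∂μH[1] =
      ∫ θ in smoothAngles Ω z, ‖deriv (polarCurve Ω z) θ‖ • g (polarCurve Ω z θ) := by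
  rw [restrict_frontier_eq hopen hconv hz]
  exact integral_image_eq_integral_norm_deriv_smul
    (measurableSet_smoothAngles hopen hconv hz)
    (fun x hx => (hasDerivAt_polarCurve hx).differentiableAt.hasDerivAt.hasDerivWithinAt)
    (measurable_deriv _) (injOn_polarCurve.mono inter_subset_left) volume_smoothAngles_ne_top g

theorem aestronglyMeasurable_outerNormal (hopen : IsOpen Ω) (hconv : Convex ℝ Ω) (hz : z ∈ Ω) :
    AEStronglyMeasurable (outerNormal Ω) ((μH[1] : Measure ℂ).restrict (frontier Ω)) := by
  rw [restrict_frontier_eq hopen hconv hz]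
  refine aestronglyMeasurable_restrict_image
    (measurableSet_smoothAngles hopen hconv hz)
    (fun x hx => (hasDerivAt_polarCurve hx).differentiableAt.hasDerivAt.hasDerivWithinAt)
    (measurable_deriv _) (injOn_polarCurve.mono inter_subset_left) volume_smoothAngles_ne_top ?_
  have hm : Measurable fun θ => -Complex.I * deriv (polarCurve Ω z) θ /
      (‖deriv (polarCurve Ω z) θ‖ : ℂ) := by
    have := measurable_deriv (polarCurve Ω z)
    fun_prop
  refine hm.aestronglyMeasurable.congr ?_
  filter_upwards [ae_restrict_mem (measurableSet_smoothAngles hopen hconv hz)] with θ hθ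
  exact (outerNormal_polarCurve hopen hconv hz hθ).symm

/-- In polar coordinates, with `p` the gauge, the integrand is `|γ'| p² ≤ |p'| + p`, which is
bounded. This is the dominating function for all differences of kernels and resolvents, even when
the boundary has infinite length. -/
theorem integrableOn_inv_sq_frontier (hopen : IsOpen Ω) (hconv : Convex ℝ Ω) (hz : z ∈ Ω) :
    IntegrableOn (fun σ => (‖σ - z‖ ^ 2)⁻¹) (frontier Ω) μH[1] := by
  rw [integrableOn_frontier_iff hopen hconv hz]
  obtain ⟨K, hK⟩ := exists_lipschitzWith_rayGauge hopen hconv hz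
  have hcont := continuous_rayGauge hopen hconv hz
  have hm : Measurable fun θ => ‖deriv (polarCurve Ω z) θ‖ • (‖polarCurve Ω z θ - z‖ ^ 2)⁻¹ := by
    have h1 := measurable_deriv (polarCurve Ω z)
    have h2 : Measurable (polarCurve Ω z) := by
      have := hcont.measurable
      unfold polarCurve
      fun_prop
    exact h1.norm.smul ((h2.sub_const z).norm.pow_const 2).inv
  obtain ⟨C, hC⟩ := (isCompact_Icc (a := -Real.pi) (b := Real.pi)).exists_bound_of_continuousOn
    hcont.continuousOn
  refine IntegrableOn.of_bound volume_smoothAngles_ne_top.lt_top hm.aestronglyMeasurable (K + C) ?_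
  filter_upwards [ae_restrict_mem (measurableSet_smoothAngles hopen hconv hz)] with θ hθ
  have hp0 : 0 < rayGauge Ω z θ := hθ.1.2
  have hd := hasDerivAt_polarCurve hθ
  have h1 : ‖polarCurve Ω z θ - z‖ = (rayGauge Ω z θ)⁻¹ := by
    rw [polarCurve, add_sub_cancel_left, norm_mul, Complex.norm_exp_ofReal_mul_I, mul_one,
      Complex.norm_real, Real.norm_eq_abs, abs_of_pos (inv_pos.2 hp0)]
  have h2 : ‖deriv (rayGauge Ω z) θ‖ ≤ K := norm_deriv_le_of_lipschitz hK
  have h3 : rayGauge Ω z θ ≤ C := (le_abs_self _).trans (hC θ ⟨hθ.1.1.1.le, hθ.1.1.2⟩)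
  have h4 : ‖deriv (polarCurve Ω z) θ‖ ≤
      ‖deriv (rayGauge Ω z) θ‖ / rayGauge Ω z θ ^ 2 + (rayGauge Ω z θ)⁻¹ := by
    rw [hd.deriv, norm_mul, Complex.norm_exp_ofReal_mul_I, mul_one]
    refine (norm_add_le _ _).trans (le_of_eq ?_)
    rw [norm_mul, Complex.norm_I, Complex.norm_real, Complex.norm_real, mul_one, norm_div, norm_neg,
      norm_pow, norm_inv, Real.norm_of_nonneg hp0.le]
  rw [h1, smul_eq_mul, norm_mul, norm_norm, inv_pow, inv_inv, norm_pow, Real.norm_of_nonneg hp0.le]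
  calc ‖deriv (polarCurve Ω z) θ‖ * rayGauge Ω z θ ^ 2
      ≤ (‖deriv (rayGauge Ω z) θ‖ / rayGauge Ω z θ ^ 2 + (rayGauge Ω z θ)⁻¹) *
        rayGauge Ω z θ ^ 2 := by gcongr
    _ = ‖deriv (rayGauge Ω z) θ‖ + rayGauge Ω z θ := by field_simp
    _ ≤ K + C := add_le_add h2 h3

theorem norm_deriv_smul_mul_kernel (hopen : IsOpen Ω) (hconv : Convex ℝ Ω) (hz : z ∈ Ω)
    (F : ℂ → ℂ) {θ : ℝ} (hθ : θ ∈ smoothAngles Ω z) :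
    ‖deriv (polarCurve Ω z) θ‖ • (F (polarCurve Ω z θ) * kernel Ω (polarCurve Ω z θ) z) =
      1 / Real.pi * F (polarCurve Ω z θ) := by
  rw [← norm_deriv_mul_kernel hopen hconv hz hθ, Complex.real_smul]
  ring

theorem integrableOn_mul_kernel_iff (hopen : IsOpen Ω) (hconv : Convex ℝ Ω) (hz : z ∈ Ω)
    (F : ℂ → ℂ) :
    IntegrableOn (fun σ => F σ * kernel Ω σ z) (frontier Ω) μH[1] ↔
      IntegrableOn (fun θ => F (polarCurve Ω z θ)) (hitAngles Ω z) := by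
  rw [integrableOn_frontier_iff hopen hconv hz, integrableOn_congr_fun
    (fun θ hθ => norm_deriv_smul_mul_kernel hopen hconv hz F hθ)
    (measurableSet_smoothAngles hopen hconv hz),
    integrableOn_congr_set_ae (smoothAngles_ae_eq hopen hconv hz)]
  exact integrable_const_mul_iff (IsUnit.mk0 _ (by simp)) _

/-- The double-layer potential is an average over the directions seen from `z`. -/
theorem integral_mul_kernel_eq (hopen : IsOpen Ω) (hconv : Convex ℝ Ω) (hz : z ∈ Ω)
    (F : ℂ → ℂ) :
    ∫ σ in frontier Ω, F σ * kernel Ω σ z ∂μH[1] =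
      1 / Real.pi * ∫ θ in hitAngles Ω z, F (polarCurve Ω z θ) := by
  rw [integral_frontier_eq hopen hconv hz, setIntegral_congr_fun
    (measurableSet_smoothAngles hopen hconv hz)
    (fun θ hθ => norm_deriv_smul_mul_kernel hopen hconv hz F hθ),
    setIntegral_congr_set (smoothAngles_ae_eq hopen hconv hz), integral_const_mul]

end

end

section

/-! ### Rays from a point of the closure -/

/-- The length of the part in `closure Ω` of the ray from `z` with direction `e^{iθ}`. -/
def rayLength (Ω : Set ℂ) (z : ℂ) (θ : ℝ) : ℝ :=
  sSup {t : ℝ | 0 ≤ t ∧ z + t * Complex.exp (θ * Complex.I) ∈ closure Ω}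

/-- The end of the part in `closure Ω` of the ray from `z` with direction `e^{iθ}`. -/
def rayEnd (Ω : Set ℂ) (z : ℂ) (θ : ℝ) : ℂ :=
  z + rayLength Ω z θ * Complex.exp (θ * Complex.I)

/-- The angles of the rays from `z` that enter `Ω`. -/
def enteringAngles (Ω : Set ℂ) (z : ℂ) : Set ℝ :=
  {θ | ∃ t : ℝ, 0 < t ∧ z + t * Complex.exp (θ * Complex.I) ∈ Ω}

/-- The angles of the rays from `z` that start in `closure Ω` without entering `Ω`. -/
def tangentAngles (Ω : Set ℂ) (z : ℂ) : Set ℝ :=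
  {θ | θ ∈ Ioc (-Real.pi) Real.pi ∧
    (∃ t : ℝ, 0 < t ∧ z + t * Complex.exp (θ * Complex.I) ∈ closure Ω) ∧ θ ∉ enteringAngles Ω z}

variable {Ω : Set ℂ} {z w : ℂ} {θ : ℝ}

/-- Recession directions of a closed convex set do not depend on the base point: moving from `z`
towards the far point `w + (n+1)tv` by the fraction `1/(n+1)` gives points that tend to `z + tv`. -/
theorem recession_of_mem_closure (hconv : Convex ℝ Ω) {v : ℂ} (hz : z ∈ closure Ω)
    (h : ∀ t : ℝ, 0 ≤ t → w + t * v ∈ closure Ω) {t : ℝ} (ht : 0 ≤ t) : z + t * v ∈ closure Ω := by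
  have hlim : Tendsto (fun n : ℕ => ((1 - 1 / ((n : ℝ) + 1) : ℝ) : ℂ) * z +
      ((1 / ((n : ℝ) + 1) : ℝ) : ℂ) * w + t * v) atTop (𝓝 (z + t * v)) := by
    have h1 : Tendsto (fun n : ℕ => ((1 / ((n : ℝ) + 1) : ℝ) : ℂ)) atTop (𝓝 ((0 : ℝ) : ℂ)) :=
      (Complex.continuous_ofReal.tendsto 0).comp tendsto_one_div_add_atTop_nhds_zero_nat
    have h2 : Tendsto (fun n : ℕ => ((1 - 1 / ((n : ℝ) + 1) : ℝ) : ℂ)) atTop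
        (𝓝 ((1 - 0 : ℝ) : ℂ)) :=
      (Complex.continuous_ofReal.tendsto _).comp
        (tendsto_const_nhds.sub tendsto_one_div_add_atTop_nhds_zero_nat)
    have := ((h2.mul_const z).add (h1.mul_const w)).add_const ((t : ℂ) * v)
    simpa using this
  refine isClosed_closure.mem_of_tendsto hlim (Eventually.of_forall fun n => ?_)
  have hn : (0 : ℝ) < (n : ℝ) + 1 := by positivity
  have hm : w + ((((n : ℝ) + 1) * t : ℝ) : ℂ) * v ∈ closure Ω := h _ (by positivity)
  have h1 : (1 : ℝ) / ((n : ℝ) + 1) ≤ 1 := by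
    rw [div_le_one hn]; linarith [(Nat.cast_nonneg n : (0 : ℝ) ≤ n)]
  have := hconv.closure hz hm (sub_nonneg.2 h1) (by positivity : (0 : ℝ) ≤ 1 / ((n : ℝ) + 1))
    (by ring)
  convert! this using 1
  have hnc : (n : ℂ) + 1 ≠ 0 := by exact_mod_cast hn.ne'
  simp only [Complex.real_smul]
  push_cast
  field_simp
  ring

/-- A ray from an interior point misses the boundary exactly when its direction is a recession
direction, a condition that may be tested at any `z` of the closure. Hence the hit angles do not
depend on the centre. -/
theorem not_mem_hitAngles_iff (hopen : IsOpen Ω) (hconv : Convex ℝ Ω) (hw : w ∈ Ω)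
    (hz : z ∈ closure Ω) (hθ : θ ∈ Ioc (-Real.pi) Real.pi) :
    θ ∉ hitAngles Ω w ↔ ∀ t : ℝ, 0 ≤ t → z + t * Complex.exp (θ * Complex.I) ∈ closure Ω := by
  have h1 : θ ∉ hitAngles Ω w ↔
      ∀ t : ℝ, 0 ≤ t → w + t * Complex.exp (θ * Complex.I) ∈ closure Ω := by
    constructor
    · intro h t ht
      rw [add_mul_exp_mem_closure_iff hopen hconv hw ht]
      have : rayGauge Ω w θ = 0 := by
        refine le_antisymm (not_lt.1 fun h' => h ⟨hθ, h'⟩) (rayGauge_nonneg _ _ _)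
      rw [this, mul_zero]; exact zero_le_one
    · rintro h ⟨-, hp⟩
      have h2 := h (2 / rayGauge Ω w θ) (by positivity)
      rw [add_mul_exp_mem_closure_iff hopen hconv hw (by positivity),
        div_mul_cancel₀ _ hp.ne'] at h2
      norm_num at h2
  rw [h1]
  exact ⟨fun h t ht => recession_of_mem_closure hconv hz h ht,
    fun h t ht => recession_of_mem_closure hconv (subset_closure hw) h ht⟩

theorem hitAngles_eq (hopen : IsOpen Ω) (hconv : Convex ℝ Ω) (hw : w ∈ Ω) (hz : z ∈ Ω) :
    hitAngles Ω w = hitAngles Ω z := by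
  ext θ
  by_cases hθ : θ ∈ Ioc (-Real.pi) Real.pi
  · rw [← not_iff_not, not_mem_hitAngles_iff hopen hconv hw (subset_closure hw) hθ,
      not_mem_hitAngles_iff hopen hconv hz (subset_closure hw) hθ]
  · exact ⟨fun h => absurd h.1 hθ, fun h => absurd h.1 hθ⟩

theorem add_mul_mem_closure_of_le (hconv : Convex ℝ Ω) (hz : z ∈ closure Ω) {v : ℂ} {s t : ℝ}
    (hs : 0 ≤ s) (hst : s ≤ t) (ht : z + t * v ∈ closure Ω) : z + s * v ∈ closure Ω := by
  rcases hs.eq_or_lt with rfl | hs0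
  · simpa using hz
  have ht0 : 0 < t := hs0.trans_le hst
  have h1 : s / t ≤ 1 := (div_le_one ht0).2 hst
  have := hconv.closure hz ht (sub_nonneg.2 h1) (by positivity : (0 : ℝ) ≤ s / t) (by ring)
  convert! this using 1
  have htc : (t : ℂ) ≠ 0 := by exact_mod_cast ht0.ne'
  simp only [Complex.real_smul]
  push_cast
  field_simp
  ring

theorem add_mul_exp_mem_closure_iff_le_rayLength (hopen : IsOpen Ω) (hconv : Convex ℝ Ω)
    (hw : w ∈ Ω) (hz : z ∈ closure Ω) (hθ : θ ∈ hitAngles Ω w) {t : ℝ} (ht : 0 ≤ t) :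
    z + t * Complex.exp (θ * Complex.I) ∈ closure Ω ↔ t ≤ rayLength Ω z θ := by
  set S := {t : ℝ | 0 ≤ t ∧ z + t * Complex.exp (θ * Complex.I) ∈ closure Ω} with hS
  have hbdd : BddAbove S := by
    have := mt (not_mem_hitAngles_iff hopen hconv hw hz hθ.1).2 (not_not.2 hθ)
    push Not at this
    obtain ⟨T, hT0, hT⟩ := this
    refine ⟨T, fun t ht => ?_⟩
    by_contra! h
    exact hT (add_mul_mem_closure_of_le hconv hz hT0 h.le ht.2)
  have hne : S.Nonempty := ⟨0, le_rfl, by simpa using hz⟩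
  have hcl : IsClosed S :=
    isClosed_Ici.inter (isClosed_closure.preimage (by fun_prop))
  constructor
  · intro h
    exact le_csSup hbdd ⟨ht, h⟩
  · intro h
    have hmem : rayLength Ω z θ ∈ S := hcl.csSup_mem hne hbdd
    exact add_mul_mem_closure_of_le hconv hz ht h hmem.2

theorem rayLength_nonneg : 0 ≤ rayLength Ω z θ := Real.sSup_nonneg fun _ h => h.1

theorem rayLength_eq_inv_rayGauge (hopen : IsOpen Ω) (hconv : Convex ℝ Ω) (hz : z ∈ Ω)
    (hθ : θ ∈ hitAngles Ω z) : rayLength Ω z θ = (rayGauge Ω z θ)⁻¹ := by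
  have key : ∀ t : ℝ, 0 ≤ t → (t ≤ rayLength Ω z θ ↔ t ≤ (rayGauge Ω z θ)⁻¹) := by
    intro t ht
    rw [← add_mul_exp_mem_closure_iff_le_rayLength hopen hconv hz (subset_closure hz) hθ ht,
      add_mul_exp_mem_closure_iff hopen hconv hz ht, ← one_div, le_div_iff₀ hθ.2]
  exact le_antisymm ((key _ rayLength_nonneg).1 le_rfl)
    ((key _ (inv_nonneg.2 hθ.2.le)).2 le_rfl)

theorem rayEnd_eq_polarCurve (hopen : IsOpen Ω) (hconv : Convex ℝ Ω) (hz : z ∈ Ω)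
    (hθ : θ ∈ hitAngles Ω z) : rayEnd Ω z θ = polarCurve Ω z θ := by
  rw [rayEnd, rayLength_eq_inv_rayGauge hopen hconv hz hθ, polarCurve]

theorem rayEnd_mem_frontier (hopen : IsOpen Ω) (hconv : Convex ℝ Ω)
    (hw : w ∈ Ω) (hz : z ∈ closure Ω) (hθ : θ ∈ hitAngles Ω w) : rayEnd Ω z θ ∈ frontier Ω := by
  have hiff := fun t ht => add_mul_exp_mem_closure_iff_le_rayLength hopen hconv hw hz hθ (t := t) ht
  rw [hopen.frontier_eq]
  refine ⟨(hiff _ rayLength_nonneg).2 le_rfl, fun h => ?_⟩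
  have hc : Tendsto (fun t : ℝ => z + t * Complex.exp (θ * Complex.I)) (𝓝 (rayLength Ω z θ))
      (𝓝 (rayEnd Ω z θ)) := Continuous.tendsto (by fun_prop) _
  have hev := hc.eventually (hopen.mem_nhds h)
  obtain ⟨ε, hε, hball⟩ := Metric.eventually_nhds_iff.1 hev
  have h1 := hball (y := rayLength Ω z θ + ε / 2) (by
    rw [Real.dist_eq, add_sub_cancel_left, abs_of_pos (by positivity)]; linarith)
  have h2 := (hiff _ (by have := rayLength_nonneg (Ω := Ω) (z := z) (θ := θ); positivity)).1
    (subset_closure h1)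
  linarith

theorem isOpen_enteringAngles (hopen : IsOpen Ω) : IsOpen (enteringAngles Ω z) := by
  have : enteringAngles Ω z =
      ⋃ t : Ioi (0 : ℝ), (fun θ : ℝ => z + (t : ℝ) * Complex.exp (θ * Complex.I)) ⁻¹' Ω := by
    ext θ; simp [enteringAngles]
  rw [this]
  exact isOpen_iUnion fun t => hopen.preimage (by fun_prop)

/-- Length cannot jump up because the closure is closed. It cannot jump down if the ray enters `Ω`,
because it then passes through interior points arbitrarily near its end. Rays of length zero need no
lower bound, so only tangent directions are excluded. -/
theorem tendsto_rayLength (hopen : IsOpen Ω) (hconv : Convex ℝ Ω)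
    (hw : w ∈ Ω) (hz : z ∈ closure Ω) (hθ : θ ∈ hitAngles Ω w) (hθ' : θ ∉ tangentAngles Ω z) :
    Tendsto (fun z' => rayLength Ω z' θ) (𝓝[closure Ω] z) (𝓝 (rayLength Ω z θ)) := by
  have hiff := fun (z : ℂ) (hz : z ∈ closure Ω) (t : ℝ) (ht : 0 ≤ t) =>
    add_mul_exp_mem_closure_iff_le_rayLength hopen hconv hw hz hθ (t := t) ht
  refine tendsto_order.2 ⟨fun a ha => ?_, fun a ha => ?_⟩
  · rcases lt_or_ge a 0 with ha0 | ha0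
    · exact Eventually.of_forall fun _ => ha0.trans_le rayLength_nonneg
    have hpos : 0 < rayLength Ω z θ := ha0.trans_lt ha
    have hent : θ ∈ enteringAngles Ω z := by
      by_contra h
      exact hθ' ⟨hθ.1, ⟨_, hpos, (hiff z hz _ hpos.le).2 le_rfl⟩, h⟩
    obtain ⟨t₀, ht₀, hmem⟩ := hent
    have ht₀' : t₀ ≤ rayLength Ω z θ := (hiff z hz _ ht₀.le).1 (subset_closure hmem)
    -- A point of `Ω` on the ray beyond `a`: either `t₀`, or the midpoint of `a` and `L`, which lies
    -- between the interior point at `t₀` and the closure point at `L`.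
    obtain ⟨t, hat, ht⟩ : ∃ t, a < t ∧ 0 ≤ t ∧ z + t * Complex.exp (θ * Complex.I) ∈ Ω := by
      rcases lt_or_ge a t₀ with h | h
      · exact ⟨t₀, h, ht₀.le, hmem⟩
      set L := rayLength Ω z θ with hL
      refine ⟨(a + L) / 2, by linarith, by linarith, ?_⟩
      have hcl := (hiff z hz _ hpos.le).2 le_rfl
      have hlt : t₀ < L := h.trans_lt ha
      have hLt : 0 < L - t₀ := by linarith
      have := hconv.combo_interior_closure_mem_interior (a := (L - (a + L) / 2) / (L - t₀))
        (b := ((a + L) / 2 - t₀) / (L - t₀)) (by rwa [hopen.interior_eq]) hcl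
        (by apply div_pos <;> linarith) (by apply div_nonneg <;> linarith)
        (by rw [← add_div, div_eq_one_iff_eq hLt.ne']; ring)
      rw [hopen.interior_eq] at this
      convert! this using 1
      have hc : (L : ℂ) - t₀ ≠ 0 := by exact_mod_cast hLt.ne'
      simp only [Complex.real_smul]
      push_cast
      field_simp
      ring
    have hc : Tendsto (fun z' : ℂ => z' + t * Complex.exp (θ * Complex.I)) (𝓝[closure Ω] z)
        (𝓝 (z + t * Complex.exp (θ * Complex.I))) :=
      (Continuous.tendsto (by fun_prop) z).mono_left nhdsWithin_le_nhds
    filter_upwards [hc.eventually (hopen.mem_nhds ht.2), self_mem_nhdsWithin] with z' h1 h2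
    exact hat.trans_le ((hiff z' h2 t ht.1).1 (subset_closure h1))
  · have ha0 : 0 ≤ a := rayLength_nonneg.trans ha.le
    have hc : Tendsto (fun z' : ℂ => z' + a * Complex.exp (θ * Complex.I)) (𝓝[closure Ω] z)
        (𝓝 (z + a * Complex.exp (θ * Complex.I))) :=
      (Continuous.tendsto (by fun_prop) z).mono_left nhdsWithin_le_nhds
    have hn : z + a * Complex.exp (θ * Complex.I) ∈ (closure Ω)ᶜ := fun h =>
      absurd ((hiff z hz a ha0).1 h) (not_le.2 ha)
    filter_upwards [hc.eventually (isClosed_closure.isOpen_compl.mem_nhds hn),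
      self_mem_nhdsWithin] with z' h1 h2
    by_contra! h
    exact h1 ((hiff z' h2 a ha0).2 h)

theorem exp_mul_I_injOn : InjOn (fun θ : ℝ => Complex.exp (θ * Complex.I))
    (Ioc (-Real.pi) Real.pi) := by
  intro x hx y hy h
  have key : ∀ x ∈ Ioc (-Real.pi) Real.pi, Complex.arg (Complex.exp (x * Complex.I)) = x := by
    intro x hx
    have := Complex.arg_mul_cos_add_sin_mul_I one_pos hx
    rwa [Complex.ofReal_one, one_mul, ← Complex.exp_mul_I] at this
  rw [← key x hx, ← key y hy]
  exact congrArg _ h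

/-- The direction of a tangent ray is determined by the side of an entering ray it lies on. -/
theorem tangent_direction_not_combo (hopen : IsOpen Ω) (hconv : Convex ℝ Ω) (hw : w ∈ Ω)
    {v : ℂ} {t a b : ℝ} (ht : 0 < t) (hv : z + t * v ∈ closure Ω) (ha : 0 ≤ a) (hb : 0 < b) :
    ∃ s : ℝ, 0 < s ∧ z + s * (a * v + b * (w - z)) ∈ Ω := by
  have hab : 0 < a / t + b := by positivity
  refine ⟨1 / (a / t + b), by positivity, ?_⟩
  have := hconv.combo_interior_closure_mem_interior (a := b / (a / t + b))
    (b := (a / t) / (a / t + b)) (by rwa [hopen.interior_eq]) hv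
    (by positivity) (by positivity) (by rw [← add_div, div_eq_one_iff_eq hab.ne']; ring)
  rw [hopen.interior_eq] at this
  convert! this using 1
  have h1 : (a : ℂ) + t * b ≠ 0 := by
    have : 0 < a + t * b := by positivity
    exact_mod_cast this.ne'
  have htc : (t : ℂ) ≠ 0 := by exact_mod_cast ht.ne'
  have h2 : (a : ℂ) / t + b ≠ 0 := by exact_mod_cast hab.ne'
  simp only [Complex.real_smul]
  push_cast
  field_simp
  ring

/-- There are at most two tangent directions, one on each side of the direction from `z` to the
interior point `w`. -/
theorem volume_tangentAngles (hopen : IsOpen Ω) (hconv : Convex ℝ Ω) (hw : w ∈ Ω) :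
    volume (tangentAngles Ω z) = 0 := by
  by_cases hz : z ∈ Ω
  · have : tangentAngles Ω z = ∅ := by
      refine eq_empty_of_forall_notMem fun θ hθ => hθ.2.2 ?_
      have hc : Tendsto (fun t : ℝ => z + t * Complex.exp (θ * Complex.I)) (𝓝 0) (𝓝 z) := by
        have : Continuous (fun t : ℝ => z + t * Complex.exp (θ * Complex.I)) := by fun_prop
        simpa using this.tendsto 0
      obtain ⟨ε, hε, h⟩ := Metric.eventually_nhds_iff.1 (hc.eventually (hopen.mem_nhds hz))
      refine ⟨ε / 2, by positivity, h ?_⟩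
      rw [Real.dist_eq, sub_zero, abs_of_pos (by positivity)]; linarith
    rw [this, measure_empty]
  set u := w - z with hu
  have hu0 : u ≠ 0 := fun h => hz (by rw [← sub_eq_zero.1 h]; exact hw)
  -- Dividing by `u` turns the direction of `w` into the positive real axis, so the sign of `Im q`
  -- tells the side.
  set q : ℝ → ℂ := fun θ => Complex.exp (θ * Complex.I) / u with hq
  have hqu : ∀ θ : ℝ, Complex.exp (θ * Complex.I) = q θ * u := fun θ => (div_mul_cancel₀ _ hu0).symm
  have hn : ∀ θ, ‖q θ‖ = ‖u‖⁻¹ := by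
    intro θ; rw [hq]; simp [Complex.norm_exp_ofReal_mul_I]
  clear_value q u
  -- two tangent rays on the same side of `u` coincide
  have hsame : ∀ x ∈ tangentAngles Ω z, ∀ y ∈ tangentAngles Ω z,
      0 < (q x).im * (q y).im → (q x).re * |(q y).im| ≤ (q y).re * |(q x).im| := by
    intro x hx y hy hxy
    by_contra! hlt
    obtain ⟨t, ht, hty⟩ := hy.2.1
    have hx0 : 0 < |(q x).im| := abs_pos.2 (left_ne_zero_of_mul hxy.ne')
    have hy0 : 0 < |(q y).im| := abs_pos.2 (right_ne_zero_of_mul hxy.ne')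
    -- If `x` were closer to `u` than `y`, then `|Im q_y| q_x` would be `|Im q_x| q_y` plus a
    -- positive multiple of the direction `1`, and the ray `x` would enter `Ω`.
    obtain ⟨s, hs, hmem⟩ := tangent_direction_not_combo hopen hconv hw ht hty
      (a := |(q x).im|) (b := (q x).re * |(q y).im| - (q y).re * |(q x).im|) hx0.le (by linarith)
    refine hx.2.2 ⟨s * |(q y).im|, by positivity, ?_⟩
    convert! hmem using 1
    rw [hqu x, hqu y, ← hu]
    have himim : |(q y).im| * (q x).im = |(q x).im| * (q y).im := by
      rcases lt_or_gt_of_ne (left_ne_zero_of_mul hxy.ne') with h | h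
      · rw [abs_of_neg h, abs_of_neg (by nlinarith)]; ring
      · rw [abs_of_pos h, abs_of_pos (by nlinarith)]; ring
    have : ((|(q y).im| : ℝ) : ℂ) * q x =
        ((|(q x).im| : ℝ) : ℂ) * q y + ((q x).re * |(q y).im| - (q y).re * |(q x).im| : ℝ) := by
      apply Complex.ext
      · simp; ring
      · simpa using himim
    push_cast at this ⊢
    linear_combination (s * u) * this
  have hsub : ∀ σ : ℝ, Set.Subsingleton {θ | θ ∈ tangentAngles Ω z ∧ 0 < σ * (q θ).im} := by
    rintro σ x ⟨hx, hx0⟩ y ⟨hy, hy0⟩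
    have hxy : 0 < (q x).im * (q y).im := by
      have h : 0 < (σ * (q x).im) * (σ * (q y).im) := mul_pos hx0 hy0
      have h2 : 0 ≤ σ ^ 2 := sq_nonneg _
      by_contra! h3
      nlinarith
    have h1 := le_antisymm (hsame x hx y hy hxy) (hsame y hy x hx (by rwa [mul_comm]))
    have hx1 : 0 < |(q x).im| := abs_pos.2 (left_ne_zero_of_mul hxy.ne')
    have hy1 : 0 < |(q y).im| := abs_pos.2 (right_ne_zero_of_mul hxy.ne')
    have himim : |(q y).im| * (q x).im = |(q x).im| * (q y).im := by
      rcases lt_or_gt_of_ne (left_ne_zero_of_mul hxy.ne') with h | h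
      · rw [abs_of_neg h, abs_of_neg (by nlinarith)]; ring
      · rw [abs_of_pos h, abs_of_pos (by nlinarith)]; ring
    have h2 : ((|(q y).im| : ℝ) : ℂ) * q x = ((|(q x).im| : ℝ) : ℂ) * q y := by
      apply Complex.ext
      · simp; linarith
      · simpa using himim
    have h3 : |(q y).im| = |(q x).im| := by
      have := congrArg norm h2
      rw [norm_mul, norm_mul, hn, hn, Complex.norm_real, Complex.norm_real, norm_abs_eq_norm,
        norm_abs_eq_norm] at this
      exact mul_right_cancel₀ (inv_ne_zero (norm_ne_zero_iff.2 hu0)) this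
    have h4 : q x = q y := by
      rw [h3] at h2
      exact mul_left_cancel₀ (by exact_mod_cast hx1.ne') h2
    refine exp_mul_I_injOn hx.1 hy.1 ?_
    show Complex.exp _ = Complex.exp _
    rw [hqu, hqu, h4]
  refine measure_mono_null (t := {θ | θ ∈ tangentAngles Ω z ∧ 0 < (1 : ℝ) * (q θ).im} ∪
    {θ | θ ∈ tangentAngles Ω z ∧ 0 < (-1 : ℝ) * (q θ).im}) ?_
    (measure_union_null ((hsub 1).measure_zero _) ((hsub (-1)).measure_zero _))
  intro θ hθ
  rcases lt_trichotomy (q θ).im 0 with h | h | h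
  · exact Or.inr ⟨hθ, by linarith⟩
  -- No tangent ray is parallel to `u`: forwards it enters at `w`, backwards it would put `z`
  -- strictly between `w` and a point of the closure, hence in `Ω`.
  · exfalso
    have hre : q θ = (q θ).re := Complex.ext rfl (by simpa using h)
    have hne : (q θ).re ≠ 0 := by
      intro h0
      have := hqu θ
      rw [hre, h0] at this
      simp [Complex.exp_ne_zero] at this
    rcases lt_or_gt_of_ne hne with hneg | hpos
    · obtain ⟨t, ht, htm⟩ := hθ.2.1
      obtain ⟨s, hs, hmem⟩ := tangent_direction_not_combo hopen hconv hw ht htm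
        (a := 1) (b := -(q θ).re) zero_le_one (by linarith)
      apply hz
      convert! hmem using 1
      rw [hqu θ, hre, ← hu]
      push_cast
      simp
    · refine hθ.2.2 ⟨(q θ).re⁻¹, by positivity, ?_⟩
      convert! hw using 1
      rw [hqu θ, hre, ← mul_assoc]
      have : ((q θ).re : ℂ) ≠ 0 := by exact_mod_cast hne
      push_cast
      simp only [Complex.ofReal_re]
      rw [inv_mul_cancel₀ this, one_mul, hu]; ring
  · exact Or.inl ⟨hθ, by linarith⟩

/-! ### Measures of sets of directions -/

theorem interiorAngle_eq : interiorAngle Ω z =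
    volume.real (Ioc (-Real.pi) Real.pi ∩ enteringAngles Ω z) := rfl

theorem measurableSet_enteringAngles (hopen : IsOpen Ω) : MeasurableSet (enteringAngles Ω z) :=
  (isOpen_enteringAngles hopen).measurableSet

/-- Two opposite directions cannot both enter `Ω`, since `z` would lie between two of its points. So
the entering directions in one half-turn are disjoint from the shifted ones in the other. -/
theorem interiorAngle_le_pi (hopen : IsOpen Ω) (hconv : Convex ℝ Ω) (hz : z ∉ Ω) :
    interiorAngle Ω z ≤ Real.pi := by
  have hpi := Real.pi_pos
  set E := enteringAngles Ω z
  have hE : MeasurableSet E := measurableSet_enteringAngles hopen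
  have hsplit : Ioc (-Real.pi) Real.pi ∩ E = (Ioc (-Real.pi) 0 ∩ E) ∪ (Ioc 0 Real.pi ∩ E) := by
    rw [← union_inter_distrib_right, Ioc_union_Ioc_eq_Ioc (by linarith) hpi.le]
  have hshift : volume (Ioc 0 Real.pi ∩ E) =
      volume (Ioc (-Real.pi) 0 ∩ (fun θ => θ + Real.pi) ⁻¹' E) := by
    have : Ioc (-Real.pi) 0 ∩ (fun θ => θ + Real.pi) ⁻¹' E =
        (fun θ => θ + Real.pi) ⁻¹' (Ioc 0 Real.pi ∩ E) := by
      rw [preimage_inter, preimage_add_const_Ioc]; simp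
    rw [this, measure_preimage_add_right]
  have hdisj : Disjoint (Ioc (-Real.pi) 0 ∩ E) (Ioc (-Real.pi) 0 ∩ (fun θ => θ + Real.pi) ⁻¹' E) := by
    refine Set.disjoint_left.2 ?_
    rintro θ ⟨-, t, ht, hmem⟩ ⟨-, s, hs, hmem'⟩
    apply hz
    have := hconv hmem hmem' (a := s / (s + t)) (b := t / (s + t)) (by positivity) (by positivity)
      (by rw [← add_div, div_self (by positivity)])
    convert! this using 1
    have hc : (s : ℂ) + t ≠ 0 := by
      have : 0 < s + t := by positivity
      exact_mod_cast this.ne'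
    have : Complex.exp (((θ + Real.pi : ℝ) : ℂ) * Complex.I) = -Complex.exp (θ * Complex.I) := by
      push_cast
      rw [add_mul, Complex.exp_add, Complex.exp_pi_mul_I]; ring
    simp only [Complex.real_smul, this]
    push_cast
    field_simp
    ring
  have hle : volume (Ioc (-Real.pi) Real.pi ∩ E) ≤ ENNReal.ofReal Real.pi := by
    rw [hsplit]
    refine (measure_union_le _ _).trans ?_
    rw [hshift, ← measure_union hdisj
      (measurableSet_Ioc.inter ((measurable_add_const _) hE)), ← inter_union_distrib_left]
    refine (measure_mono inter_subset_left).trans ?_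
    simp
  rw [interiorAngle_eq, measureReal_def]
  exact ENNReal.toReal_le_of_le_ofReal hpi.le hle

/-- Directions inside the sector are recession directions, hence never hit. -/
theorem volume_real_hitAngles_le (hopen : IsOpen Ω) (hconv : Convex ℝ Ω) (hw : w ∈ Ω)
    {a : ℂ} {β α : ℝ} (hα0 : 0 < α) (hα1 : α ≤ Real.pi / 2) (hs : sector a β α ⊆ Ω) :
    volume.real (hitAngles Ω w) ≤ 2 * Real.pi - 2 * α := by
  have hpi := Real.pi_pos
  set R : Set ℝ := {θ | ∀ t : ℝ, 0 < t → a + t * Complex.exp (θ * Complex.I) ∈ Ω} with hR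
  have hsecR : Ioo (β - α) (β + α) ⊆ R := by
    intro θ hθ t ht
    apply hs
    refine ⟨?_, ?_⟩
    · intro h
      have : (t : ℂ) * Complex.exp (θ * Complex.I) = 0 := by simpa using h
      simp [ht.ne'] at this
    · have e1 : (a + t * Complex.exp (θ * Complex.I) - a) * Complex.exp (-(β * Complex.I)) =
          t * (Complex.cos ((θ - β : ℝ) : ℂ) + Complex.sin ((θ - β : ℝ) : ℂ) * Complex.I) := by
        rw [← Complex.exp_mul_I, add_sub_cancel_left, mul_assoc, ← Complex.exp_add]
        congr 2; push_cast; ring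
      rw [e1, Complex.arg_mul_cos_add_sin_mul_I ht ⟨by linarith [hθ.1], by linarith [hθ.2]⟩, abs_lt]
      exact ⟨by linarith [hθ.1], by linarith [hθ.2]⟩
  have hclR : ∀ θ ∈ R, ∀ t : ℝ, 0 ≤ t →
      a + t * Complex.exp (θ * Complex.I) ∈ closure Ω := by
    intro θ hθ t ht
    have hc : Tendsto (fun s : ℝ => a + s * Complex.exp (θ * Complex.I)) (𝓝[>] t)
        (𝓝 (a + t * Complex.exp (θ * Complex.I))) :=
      (Continuous.tendsto (by fun_prop) t).mono_left nhdsWithin_le_nhds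
    refine mem_closure_of_tendsto hc ?_
    filter_upwards [self_mem_nhdsWithin] with s hs
    exact hθ s (ht.trans_lt hs)
  have ha : a ∈ closure Ω := by
    have := hclR β (hsecR ⟨by linarith, by linarith⟩) 0 le_rfl
    simpa using this
  have hdisj : Disjoint (hitAngles Ω w) (Ioc (-Real.pi) Real.pi ∩ R) := by
    refine Set.disjoint_left.2 fun θ hθ hθR => ?_
    exact (not_mem_hitAngles_iff hopen hconv hw ha hθ.1).2 (hclR θ hθR.2) hθ
  -- The interval `(β - α, β + α)` need not lie in `(-π, π]`. Its `2π`-periodic hull has the same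
  -- measure in every period, in particular in the one centred at `β`, which contains the interval
  -- since `α < π`.
  set S : Set ℝ := {θ | ∃ n : ℤ, θ + n * (2 * Real.pi) ∈ Ioo (β - α) (β + α)} with hS
  have hSopen : IsOpen S := by
    have : S = ⋃ n : ℤ, (fun θ : ℝ => θ + n * (2 * Real.pi)) ⁻¹' Ioo (β - α) (β + α) := by
      ext θ; simp only [hS, mem_iUnion, mem_preimage, mem_ofPred_eq]
    rw [this]
    exact isOpen_iUnion fun n => isOpen_Ioo.preimage (by fun_prop)
  have hSR : S ⊆ R := by
    rintro θ ⟨n, hn⟩ t ht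
    have := hsecR hn t ht
    have e : Complex.exp (((θ + n * (2 * Real.pi) : ℝ) : ℂ) * Complex.I) =
        Complex.exp (θ * Complex.I) := by
      push_cast
      rw [add_mul, Complex.exp_add, mul_assoc, Complex.exp_int_mul_two_pi_mul_I, mul_one]
    rwa [e] at this
  have hper : ∀ g : AddSubgroup.zmultiples (2 * Real.pi), (fun x => g +ᵥ x) ⁻¹' S = S := by
    rintro ⟨g, hg⟩
    obtain ⟨m, rfl⟩ := AddSubgroup.mem_zmultiples_iff.1 hg
    ext θ
    simp only [hS, mem_preimage, AddSubgroup.vadd_def, vadd_eq_add, zsmul_eq_mul, mem_ofPred_eq]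
    constructor
    · rintro ⟨n, hn⟩
      refine ⟨n + m, ?_⟩
      convert! hn using 1; push_cast; ring
    · rintro ⟨n, hn⟩
      refine ⟨n - m, ?_⟩
      convert! hn using 1; push_cast; ring
  have hvol : volume (S ∩ Ioc (-Real.pi) (-Real.pi + 2 * Real.pi)) =
      volume (S ∩ Ioc (β - Real.pi) (β - Real.pi + 2 * Real.pi)) :=
    (isAddFundamentalDomain_Ioc Real.two_pi_pos (-Real.pi) volume).measure_set_eq
      (isAddFundamentalDomain_Ioc Real.two_pi_pos (β - Real.pi) volume) hSopen.measurableSet hper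
  have hge : ENNReal.ofReal (2 * α) ≤ volume (S ∩ Ioc (-Real.pi) Real.pi) := by
    rw [show -Real.pi + 2 * Real.pi = Real.pi by ring] at hvol
    rw [hvol]
    calc ENNReal.ofReal (2 * α) = volume (Ioo (β - α) (β + α)) := by
          rw [Real.volume_Ioo]; congr 1; ring
      _ ≤ _ := by
        refine measure_mono fun θ hθ => ?_
        exact ⟨⟨0, by simpa using hθ⟩, by linarith [hθ.1], by linarith [hθ.2]⟩
  have hge' : 2 * α ≤ volume.real (S ∩ Ioc (-Real.pi) Real.pi) := by
    rw [measureReal_def]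
    exact (ENNReal.ofReal_le_iff_le_toReal (measure_ne_top_of_subset inter_subset_right
      measure_Ioc_lt_top.ne)).1 hge
  have hd2 : Disjoint (hitAngles Ω w) (S ∩ Ioc (-Real.pi) Real.pi) :=
    hdisj.mono_right (subset_inter inter_subset_right (inter_subset_left.trans hSR))
  have hfin2 : volume (S ∩ Ioc (-Real.pi) Real.pi) ≠ ∞ :=
    measure_ne_top_of_subset inter_subset_right measure_Ioc_lt_top.ne
  have hun := measureReal_union (μ := volume) hd2 (hSopen.measurableSet.inter measurableSet_Ioc)
    volume_hitAngles_ne_top hfin2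
  have hle : volume.real (hitAngles Ω w ∪ S ∩ Ioc (-Real.pi) Real.pi) ≤ 2 * Real.pi := by
    have : volume.real (Ioc (-Real.pi) Real.pi) = 2 * Real.pi := by
      rw [Real.volume_real_Ioc_of_le (by linarith)]; ring
    rw [← this]
    exact measureReal_mono (union_subset (fun _ h => h.1) inter_subset_right)
      measure_Ioc_lt_top.ne
  linarith

/-- Up to a null set, the rays of length zero are those that do not enter `Ω`. -/
theorem volume_real_rayLength_eq_zero (hopen : IsOpen Ω) (hconv : Convex ℝ Ω) (hw : w ∈ Ω)
    (hz : z ∈ closure Ω) :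
    volume.real (hitAngles Ω w ∩ {θ | rayLength Ω z θ = 0}) =
      2 * Real.pi - interiorAngle Ω z := by
  have hpi := Real.pi_pos
  have hae : (hitAngles Ω w ∩ {θ | rayLength Ω z θ = 0} : Set ℝ) =ᵐ[volume]
      (Ioc (-Real.pi) Real.pi \ enteringAngles Ω z : Set ℝ) := by
    refine (ae_le_set.2 ?_).antisymm (ae_le_set.2 ?_)
    · rw [sdiff_eq_empty.2, measure_empty]
      rintro θ ⟨hθ, h0⟩
      refine ⟨hθ.1, ?_⟩
      rintro ⟨t, ht, hmem⟩
      have := (add_mul_exp_mem_closure_iff_le_rayLength hopen hconv hw hz hθ ht.le).1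
        (subset_closure hmem)
      rw [h0] at this
      linarith
    · refine measure_mono_null ?_ (volume_tangentAngles (z := z) hopen hconv hw)
      rintro θ ⟨⟨hθ, hent⟩, hn⟩
      refine ⟨hθ, ?_, hent⟩
      by_contra! hno
      apply hn
      have hhit : θ ∈ hitAngles Ω w := by
        by_contra h
        exact hno 1 one_pos ((not_mem_hitAngles_iff hopen hconv hw hz hθ).1 h 1 zero_le_one)
      refine ⟨hhit, ?_⟩
      by_contra h0
      have hpos : 0 < rayLength Ω z θ := lt_of_le_of_ne rayLength_nonneg (Ne.symm h0)
      exact hno _ hpos ((add_mul_exp_mem_closure_iff_le_rayLength hopen hconv hw hz hhit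
        hpos.le).2 le_rfl)
  rw [measureReal_congr hae, interiorAngle_eq]
  have h1 := measureReal_inter_add_sdiff (μ := volume) (s := Ioc (-Real.pi) Real.pi)
    (measurableSet_enteringAngles (z := z) hopen) measure_Ioc_lt_top.ne
  have : volume.real (Ioc (-Real.pi) Real.pi) = 2 * Real.pi := by
    rw [Real.volume_real_Ioc_of_le (by linarith)]; ring
  linarith

end

section

/-! ### The angular average -/

/-- The average, over the directions in which the boundary is hit, of the boundary values seen
from `z`. The set of these directions does not depend on `w ∈ Ω`. -/
def angularAverage (Ω : Set ℂ) (w : ℂ) (F : ℂ → ℂ) (z : ℂ) : ℂ :=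
  1 / Real.pi * ∫ θ in hitAngles Ω w, F (rayEnd Ω z θ)

variable {Ω : Set ℂ} {z w : ℂ} {θ : ℝ} {F : ℂ → ℂ} {M : ℝ}

theorem ae_restrict_hitAngles (hopen : IsOpen Ω) (hconv : Convex ℝ Ω) (hw : w ∈ Ω) (z : ℂ) :
    ∀ᵐ θ ∂(volume.restrict (hitAngles Ω w)), θ ∈ hitAngles Ω w ∧ θ ∉ tangentAngles Ω z := by
  filter_upwards [ae_restrict_mem (measurableSet_hitAngles hopen hconv hw),
    ae_restrict_of_ae (measure_eq_zero_iff_ae_notMem.1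
      (volume_tangentAngles (z := z) hopen hconv hw))] with θ h1 h2
  exact ⟨h1, h2⟩

theorem tendsto_comp_rayEnd (hopen : IsOpen Ω) (hconv : Convex ℝ Ω) (hw : w ∈ Ω)
    (hz : z ∈ closure Ω) (hF : ContinuousOn F (frontier Ω))
    (hθ : θ ∈ hitAngles Ω w) (hθ' : θ ∉ tangentAngles Ω z) :
    Tendsto (fun z' => F (rayEnd Ω z' θ)) (𝓝[closure Ω] z) (𝓝 (F (rayEnd Ω z θ))) := by
  have h1 : Tendsto (fun z' => rayEnd Ω z' θ) (𝓝[closure Ω] z) (𝓝 (rayEnd Ω z θ)) := by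
    have h := tendsto_rayLength hopen hconv hw hz hθ hθ'
    have hid : Tendsto (fun z' : ℂ => z') (𝓝[closure Ω] z) (𝓝 z) :=
      tendsto_id.mono_left nhdsWithin_le_nhds
    exact hid.add (((Complex.continuous_ofReal.tendsto _).comp h).mul_const _)
  refine (hF _ (rayEnd_mem_frontier hopen hconv hw hz hθ)).tendsto.comp
    (tendsto_nhdsWithin_iff.2 ⟨h1, ?_⟩)
  filter_upwards [self_mem_nhdsWithin] with z' hz'
  exact rayEnd_mem_frontier hopen hconv hw hz' hθ

theorem continuousOn_polarCurve (hopen : IsOpen Ω) (hconv : Convex ℝ Ω) (hz : z ∈ Ω) :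
    ContinuousOn (polarCurve Ω z) (hitAngles Ω z) := by
  have h := (continuous_rayGauge hopen hconv hz).continuousOn (s := hitAngles Ω z)
  have h2 : ContinuousOn (fun θ => (rayGauge Ω z θ)⁻¹) (hitAngles Ω z) :=
    h.inv₀ fun θ hθ => hθ.2.ne'
  unfold polarCurve
  fun_prop

/-- From an interior point the ray end is continuous in `θ`. From a boundary point it is an almost
everywhere limit of such functions. -/
theorem aestronglyMeasurable_comp_rayEnd (hopen : IsOpen Ω) (hconv : Convex ℝ Ω) (hw : w ∈ Ω)
    (hz : z ∈ closure Ω) (hF : ContinuousOn F (frontier Ω)) :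
    AEStronglyMeasurable (fun θ => F (rayEnd Ω z θ)) (volume.restrict (hitAngles Ω w)) := by
  have hint : ∀ z ∈ Ω, AEStronglyMeasurable (fun θ => F (rayEnd Ω z θ))
      (volume.restrict (hitAngles Ω w)) := by
    intro z hz
    rw [hitAngles_eq hopen hconv hw hz]
    have hm := measurableSet_hitAngles hopen hconv hz
    have hc : ContinuousOn (fun θ => F (polarCurve Ω z θ)) (hitAngles Ω z) :=
      hF.comp (continuousOn_polarCurve hopen hconv hz)
        fun θ hθ => polarCurve_mem_frontier hopen hconv hz hθ.2
    refine (hc.aestronglyMeasurable hm).congr ?_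
    filter_upwards [ae_restrict_mem hm] with θ hθ
    rw [rayEnd_eq_polarCurve hopen hconv hz hθ]
  obtain ⟨x, hx, hxz⟩ := mem_closure_iff_seq_limit.1 hz
  refine aestronglyMeasurable_of_tendsto_ae atTop (fun n => hint (x n) (hx n)) ?_
  filter_upwards [ae_restrict_hitAngles hopen hconv hw z] with θ hθ
  exact (tendsto_comp_rayEnd hopen hconv hw hz hF hθ.1 hθ.2).comp
    (tendsto_nhdsWithin_iff.2 ⟨hxz, Eventually.of_forall fun n => subset_closure (hx n)⟩)

theorem ae_norm_comp_rayEnd_le (hopen : IsOpen Ω) (hconv : Convex ℝ Ω) (hw : w ∈ Ω)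
    (hz : z ∈ closure Ω) (hM : ∀ σ ∈ frontier Ω, ‖F σ‖ ≤ M) :
    ∀ᵐ θ ∂(volume.restrict (hitAngles Ω w)), ‖F (rayEnd Ω z θ)‖ ≤ M := by
  filter_upwards [ae_restrict_mem (measurableSet_hitAngles hopen hconv hw)] with θ hθ
  exact hM _ (rayEnd_mem_frontier hopen hconv hw hz hθ)

theorem integrableOn_comp_rayEnd (hopen : IsOpen Ω) (hconv : Convex ℝ Ω) (hw : w ∈ Ω)
    (hz : z ∈ closure Ω) (hF : ContinuousOn F (frontier Ω)) (hM : ∀ σ ∈ frontier Ω, ‖F σ‖ ≤ M) :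
    IntegrableOn (fun θ => F (rayEnd Ω z θ)) (hitAngles Ω w) :=
  IntegrableOn.of_bound volume_hitAngles_ne_top.lt_top
    (aestronglyMeasurable_comp_rayEnd hopen hconv hw hz hF) M
    (ae_norm_comp_rayEnd_le hopen hconv hw hz hM)

/-- The angular average extends continuously to the boundary. -/
theorem continuousOn_angularAverage (hopen : IsOpen Ω) (hconv : Convex ℝ Ω) (hw : w ∈ Ω)
    (hF : ContinuousOn F (frontier Ω)) (hM : ∀ σ ∈ frontier Ω, ‖F σ‖ ≤ M) :
    ContinuousOn (angularAverage Ω w F) (closure Ω) := by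
  intro z hz
  refine Tendsto.const_mul _ ?_
  have : IsFiniteMeasure (volume.restrict (hitAngles Ω w)) :=
    ⟨by simpa using volume_hitAngles_ne_top.lt_top⟩
  refine tendsto_integral_filter_of_dominated_convergence (fun _ => M) ?_ ?_
    (integrable_const M) ?_
  · filter_upwards [self_mem_nhdsWithin] with z' hz'
    exact aestronglyMeasurable_comp_rayEnd hopen hconv hw hz' hF
  · filter_upwards [self_mem_nhdsWithin] with z' hz'
    exact ae_norm_comp_rayEnd_le hopen hconv hw hz' hM
  · filter_upwards [ae_restrict_hitAngles hopen hconv hw z] with θ hθ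
    exact tendsto_comp_rayEnd hopen hconv hw hz hF hθ.1 hθ.2

theorem integral_mul_kernel_eq_angularAverage (hopen : IsOpen Ω) (hconv : Convex ℝ Ω) (hw : w ∈ Ω)
    (hz : z ∈ Ω) (F : ℂ → ℂ) :
    ∫ σ in frontier Ω, F σ * kernel Ω σ z ∂μH[1] = angularAverage Ω w F z := by
  rw [integral_mul_kernel_eq hopen hconv hz, angularAverage, hitAngles_eq hopen hconv hw hz]
  congr 1
  refine setIntegral_congr_fun (measurableSet_hitAngles hopen hconv hz) fun θ hθ => ?_
  rw [rayEnd_eq_polarCurve hopen hconv hz hθ]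

theorem norm_angularAverage_le (hopen : IsOpen Ω) (hconv : Convex ℝ Ω) (hw : w ∈ Ω)
    (hz : z ∈ closure Ω) (hM : ∀ σ ∈ frontier Ω, ‖F σ‖ ≤ M) :
    ‖angularAverage Ω w F z‖ ≤ M * (volume.real (hitAngles Ω w) / Real.pi) := by
  have h := norm_setIntegral_le_of_norm_le_const_ae (μ := volume) (s := hitAngles Ω w)
    (f := fun θ => F (rayEnd Ω z θ)) (C := M) volume_hitAngles_ne_top.lt_top
    (ae_norm_comp_rayEnd_le hopen hconv hw hz hM)
  rw [angularAverage, norm_mul, norm_div, norm_one, Complex.norm_real,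
    Real.norm_of_nonneg Real.pi_pos.le]
  calc 1 / Real.pi * ‖∫ θ in hitAngles Ω w, F (rayEnd Ω z θ)‖
      ≤ 1 / Real.pi * (M * volume.real (hitAngles Ω w)) := by
        have := Real.pi_pos
        gcongr
    _ = _ := by ring

/-! ### The kernel -/

theorem kernel_eq_ofReal (Ω : Set ℂ) (σ z : ℂ) :
    kernel Ω σ z = ((1 / Real.pi * (outerNormal Ω σ / (σ - z)).re : ℝ) : ℂ) := by
  rw [kernel, ← map_sub, ← map_div₀, Complex.add_conj]
  have : (Real.pi : ℂ) ≠ 0 := by exact_mod_cast Real.pi_ne_zero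
  push_cast
  field_simp

/-- The closure lies in the supporting half-plane at `σ`. At corners the normal is `0` by convention
and the kernel vanishes. -/
theorem kernel_re_nonneg (σ : ℂ) (hz : z ∈ closure Ω) :
    0 ≤ 1 / Real.pi * (outerNormal Ω σ / (σ - z)).re := by
  refine mul_nonneg (by have := Real.pi_pos; positivity) ?_
  have h := re_conj_outerNormal_mul_le (Ω := Ω) (σ := σ) hz
  have h2 : (outerNormal Ω σ / (σ - z)).re =
      (-((starRingEnd ℂ) (outerNormal Ω σ) * (z - σ)).re) * (Complex.normSq (σ - z))⁻¹ := by
    rw [div_eq_mul_inv, Complex.inv_def, ← mul_assoc, mul_comm _ (((_ : ℝ) : ℂ)),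
      Complex.re_ofReal_mul]
    simp [Complex.mul_re]
    ring
  rw [h2]
  exact mul_nonneg (by linarith) (inv_nonneg.2 (Complex.normSq_nonneg _))

theorem norm_inv_sub_inv_le {σ : ℂ} (h1 : σ ≠ z) (h2 : σ ≠ w) {c : ℝ} (hc : 0 < c)
    (h3 : c * ‖σ - w‖ ≤ ‖σ - z‖) :
    ‖(σ - z)⁻¹ - (σ - w)⁻¹‖ ≤ ‖z - w‖ / c * (‖σ - w‖ ^ 2)⁻¹ := by
  have e1 : (σ - z)⁻¹ - (σ - w)⁻¹ = (z - w) / ((σ - z) * (σ - w)) := by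
    have := sub_ne_zero.2 h1
    have := sub_ne_zero.2 h2
    field_simp
    ring
  have hw0 : 0 < ‖σ - w‖ := norm_pos_iff.2 (sub_ne_zero.2 h2)
  have hz0 : 0 < ‖σ - z‖ := norm_pos_iff.2 (sub_ne_zero.2 h1)
  rw [e1, norm_div, norm_mul, div_eq_mul_inv, div_mul_eq_mul_div, le_div_iff₀ hc, mul_assoc]
  gcongr
  rw [inv_mul_le_iff₀ (by positivity), ← div_eq_mul_inv, le_div_iff₀ (by positivity)]
  nlinarith

/-- Differences of kernels decay like `|σ - w|⁻²`, uniformly for `z` comparably far from `σ`. -/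
theorem norm_kernel_sub_le {σ : ℂ} (h1 : σ ≠ z) (h2 : σ ≠ w) {c : ℝ} (hc : 0 < c)
    (h3 : c * ‖σ - w‖ ≤ ‖σ - z‖) :
    ‖kernel Ω σ z - kernel Ω σ w‖ ≤ ‖z - w‖ / c * (‖σ - w‖ ^ 2)⁻¹ := by
  rw [kernel_eq_ofReal, kernel_eq_ofReal, ← Complex.ofReal_sub, ← mul_sub, ← Complex.sub_re,
    div_eq_mul_inv (outerNormal Ω σ), div_eq_mul_inv (outerNormal Ω σ), ← mul_sub,
    Complex.norm_real, norm_mul]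
  have hpi : ‖1 / Real.pi‖ ≤ 1 := by
    rw [one_div, norm_inv, Real.norm_of_nonneg Real.pi_pos.le]
    exact inv_le_one_of_one_le₀ (by linarith [Real.pi_gt_three])
  calc _ ≤ 1 * ‖(outerNormal Ω σ * ((σ - z)⁻¹ - (σ - w)⁻¹)).re‖ := by
        gcongr
    _ ≤ ‖outerNormal Ω σ * ((σ - z)⁻¹ - (σ - w)⁻¹)‖ := by
        rw [one_mul]; exact Complex.abs_re_le_norm _
    _ ≤ 1 * ‖(σ - z)⁻¹ - (σ - w)⁻¹‖ := by
        rw [norm_mul]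
        gcongr
        exact norm_outerNormal_le _ _
    _ ≤ _ := by rw [one_mul]; exact norm_inv_sub_inv_le h1 h2 hc h3

theorem aestronglyMeasurable_kernel (hopen : IsOpen Ω) (hconv : Convex ℝ Ω) (hw : w ∈ Ω) (z : ℂ) :
    AEStronglyMeasurable (fun σ => kernel Ω σ z) ((μH[1] : Measure ℂ).restrict (frontier Ω)) := by
  have h := aestronglyMeasurable_outerNormal hopen hconv hw
  have h1 : AEStronglyMeasurable (fun σ => outerNormal Ω σ * (σ - z)⁻¹)
      ((μH[1] : Measure ℂ).restrict (frontier Ω)) :=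
    h.mul (by fun_prop : Measurable fun σ : ℂ => (σ - z)⁻¹).aestronglyMeasurable
  simp_rw [kernel_eq_ofReal, div_eq_mul_inv]
  exact Complex.continuous_ofReal.comp_aestronglyMeasurable
    ((Complex.continuous_re.comp_aestronglyMeasurable h1).const_mul _)

theorem integrableOn_kernel (hopen : IsOpen Ω) (hconv : Convex ℝ Ω) (hz : z ∈ Ω) :
    IntegrableOn (fun σ => kernel Ω σ z) (frontier Ω) μH[1] := by
  have h := (integrableOn_mul_kernel_iff hopen hconv hz (fun _ => 1)).2
    (integrableOn_const volume_hitAngles_ne_top)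
  simpa using h

theorem measurableSet_frontier' (Ω : Set ℂ) : MeasurableSet (frontier Ω) :=
  isClosed_frontier.measurableSet

theorem ne_of_mem_frontier (hopen : IsOpen Ω) {σ : ℂ} (hσ : σ ∈ frontier Ω) (hw : w ∈ Ω) :
    σ ≠ w := by
  rintro rfl
  rw [hopen.frontier_eq] at hσ
  exact hσ.2 hw

/-! ### The double-layer potential at a boundary point -/

/-- A continuous cutoff that vanishes near `z` and increases to `1` off `z`. -/
def cutoff (z : ℂ) (n : ℕ) (σ : ℂ) : ℝ := min 1 (max 0 (n * ‖σ - z‖ - 1))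

theorem cutoff_nonneg (z : ℂ) (n : ℕ) (σ : ℂ) : 0 ≤ cutoff z n σ :=
  le_min zero_le_one (le_max_left _ _)

theorem cutoff_le_one (z : ℂ) (n : ℕ) (σ : ℂ) : cutoff z n σ ≤ 1 := min_le_left _ _

theorem norm_cutoff_le (z : ℂ) (n : ℕ) (σ : ℂ) : ‖(cutoff z n σ : ℂ)‖ ≤ 1 := by
  rw [Complex.norm_real, Real.norm_of_nonneg (cutoff_nonneg z n σ)]
  exact cutoff_le_one z n σ

theorem continuous_cutoff (z : ℂ) (n : ℕ) : Continuous (cutoff z n) := by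
  unfold cutoff; fun_prop

theorem cutoff_eq_zero {n : ℕ} {σ : ℂ} (h : n * ‖σ - z‖ ≤ 1) : cutoff z n σ = 0 := by
  rw [cutoff, max_eq_left (by linarith), min_eq_right zero_le_one]

theorem cutoff_self (z : ℂ) (n : ℕ) : cutoff z n z = 0 := cutoff_eq_zero (by simp)

theorem tendsto_cutoff {σ : ℂ} (h : σ ≠ z) : Tendsto (fun n => cutoff z n σ) atTop (𝓝 1) := by
  have hpos : 0 < ‖σ - z‖ := norm_pos_iff.2 (sub_ne_zero.2 h)
  obtain ⟨N, hN⟩ := exists_nat_gt (2 / ‖σ - z‖)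
  refine tendsto_const_nhds.congr' ?_
  filter_upwards [eventually_ge_atTop N] with n hn
  have h1 : 2 < n * ‖σ - z‖ := by
    rw [div_lt_iff₀ hpos] at hN
    refine hN.trans_le ?_
    gcongr
  rw [cutoff, min_eq_left]
  exact le_max_of_le_right (by linarith)

/-- Approach `z` from inside `Ω`, where the identity is known. As `F` vanishes near `z`, the kernels
at nearby points have a common integrable majorant on its support, and the angular average is
continuous up to the boundary. -/
theorem integral_mul_kernel_eq_of_eq_zero_near (hopen : IsOpen Ω) (hconv : Convex ℝ Ω) (hw : w ∈ Ω)
    (hz : z ∈ closure Ω) (hF : ContinuousOn F (frontier Ω)) (hM : ∀ σ ∈ frontier Ω, ‖F σ‖ ≤ M)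
    {δ : ℝ} (hδ : 0 < δ) (h0 : ∀ σ, ‖σ - z‖ ≤ δ → F σ = 0) :
    IntegrableOn (fun σ => F σ * kernel Ω σ z) (frontier Ω) μH[1] ∧
    ∫ σ in frontier Ω, F σ * kernel Ω σ z ∂μH[1] = angularAverage Ω w F z := by
  have hFm : AEStronglyMeasurable F ((μH[1] : Measure ℂ).restrict (frontier Ω)) :=
    hF.aestronglyMeasurable (measurableSet_frontier' Ω)
  set B : ℂ → ℝ := fun σ => M * (‖kernel Ω σ w‖ +
    (‖z - w‖ + δ) / (δ / 2 / (δ + ‖z - w‖)) * (‖σ - w‖ ^ 2)⁻¹) with hB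
  have hBint : Integrable B ((μH[1] : Measure ℂ).restrict (frontier Ω)) :=
    ((integrableOn_kernel hopen hconv hw).norm.add
      ((integrableOn_inv_sq_frontier hopen hconv hw).const_mul _)).const_mul M
  have hbound : ∀ z' : ℂ, ‖z' - z‖ ≤ δ / 2 → ∀ σ ∈ frontier Ω, ‖F σ * kernel Ω σ z'‖ ≤ B σ := by
    intro z' hz' σ hσ
    have hM0 : 0 ≤ M := (norm_nonneg _).trans (hM σ hσ)
    have hσw : σ ≠ w := ne_of_mem_frontier hopen hσ hw
    rcases le_or_gt ‖σ - z‖ δ with h | h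
    · rw [h0 σ h, zero_mul, norm_zero]
      positivity
    have hσz' : δ / 2 < ‖σ - z'‖ := by
      have : ‖σ - z‖ ≤ ‖σ - z'‖ + ‖z' - z‖ := by
        simpa using norm_add_le (σ - z') (z' - z)
      linarith
    have hne : σ ≠ z' := by
      rintro rfl
      rw [sub_self, norm_zero] at hσz'
      linarith
    have hz'w : ‖z' - w‖ ≤ ‖z - w‖ + δ / 2 := by
      have : ‖z' - w‖ ≤ ‖z' - z‖ + ‖z - w‖ := by simpa using norm_add_le (z' - z) (z - w)
      linarith
    have hd : 0 < δ + ‖z - w‖ := by positivity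
    have hcomp : δ / 2 / (δ + ‖z - w‖) * ‖σ - w‖ ≤ ‖σ - z'‖ := by
      have : ‖σ - w‖ ≤ ‖σ - z'‖ + ‖z' - w‖ := by simpa using norm_add_le (σ - z') (z' - w)
      rw [div_mul_eq_mul_div, div_le_iff₀ hd]
      nlinarith [norm_nonneg (z - w)]
    have hk := norm_kernel_sub_le (Ω := Ω) hne hσw (by positivity) hcomp
    rw [norm_mul]
    refine mul_le_mul (hM σ hσ) ?_ (norm_nonneg _) hM0
    have h5 : ‖kernel Ω σ z'‖ ≤ ‖kernel Ω σ w‖ + ‖kernel Ω σ z' - kernel Ω σ w‖ := by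
      simpa using norm_add_le (kernel Ω σ w) (kernel Ω σ z' - kernel Ω σ w)
    refine h5.trans (add_le_add le_rfl (hk.trans ?_))
    gcongr
    linarith
  have hmz : ∀ z' : ℂ, AEStronglyMeasurable (fun σ => F σ * kernel Ω σ z')
      ((μH[1] : Measure ℂ).restrict (frontier Ω)) := fun z' =>
    hFm.mul (aestronglyMeasurable_kernel hopen hconv hw z')
  refine ⟨hBint.mono' (hmz z) ?_, ?_⟩
  · filter_upwards [ae_restrict_mem (measurableSet_frontier' Ω)] with σ hσ
    exact hbound z (by rw [sub_self, norm_zero]; positivity) σ hσ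
  obtain ⟨x, hx, hxz⟩ := mem_closure_iff_seq_limit.1 hz
  have hev : ∀ᶠ n in atTop, ‖x n - z‖ ≤ δ / 2 := by
    have := Metric.tendsto_nhds.1 hxz (δ / 2) (by positivity)
    filter_upwards [this] with n hn
    rw [← dist_eq_norm]; exact hn.le
  have hlim1 : Tendsto (fun n => ∫ σ in frontier Ω, F σ * kernel Ω σ (x n) ∂μH[1]) atTop
      (𝓝 (∫ σ in frontier Ω, F σ * kernel Ω σ z ∂μH[1])) := by
    refine tendsto_integral_filter_of_dominated_convergence B
      (Eventually.of_forall fun n => hmz (x n)) ?_ hBint ?_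
    · filter_upwards [hev] with n hn
      filter_upwards [ae_restrict_mem (measurableSet_frontier' Ω)] with σ hσ
      exact hbound _ hn σ hσ
    · refine Eventually.of_forall fun σ => ?_
      rcases eq_or_ne σ z with rfl | hne
      · rw [h0 σ (by simpa using hδ.le)]
        simp
      · refine Tendsto.const_mul _ ?_
        simp_rw [kernel_eq_ofReal]
        refine (Complex.continuous_ofReal.tendsto _).comp (Tendsto.const_mul _ ?_)
        refine (Complex.continuous_re.tendsto _).comp (Tendsto.div tendsto_const_nhds
          (tendsto_const_nhds.sub hxz) (sub_ne_zero.2 hne))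
  have hlim2 : Tendsto (fun n => angularAverage Ω w F (x n)) atTop
      (𝓝 (angularAverage Ω w F z)) :=
    (continuousOn_angularAverage hopen hconv hw hF hM z hz).tendsto.comp
      (tendsto_nhdsWithin_iff.2 ⟨hxz, Eventually.of_forall fun n => subset_closure (hx n)⟩)
  refine tendsto_nhds_unique hlim1 (hlim2.congr fun n => ?_)
  exact (integral_mul_kernel_eq_angularAverage hopen hconv hw (hx n) F).symm

theorem ae_frontier_ne (Ω : Set ℂ) (z : ℂ) :
    ∀ᵐ σ ∂((μH[1] : Measure ℂ).restrict (frontier Ω)), σ ∈ frontier Ω ∧ σ ≠ z := by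
  have : NullSingletonClass (μH[1] : Measure ℂ) :=
    Measure.nullSingletonClass_hausdorff ℂ one_pos
  filter_upwards [ae_restrict_mem (measurableSet_frontier' Ω),
    ae_restrict_of_ae (measure_eq_zero_iff_ae_notMem.1 (measure_singleton (μ := (μH[1] : Measure ℂ)) z))]
    with σ h1 h2
  exact ⟨h1, h2⟩

theorem cutoff_mul_eq_zero (F : ℂ → ℂ) (n : ℕ) (σ : ℂ) (h : ‖σ - z‖ ≤ 1 / ((n : ℝ) + 1)) :
    (cutoff z n σ : ℂ) * F σ = 0 := by
  rw [cutoff_eq_zero, Complex.ofReal_zero, zero_mul]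
  have hn : (0 : ℝ) < (n : ℝ) + 1 := by positivity
  rw [le_div_iff₀ hn] at h
  nlinarith [norm_nonneg (σ - z)]

/-- Cut off near `z`: by positivity the truncated integrals equal angular averages of the cutoffs,
which are at most `vol / π`. Fatou's lemma removes the cutoff. -/
theorem integrableOn_kernel_of_mem_closure (hopen : IsOpen Ω) (hconv : Convex ℝ Ω) (hw : w ∈ Ω)
    (hz : z ∈ closure Ω) : IntegrableOn (fun σ => kernel Ω σ z) (frontier Ω) μH[1] := by
  have hkm := aestronglyMeasurable_kernel hopen hconv hw z
  have hcut : ∀ n, IntegrableOn (fun σ => (cutoff z n σ : ℂ) * kernel Ω σ z) (frontier Ω) μH[1] ∧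
      ∫ σ in frontier Ω, (cutoff z n σ : ℂ) * kernel Ω σ z ∂μH[1] =
        angularAverage Ω w (fun σ => (cutoff z n σ : ℂ)) z := fun n =>
    integral_mul_kernel_eq_of_eq_zero_near hopen hconv hw hz (F := fun σ => (cutoff z n σ : ℂ))
      (Complex.continuous_ofReal.comp (continuous_cutoff z n)).continuousOn
      (fun σ _ => norm_cutoff_le z n σ) (δ := 1 / ((n : ℝ) + 1)) (by positivity)
      (fun σ h => by simpa using cutoff_mul_eq_zero (fun _ => 1) n σ h)
  refine ⟨hkm, ?_⟩
  have hle : ∀ n, ∫⁻ σ in frontier Ω, ‖(cutoff z n σ : ℂ) * kernel Ω σ z‖ₑ ∂μH[1] ≤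
      ENNReal.ofReal (volume.real (hitAngles Ω w) / Real.pi) := by
    intro n
    rw [← ofReal_integral_norm_eq_lintegral_enorm (hcut n).1]
    refine ENNReal.ofReal_le_ofReal ?_
    have h1 : ((∫ σ in frontier Ω, ‖(cutoff z n σ : ℂ) * kernel Ω σ z‖ ∂μH[1] : ℝ) : ℂ) =
        angularAverage Ω w (fun σ => (cutoff z n σ : ℂ)) z := by
      rw [← (hcut n).2, ← integral_complex_ofReal]
      refine integral_congr_ae (Eventually.of_forall fun σ => ?_)
      simp only [kernel_eq_ofReal, ← Complex.ofReal_mul]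
      rw [Complex.norm_real, Real.norm_of_nonneg
        (mul_nonneg (cutoff_nonneg _ _ _) (kernel_re_nonneg σ hz))]
    have h2 := norm_angularAverage_le hopen hconv hw hz (M := 1)
      (F := fun σ => (cutoff z n σ : ℂ)) (fun σ _ => norm_cutoff_le z n σ)
    rw [← h1, Complex.norm_real, one_mul] at h2
    exact (le_abs_self _).trans h2
  rw [HasFiniteIntegral]
  calc ∫⁻ σ in frontier Ω, ‖kernel Ω σ z‖ₑ ∂μH[1]
      = ∫⁻ σ in frontier Ω, liminf (fun n => ‖(cutoff z n σ : ℂ) * kernel Ω σ z‖ₑ) atTop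
          ∂μH[1] := by
        refine lintegral_congr_ae ?_
        filter_upwards [ae_frontier_ne Ω z] with σ hσ
        have h1 : Tendsto (fun n => (cutoff z n σ : ℂ) * kernel Ω σ z) atTop
            (𝓝 (((1 : ℝ) : ℂ) * kernel Ω σ z)) :=
          ((Complex.continuous_ofReal.tendsto _).comp (tendsto_cutoff hσ.2)).mul_const _
        rw [Complex.ofReal_one, one_mul] at h1
        exact (((continuous_enorm.tendsto _).comp h1).liminf_eq).symm
    _ ≤ liminf (fun n => ∫⁻ σ in frontier Ω, ‖(cutoff z n σ : ℂ) * kernel Ω σ z‖ₑ ∂μH[1])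
          atTop := lintegral_liminf_le' fun n => (hcut n).1.1.enorm
    _ ≤ ENNReal.ofReal (volume.real (hitAngles Ω w) / Real.pi) :=
        liminf_le_of_le (by isBoundedDefault) fun b hb => by
          obtain ⟨n, hn⟩ := hb.exists
          exact hn.trans (hle n)
    _ < ∞ := ENNReal.ofReal_lt_top

theorem rayEnd_eq_iff : rayEnd Ω z θ = z ↔ rayLength Ω z θ = 0 := by
  simp [rayEnd, Complex.exp_ne_zero]

theorem measurableSet_rayLength_eq_zero (hopen : IsOpen Ω) (hconv : Convex ℝ Ω) (hw : w ∈ Ω)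
    (hz : z ∈ closure Ω) :
    NullMeasurableSet (hitAngles Ω w ∩ {θ | rayLength Ω z θ = 0}) := by
  have h := aestronglyMeasurable_comp_rayEnd (F := fun σ => σ) hopen hconv hw hz continuousOn_id
  have h2 : NullMeasurableSet ((fun θ => rayEnd Ω z θ) ⁻¹' {z}) (volume.restrict (hitAngles Ω w)) :=
    h.aemeasurable.nullMeasurableSet_preimage (measurableSet_singleton z)
  have h3 := (nullMeasurableSet_restrict
    (measurableSet_hitAngles hopen hconv hw).nullMeasurableSet).1 h2
  convert! h3 using 1
  ext θ
  simp [rayEnd_eq_iff, and_comm]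

/-- The integral of a bounded function against the kernel at a point of the closure. -/
theorem integral_mul_kernel_eq_setIntegral (hopen : IsOpen Ω) (hconv : Convex ℝ Ω) (hw : w ∈ Ω)
    (hz : z ∈ closure Ω) (hF : ContinuousOn F (frontier Ω)) (hM : ∀ σ ∈ frontier Ω, ‖F σ‖ ≤ M) :
    ∫ σ in frontier Ω, F σ * kernel Ω σ z ∂μH[1] =
      1 / Real.pi * ∫ θ in hitAngles Ω w \ {θ | rayLength Ω z θ = 0}, F (rayEnd Ω z θ) := by
  have hmH := measurableSet_hitAngles hopen hconv hw
  have hFm : AEStronglyMeasurable F ((μH[1] : Measure ℂ).restrict (frontier Ω)) :=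
    hF.aestronglyMeasurable (measurableSet_frontier' Ω)
  have hcm : ∀ n, Continuous fun σ => (cutoff z n σ : ℂ) := fun n =>
    Complex.continuous_ofReal.comp (continuous_cutoff z n)
  have hcF : ∀ n, ContinuousOn (fun σ => (cutoff z n σ : ℂ) * F σ) (frontier Ω) := fun n =>
    (hcm n).continuousOn.mul hF
  have hcM : ∀ n, ∀ σ ∈ frontier Ω, ‖(cutoff z n σ : ℂ) * F σ‖ ≤ M := by
    intro n σ hσ
    rw [norm_mul]
    calc _ ≤ 1 * ‖F σ‖ := by
          gcongr
          exact norm_cutoff_le z n σ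
      _ ≤ M := by rw [one_mul]; exact hM σ hσ
  have hid : ∀ n, ∫ σ in frontier Ω, (cutoff z n σ : ℂ) * F σ * kernel Ω σ z ∂μH[1] =
      angularAverage Ω w (fun σ => (cutoff z n σ : ℂ) * F σ) z := fun n =>
    (integral_mul_kernel_eq_of_eq_zero_near hopen hconv hw hz (hcF n) (hcM n)
      (δ := 1 / ((n : ℝ) + 1)) (by positivity) (fun σ h => cutoff_mul_eq_zero F n σ h)).2
  have hlim1 : Tendsto (fun n => ∫ σ in frontier Ω, (cutoff z n σ : ℂ) * F σ * kernel Ω σ z ∂μH[1])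
      atTop (𝓝 (∫ σ in frontier Ω, F σ * kernel Ω σ z ∂μH[1])) := by
    have hkm := aestronglyMeasurable_kernel hopen hconv hw z
    refine tendsto_integral_filter_of_dominated_convergence (fun σ => M * ‖kernel Ω σ z‖)
      (Eventually.of_forall fun n => ((hcm n).aestronglyMeasurable.mul hFm).mul hkm)
      (Eventually.of_forall fun n => ?_)
      ((integrableOn_kernel_of_mem_closure hopen hconv hw hz).norm.const_mul M) ?_
    · filter_upwards [ae_frontier_ne Ω z] with σ hσ
      rw [norm_mul]
      gcongr
      exact hcM n σ hσ.1
    · filter_upwards [ae_frontier_ne Ω z] with σ hσ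
      have := ((((Complex.continuous_ofReal.tendsto _).comp (tendsto_cutoff hσ.2)).mul_const
        (F σ)).mul_const (kernel Ω σ z))
      simpa using this
  have hfin : IsFiniteMeasure (volume.restrict (hitAngles Ω w)) :=
    ⟨by simpa using volume_hitAngles_ne_top.lt_top⟩
  -- The cutoffs tend to the indicator of `σ ≠ z`. On the boundary the point `z` is null for
  -- arclength, but in angle the rays that end at `z` may have positive measure; this discrepancy is
  -- the jump.
  have hlim2 : Tendsto (fun n => ∫ θ in hitAngles Ω w,
      (cutoff z n (rayEnd Ω z θ) : ℂ) * F (rayEnd Ω z θ)) atTop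
      (𝓝 (∫ θ in hitAngles Ω w,
        ({θ | rayLength Ω z θ = 0}ᶜ).indicator (fun θ => F (rayEnd Ω z θ)) θ)) := by
    refine tendsto_integral_filter_of_dominated_convergence (fun _ => M)
      (Eventually.of_forall fun n =>
        aestronglyMeasurable_comp_rayEnd (F := fun σ => (cutoff z n σ : ℂ) * F σ)
          hopen hconv hw hz (hcF n))
      (Eventually.of_forall fun n => ae_norm_comp_rayEnd_le
        (F := fun σ => (cutoff z n σ : ℂ) * F σ) hopen hconv hw hz (hcM n))
      (integrable_const M) (Eventually.of_forall fun θ => ?_)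
    by_cases hθ : rayLength Ω z θ = 0
    · rw [indicator_of_notMem (by simpa using hθ)]
      simp [rayEnd_eq_iff.2 hθ, cutoff_self]
    · rw [indicator_of_mem (by simpa using hθ)]
      have := ((Complex.continuous_ofReal.tendsto _).comp
        (tendsto_cutoff (mt rayEnd_eq_iff.1 hθ))).mul_const (F (rayEnd Ω z θ))
      simpa using this
  have hlim3 := (hlim2.const_mul (1 / (Real.pi : ℂ))).congr fun n => (hid n).symm
  rw [tendsto_nhds_unique hlim1 hlim3]
  congr 1
  have hnull := measurableSet_rayLength_eq_zero hopen hconv hw hz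
  have e1 : (hitAngles Ω w).indicator (({θ | rayLength Ω z θ = 0}ᶜ).indicator
      (fun θ => F (rayEnd Ω z θ))) =
      (hitAngles Ω w \ {θ | rayLength Ω z θ = 0}).indicator (fun θ => F (rayEnd Ω z θ)) := by
    rw [indicator_indicator, sdiff_eq]
  have e2 : NullMeasurableSet (hitAngles Ω w \ {θ | rayLength Ω z θ = 0}) := by
    rw [← sdiff_self_inter]
    exact hmH.nullMeasurableSet.diff hnull
  rw [← integral_indicator hmH, e1, integral_indicator₀ e2]

/-- The jump relation: at a boundary point, the angular average is the value of `I + P`. -/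
theorem integral_mul_kernel_add_eq_angularAverage (hopen : IsOpen Ω) (hconv : Convex ℝ Ω)
    (hw : w ∈ Ω) (hz : z ∈ closure Ω) (hF : ContinuousOn F (frontier Ω))
    (hM : ∀ σ ∈ frontier Ω, ‖F σ‖ ≤ M) :
    ∫ σ in frontier Ω, F σ * kernel Ω σ z ∂μH[1] +
      (2 - interiorAngle Ω z / Real.pi : ℝ) * F z = angularAverage Ω w F z := by
  rw [integral_mul_kernel_eq_setIntegral hopen hconv hw hz hF hM, angularAverage]
  have hnull := measurableSet_rayLength_eq_zero hopen hconv hw hz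
  have hsplit := integral_inter_add_sdiff₀ (μ := volume) (s := hitAngles Ω w)
    (t := hitAngles Ω w ∩ {θ | rayLength Ω z θ = 0}) hnull
    (integrableOn_comp_rayEnd hopen hconv hw hz hF hM)
  rw [sdiff_self_inter, ← inter_assoc, inter_self] at hsplit
  rw [← hsplit]
  have hc : ∫ θ in hitAngles Ω w ∩ {θ | rayLength Ω z θ = 0}, F (rayEnd Ω z θ) =
      (2 * Real.pi - interiorAngle Ω z : ℝ) * F z := by
    rw [← volume_real_rayLength_eq_zero hopen hconv hw hz, ← Complex.real_smul,
      ← setIntegral_const]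
    refine integral_congr_ae ?_
    filter_upwards [ae_restrict_mem₀ hnull] with θ hθ
    rw [rayEnd_eq_iff.2 hθ.2]
  rw [hc]
  have : (Real.pi : ℂ) ≠ 0 := by exact_mod_cast Real.pi_ne_zero
  push_cast
  field_simp
  ring

/-- Removing the rays of length zero, of total angle `2π - ω(z)`, leaves this mass for the kernel at
`z`. -/
theorem norm_integral_mul_kernel_le (hopen : IsOpen Ω) (hconv : Convex ℝ Ω)
    (hw : w ∈ Ω) (hz : z ∈ closure Ω) (hF : ContinuousOn F (frontier Ω))
    (hM : ∀ σ ∈ frontier Ω, ‖F σ‖ ≤ M) :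
    ‖∫ σ in frontier Ω, F σ * kernel Ω σ z ∂μH[1]‖ ≤
      M * ((volume.real (hitAngles Ω w) + interiorAngle Ω z) / Real.pi - 2) := by
  rw [integral_mul_kernel_eq_setIntegral hopen hconv hw hz hF hM]
  have hpi := Real.pi_pos
  have hnull := measurableSet_rayLength_eq_zero hopen hconv hw hz
  have hsub : hitAngles Ω w \ {θ | rayLength Ω z θ = 0} ⊆ hitAngles Ω w := sdiff_subset
  have h := norm_setIntegral_le_of_norm_le_const_ae (μ := volume)
    (s := hitAngles Ω w \ {θ | rayLength Ω z θ = 0})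
    (f := fun θ => F (rayEnd Ω z θ)) (C := M)
    (measure_ne_top_of_subset hsub volume_hitAngles_ne_top).lt_top
    (ae_restrict_of_ae_restrict_of_subset hsub (ae_norm_comp_rayEnd_le hopen hconv hw hz hM))
  have hv : volume.real (hitAngles Ω w \ {θ | rayLength Ω z θ = 0}) =
      volume.real (hitAngles Ω w) - (2 * Real.pi - interiorAngle Ω z) := by
    rw [← volume_real_rayLength_eq_zero hopen hconv hw hz]
    have := measureReal_inter_add_sdiff₀ (μ := volume) (s := hitAngles Ω w) hnull
      volume_hitAngles_ne_top
    rw [sdiff_self_inter, ← inter_assoc, inter_self] at this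
    linarith
  rw [hv] at h
  rw [norm_mul, norm_div, norm_one, Complex.norm_real, Real.norm_of_nonneg hpi.le]
  calc _ ≤ 1 / Real.pi * (M * (volume.real (hitAngles Ω w) - (2 * Real.pi - interiorAngle Ω z))) := by
        gcongr
    _ = _ := by field_simp; ring

end

section

/-! ### The boundary operator -/

variable {Ω : Set ℂ} {z w : ℂ}

/-- Extension by zero of a function on the boundary. -/
def extendBoundary (g : frontier Ω →ᵇ ℂ) : ℂ → ℂ := Function.extend Subtype.val g 0

theorem extendBoundary_coe (g : frontier Ω →ᵇ ℂ) (σ : frontier Ω) : extendBoundary g σ = g σ :=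
  Subtype.val_injective.extend_apply _ _ _

theorem continuousOn_extendBoundary (g : frontier Ω →ᵇ ℂ) :
    ContinuousOn (extendBoundary g) (frontier Ω) := by
  rw [continuousOn_iff_continuous_domRestrict]
  convert! g.continuous using 1
  ext σ
  exact extendBoundary_coe g σ

theorem norm_extendBoundary_le (g : frontier Ω →ᵇ ℂ) (σ : ℂ) : ‖extendBoundary g σ‖ ≤ ‖g‖ := by
  by_cases h : σ ∈ frontier Ω
  · rw [show σ = ((⟨σ, h⟩ : frontier Ω) : ℂ) from rfl, extendBoundary_coe]
    exact g.norm_coe_le_norm _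
  · rw [extendBoundary, Function.extend_apply' _ _ _ (by rintro ⟨a, rfl⟩; exact h a.2)]
    simp

theorem map_coe_hausdorffMeasure_frontier :
    Measure.map ((↑) : frontier Ω → ℂ) μH[1] = μH[1].restrict (frontier Ω) := by
  rw [isometry_subtype_coe.map_hausdorffMeasure (Or.inl zero_le_one), Subtype.range_coe]

theorem integral_frontier_coe {E : Type*} [NormedAddCommGroup E] [NormedSpace ℝ E] (f : ℂ → E) :
    ∫ σ : frontier Ω, f σ ∂μH[1] = ∫ σ in frontier Ω, f σ ∂μH[1] := by
  rw [← map_coe_hausdorffMeasure_frontier,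
    (MeasurableEmbedding.subtype_coe (measurableSet_frontier' Ω)).integral_map]

theorem doubleLayer_eq_integral (g : frontier Ω →ᵇ ℂ) (z : ℂ) :
    doubleLayer Ω g z = ∫ σ in frontier Ω, extendBoundary g σ * kernel Ω σ z ∂μH[1] := by
  rw [← integral_frontier_coe, doubleLayer]
  simp_rw [extendBoundary_coe]

theorem boundaryOp_eq_integral (g : frontier Ω →ᵇ ℂ) (z : frontier Ω) :
    boundaryOp Ω g z = ∫ σ in frontier Ω, extendBoundary g σ * kernel Ω σ z ∂μH[1] +
      (1 - interiorAngle Ω z / Real.pi : ℝ) * g z := by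
  have : NullSingletonClass (μH[1] : Measure (frontier Ω)) :=
    Measure.nullSingletonClass_hausdorff _ one_pos
  rw [boundaryOp, ← doubleLayer_eq_integral, doubleLayer, restrict_compl_singleton]

theorem doubleLayer_eq_angularAverage (hopen : IsOpen Ω) (hconv : Convex ℝ Ω) (hw : w ∈ Ω)
    (hz : z ∈ Ω) (g : frontier Ω →ᵇ ℂ) :
    doubleLayer Ω g z = angularAverage Ω w (extendBoundary g) z := by
  rw [doubleLayer_eq_integral, integral_mul_kernel_eq_angularAverage hopen hconv hw hz]

theorem add_boundaryOp_eq_angularAverage (hopen : IsOpen Ω) (hconv : Convex ℝ Ω) (hw : w ∈ Ω)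
    (g : frontier Ω →ᵇ ℂ) (z : frontier Ω) :
    g z + boundaryOp Ω g z = angularAverage Ω w (extendBoundary g) z := by
  rw [← integral_mul_kernel_add_eq_angularAverage hopen hconv hw z.2.1
    (continuousOn_extendBoundary g) (fun σ _ => norm_extendBoundary_le g σ),
    boundaryOp_eq_integral, extendBoundary_coe]
  push_cast
  ring

/-- Because `ω(z) ≤ π`, the point mass at `z` is nonnegative; added to the mass of the kernel it
cancels `ω(z)`, and the total is the same at every boundary point. -/
theorem norm_boundaryOp_le (hopen : IsOpen Ω) (hconv : Convex ℝ Ω) (hw : w ∈ Ω)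
    (g : frontier Ω →ᵇ ℂ) (z : frontier Ω) :
    ‖boundaryOp Ω g z‖ ≤ (volume.real (hitAngles Ω w) / Real.pi - 1) * ‖g‖ := by
  have hpi := Real.pi_pos
  have h1 := norm_integral_mul_kernel_le hopen hconv hw z.2.1
    (continuousOn_extendBoundary g) (fun σ _ => norm_extendBoundary_le g σ)
  have hzΩ : (z : ℂ) ∉ Ω := fun h => ne_of_mem_frontier hopen z.2 h rfl
  have h2 : 0 ≤ 1 - interiorAngle Ω z / Real.pi := by
    rw [sub_nonneg, div_le_one hpi]
    exact interiorAngle_le_pi hopen hconv hzΩ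
  rw [boundaryOp_eq_integral]
  refine (norm_add_le _ _).trans ?_
  rw [norm_mul, Complex.norm_real, Real.norm_of_nonneg h2]
  have h3 := mul_le_mul_of_nonneg_left (g.norm_coe_le_norm z) h2
  calc _ ≤ ‖g‖ * ((volume.real (hitAngles Ω w) + interiorAngle Ω z) / Real.pi - 2) +
        (1 - interiorAngle Ω z / Real.pi) * ‖g‖ := add_le_add h1 h3
    _ = _ := by ring

theorem angularAverage_add_smul (hopen : IsOpen Ω) (hconv : Convex ℝ Ω) (hw : w ∈ Ω)
    (hz : z ∈ closure Ω) (c : ℂ) (g h : frontier Ω →ᵇ ℂ) :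
    angularAverage Ω w (extendBoundary (g + c • h)) z =
      angularAverage Ω w (extendBoundary g) z + c * angularAverage Ω w (extendBoundary h) z := by
  have hint := fun g : frontier Ω →ᵇ ℂ => integrableOn_comp_rayEnd hopen hconv hw hz
    (continuousOn_extendBoundary g) (fun σ _ => norm_extendBoundary_le g σ)
  have h1 : ∫ θ in hitAngles Ω w, extendBoundary (g + c • h) (rayEnd Ω z θ) =
      ∫ θ in hitAngles Ω w, (extendBoundary g (rayEnd Ω z θ) +
        c * extendBoundary h (rayEnd Ω z θ)) := by
    refine setIntegral_congr_fun (measurableSet_hitAngles hopen hconv hw) fun θ hθ => ?_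
    have := fun g : frontier Ω →ᵇ ℂ => extendBoundary_coe g
      ⟨_, rayEnd_mem_frontier hopen hconv hw hz hθ⟩
    simp only at this
    simp only [this]
    rfl
  rw [angularAverage, h1, integral_add (hint g) ((hint h).const_mul c), integral_const_mul,
    angularAverage, angularAverage]
  ring

/-- The operator `P` as a bounded operator on the space of bounded continuous functions. -/
theorem exists_boundaryCLM (hopen : IsOpen Ω) (hconv : Convex ℝ Ω) (hw : w ∈ Ω)
    (hfr : (frontier Ω).Nonempty) :
    ∃ P : (frontier Ω →ᵇ ℂ) →L[ℂ] (frontier Ω →ᵇ ℂ), (∀ g z, P g z = boundaryOp Ω g z) ∧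
      ‖P‖ ≤ volume.real (hitAngles Ω w) / Real.pi - 1 := by
  -- The bound applied to the constant `1` shows that it is nonnegative.
  have hκ : 0 ≤ volume.real (hitAngles Ω w) / Real.pi - 1 := by
    obtain ⟨z, hz⟩ := hfr
    have h := (norm_nonneg _).trans (norm_boundaryOp_le hopen hconv hw
      (BoundedContinuousFunction.const (frontier Ω) 1) ⟨z, hz⟩)
    have hne : Nonempty (frontier Ω) := ⟨⟨z, hz⟩⟩
    rw [BoundedContinuousFunction.norm_const_eq, norm_one, mul_one] at h
    exact h
  have hcont : ∀ g : frontier Ω →ᵇ ℂ, Continuous (boundaryOp Ω g) := by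
    intro g
    -- Neither term of `Pg` is visibly continuous at corners, but `Tg - g` is.
    have h1 : boundaryOp Ω g =
        fun z : frontier Ω => angularAverage Ω w (extendBoundary g) z - g z := by
      funext z
      rw [← add_boundaryOp_eq_angularAverage hopen hconv hw]; ring
    rw [h1]
    refine Continuous.sub ?_ g.continuous
    have := continuousOn_angularAverage hopen hconv hw
      (continuousOn_extendBoundary g) (fun σ _ => norm_extendBoundary_le g σ)
    exact (this.mono frontier_subset_closure).domRestrict
  have hlin : ∀ (c : ℂ) (g h : frontier Ω →ᵇ ℂ) (z : frontier Ω),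
      boundaryOp Ω (g + c • h) z = boundaryOp Ω g z + c * boundaryOp Ω h z := by
    intro c g h z
    have e := fun g : frontier Ω →ᵇ ℂ => add_boundaryOp_eq_angularAverage hopen hconv hw g z
    have h1 := angularAverage_add_smul hopen hconv hw z.2.1 c g h
    rw [← e, ← e, ← e] at h1
    simp only [BoundedContinuousFunction.add_apply, BoundedContinuousFunction.smul_apply,
      smul_eq_mul] at h1
    linear_combination h1
  have h0 : ∀ z, boundaryOp Ω (0 : frontier Ω →ᵇ ℂ) z = 0 := by
    intro z
    have := hlin (-1) 0 0 z
    simpa using this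
  let L : (frontier Ω →ᵇ ℂ) →ₗ[ℂ] (frontier Ω →ᵇ ℂ) :=
    { toFun := fun g => BoundedContinuousFunction.ofNormedAddCommGroup (boundaryOp Ω g) (hcont g) _
        (norm_boundaryOp_le hopen hconv hw g)
      map_add' := fun g h => by
        ext z
        have := hlin 1 g h z
        simpa using this
      map_smul' := fun c g => by
        ext z
        have := hlin c 0 g z
        rw [h0 z] at this
        simpa using this }
  refine ⟨L.mkContinuous _ fun g => ?_, fun g z => rfl, L.mkContinuous_norm_le hκ _⟩
  exact (BoundedContinuousFunction.norm_le (by positivity)).2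
    fun z => norm_boundaryOp_le hopen hconv hw g z

/-- If `vol(hit directions) ≤ 2π - 2α` then `I + P` is invertible, with a bound on the inverse. -/
theorem isInvertibleIdAddP_of_le (hopen : IsOpen Ω) (hconv : Convex ℝ Ω) (hw : w ∈ Ω)
    (hfr : (frontier Ω).Nonempty) {α : ℝ} (hα : 0 < α)
    (hvol : volume.real (hitAngles Ω w) ≤ 2 * Real.pi - 2 * α) :
    IsInvertibleIdAddP Ω ∧ ∀ (g : frontier Ω →ᵇ ℂ) (C : ℝ),
      (∀ z, ‖g z + boundaryOp Ω g z‖ ≤ C) → ‖g‖ ≤ Real.pi / (2 * α) * C := by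
  have hpi := Real.pi_pos
  set κ := volume.real (hitAngles Ω w) / Real.pi - 1 with hκ
  have hκ1 : κ ≤ 1 - 2 * α / Real.pi := by
    have : volume.real (hitAngles Ω w) / Real.pi ≤ (2 * Real.pi - 2 * α) / Real.pi := by gcongr
    rw [sub_div, mul_div_cancel_right₀ _ hpi.ne'] at this
    linarith
  obtain ⟨P, hP, hPn⟩ := exists_boundaryCLM hopen hconv hw hfr
  have hα' : 0 < 2 * α / Real.pi := by positivity
  have hunit : IsUnit (1 + P) := by
    have h := isUnit_one_sub_of_norm_lt_one (x := -P)
      (by rw [norm_neg]; exact hPn.trans_lt (by linarith))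
    rwa [sub_neg_eq_add] at h
  have hbij := ContinuousLinearMap.isUnit_iff_bijective.1 hunit
  have hiff : ∀ g h : frontier Ω →ᵇ ℂ, (∀ z, g z + boundaryOp Ω g z = h z) ↔ (1 + P) g = h := by
    intro g h
    constructor
    · intro H
      ext z
      rw [← H z, ← hP]
      rfl
    · rintro rfl z
      rw [← hP]
      rfl
  refine ⟨⟨fun g => ⟨P g, hP g⟩, fun h => ?_⟩, fun g C hC => ?_⟩
  · obtain ⟨g, hg, hu⟩ := hbij.existsUnique h
    exact ⟨g, (hiff g h).2 hg, fun g' hg' => hu g' ((hiff g' h).1 hg')⟩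
  · have hne : Nonempty (frontier Ω) := hfr.to_subtype
    have h1 : ‖g + P g‖ ≤ C := by
      refine (BoundedContinuousFunction.norm_le_of_nonempty).2 fun z => ?_
      rw [BoundedContinuousFunction.add_apply, hP]
      exact hC z
    have h2 : ‖g‖ ≤ ‖g + P g‖ + ‖P g‖ := by simpa using norm_sub_le (g + P g) (P g)
    have h3 : ‖P g‖ ≤ (1 - 2 * α / Real.pi) * ‖g‖ :=
      (P.le_opNorm g).trans (by gcongr; exact hPn.trans hκ1)
    have h4 : 2 * α / Real.pi * ‖g‖ ≤ C := by linarith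
    rw [div_mul_eq_mul_div, div_le_iff₀ hpi] at h4
    rw [div_mul_eq_mul_div, le_div_iff₀ (by positivity)]
    linarith

end

section

/-! ### Cauchy transforms in a Banach algebra -/

section Cauchy

variable {𝔅 : Type*} [NormedRing 𝔅] [NormedAlgebra ℂ 𝔅]

/-- The resolvent at `σ`, normalized at `w`: `(σ - a)⁻¹ - (σ - w)⁻¹`. -/
def resolventDiff (w σ : ℂ) (a : 𝔅) : 𝔅 :=
  Ring.inverse (algebraMap ℂ 𝔅 σ - a) - algebraMap ℂ 𝔅 (σ - w)⁻¹

/-- The Cauchy transform of the density `h`, normalized to vanish at `w`. -/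
def cauchyTransform (m : Measure ℂ) (w : ℂ) (h : ℂ → ℂ) (a : 𝔅) : 𝔅 :=
  ∫ σ, h σ • resolventDiff w σ a ∂m

/-- `σ - a` is invertible for `σ ∈ S`, with inverse of norm at most `C / |σ - w|`. -/
def ResolventBound (S : Set ℂ) (w : ℂ) (C : ℝ) (a : 𝔅) : Prop :=
  ∀ σ ∈ S, IsUnit (algebraMap ℂ 𝔅 σ - a) ∧ ‖Ring.inverse (algebraMap ℂ 𝔅 σ - a)‖ ≤ C / ‖σ - w‖

variable {m : Measure ℂ} {S : Set ℂ} {w : ℂ} {h : ℂ → ℂ} {M C : ℝ} {a b : 𝔅}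

/-- The resolvent identity: subtracting the resolvent at `w` gains a second factor of order `|σ -
w|⁻¹`, which makes the Cauchy integral converge on an unbounded boundary. -/
theorem resolventDiff_eq {σ : ℂ} (hσ : σ ≠ w) (hu : IsUnit (algebraMap ℂ 𝔅 σ - a)) :
    resolventDiff w σ a =
      (σ - w)⁻¹ • (Ring.inverse (algebraMap ℂ 𝔅 σ - a) * (a - algebraMap ℂ 𝔅 w)) := by
  have h0 : σ - w ≠ 0 := sub_ne_zero.2 hσ
  have h1 : a - algebraMap ℂ 𝔅 w = algebraMap ℂ 𝔅 (σ - w) - (algebraMap ℂ 𝔅 σ - a) := by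
    rw [map_sub]; abel
  rw [resolventDiff, h1, mul_sub, Ring.inverse_mul_cancel _ hu, Algebra.algebraMap_eq_smul_one
    (σ - w), mul_smul_comm, mul_one, smul_sub, inv_smul_smul₀ h0, Algebra.algebraMap_eq_smul_one
    (σ - w)⁻¹]

theorem norm_resolventDiff_le (hb : ResolventBound S w C a) {σ : ℂ} (hσ : σ ∈ S) (hne : σ ≠ w) :
    ‖resolventDiff w σ a‖ ≤ C * ‖a - algebraMap ℂ 𝔅 w‖ * (‖σ - w‖ ^ 2)⁻¹ := by
  rw [resolventDiff_eq hne (hb σ hσ).1]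
  have h0 : 0 < ‖σ - w‖ := norm_pos_iff.2 (sub_ne_zero.2 hne)
  refine (norm_smul_le _ _).trans ?_
  calc ‖(σ - w)⁻¹‖ * ‖Ring.inverse (algebraMap ℂ 𝔅 σ - a) * (a - algebraMap ℂ 𝔅 w)‖
      ≤ ‖(σ - w)⁻¹‖ * (C / ‖σ - w‖ * ‖a - algebraMap ℂ 𝔅 w‖) := by
        gcongr
        exact (norm_mul_le _ _).trans (by gcongr; exact (hb σ hσ).2)
    _ = _ := by rw [norm_inv]; field_simp

theorem continuousOn_inverse [CompleteSpace 𝔅] (hb : ResolventBound S w C a) :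
    ContinuousOn (fun σ => Ring.inverse (algebraMap ℂ 𝔅 σ - a)) S := by
  intro σ hσ
  obtain ⟨u, hu⟩ := (hb σ hσ).1
  have h1 : ContinuousAt Ring.inverse (algebraMap ℂ 𝔅 σ - a) := hu ▸ NormedRing.inverse_continuousAt u
  have h2 : ContinuousAt (fun σ => algebraMap ℂ 𝔅 σ - a) σ :=
    ((continuous_algebraMap ℂ 𝔅).sub continuous_const).continuousAt
  exact (ContinuousAt.comp (f := fun σ => algebraMap ℂ 𝔅 σ - a) h1 h2).continuousWithinAt

/-- A measure carried by `S` for which `|σ - w|⁻²` is integrable, and a bounded density. -/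
structure IsCauchyData (m : Measure ℂ) (S : Set ℂ) (w : ℂ) (h : ℂ → ℂ) (M : ℝ) : Prop where
  measurableSet : MeasurableSet S
  restrict_eq : m.restrict S = m
  integrable : Integrable (fun σ => (‖σ - w‖ ^ 2)⁻¹) m
  aestronglyMeasurable : AEStronglyMeasurable h m
  bound : ∀ σ, ‖h σ‖ ≤ M
  ne : ∀ σ ∈ S, σ ≠ w

namespace IsCauchyData

theorem ae_mem (hd : IsCauchyData m S w h M) : ∀ᵐ σ ∂m, σ ∈ S := by
  rw [← hd.restrict_eq]; exact ae_restrict_mem hd.measurableSet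

theorem nonneg (hd : IsCauchyData m S w h M) : 0 ≤ M := (norm_nonneg _).trans (hd.bound 0)

theorem aestronglyMeasurable_of_continuousOn {E : Type*} [NormedAddCommGroup E]
    (hd : IsCauchyData m S w h M) {f : ℂ → E}
    (hf : ContinuousOn f S) : AEStronglyMeasurable f m := by
  rw [← hd.restrict_eq]; exact hf.aestronglyMeasurable hd.measurableSet

theorem aestronglyMeasurable_resolventDiff [CompleteSpace 𝔅] (hd : IsCauchyData m S w h M)
    (hb : ResolventBound S w C a) :
    AEStronglyMeasurable (fun σ => h σ • resolventDiff w σ a) m := by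
  refine hd.aestronglyMeasurable.smul ?_
  refine (hd.aestronglyMeasurable_of_continuousOn (continuousOn_inverse hb)).sub ?_
  refine hd.aestronglyMeasurable_of_continuousOn ?_
  refine (continuous_algebraMap ℂ 𝔅).comp_continuousOn ?_
  exact (continuousOn_id.sub continuousOn_const).inv₀ fun σ hσ => sub_ne_zero.2 (hd.ne σ hσ)

theorem integrable_resolventDiff [CompleteSpace 𝔅] (hd : IsCauchyData m S w h M)
    (hb : ResolventBound S w C a) : Integrable (fun σ => h σ • resolventDiff w σ a) m := by
  refine (hd.integrable.const_mul (M * (C * ‖a - algebraMap ℂ 𝔅 w‖))).mono'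
    (hd.aestronglyMeasurable_resolventDiff hb) ?_
  filter_upwards [hd.ae_mem] with σ hσ
  rw [mul_assoc]
  refine (norm_smul_le _ _).trans ?_
  have := norm_resolventDiff_le hb hσ (hd.ne σ hσ)
  have := hd.nonneg
  gcongr
  exact hd.bound σ

/-- Differentiation under the integral sign: the derivative of the resolvent is `R b R`, of order
`|σ - w|⁻²` uniformly for `t ∈ U`. -/
theorem differentiableAt_cauchyTransform [CompleteSpace 𝔅] (hd : IsCauchyData m S w h M) {U : Set ℂ}
    (hU : IsOpen U) (hC : 0 ≤ C) (hb : ∀ t ∈ U, ResolventBound S w C (a + t • b)) {t : ℂ}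
    (ht : t ∈ U) :
    DifferentiableAt ℂ (fun t : ℂ => cauchyTransform m w h (a + t • b)) t := by
  have hderiv : ∀ σ ∈ S, ∀ t ∈ U, HasDerivAt (fun t : ℂ => h σ • resolventDiff w σ (a + t • b))
      (h σ • (Ring.inverse (algebraMap ℂ 𝔅 σ - (a + t • b)) * b *
        Ring.inverse (algebraMap ℂ 𝔅 σ - (a + t • b)))) t := by
    intro σ hσ t ht
    obtain ⟨u, hu⟩ := (hb t ht σ hσ).1
    have h1 : HasDerivAt (fun t : ℂ => algebraMap ℂ 𝔅 σ - (a + t • b)) (-((1 : ℂ) • b)) t :=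
      (((hasDerivAt_id t).smul_const b).const_add a).const_sub _
    have h2 := hasFDerivAt_ringInverse (𝕜 := ℂ) u
    rw [hu] at h2
    have h3 := h2.comp_hasDerivAt t h1
    have h4 : HasDerivAt (fun t : ℂ => resolventDiff w σ (a + t • b))
        (Ring.inverse (algebraMap ℂ 𝔅 σ - (a + t • b)) * b *
          Ring.inverse (algebraMap ℂ 𝔅 σ - (a + t • b))) t := by
      refine HasDerivAt.sub_const _ (h3.congr_deriv ?_)
      rw [← hu, Ring.inverse_unit]
      simp
    exact h4.const_smul (h σ)
  obtain ⟨ε, hε, hball⟩ := Metric.isOpen_iff.1 hU t ht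
  have := hasDerivAt_integral_of_dominated_loc_of_deriv_le (μ := m)
    (F := fun t σ => h σ • resolventDiff w σ (a + t • b))
    (F' := fun t σ => h σ • (Ring.inverse (algebraMap ℂ 𝔅 σ - (a + t • b)) * b *
        Ring.inverse (algebraMap ℂ 𝔅 σ - (a + t • b))))
    (bound := fun σ => M * (C ^ 2 * ‖b‖) * (‖σ - w‖ ^ 2)⁻¹) (x₀ := t) (hU.mem_nhds ht)
    (Filter.eventually_of_mem (hU.mem_nhds ht) fun t ht =>
      hd.aestronglyMeasurable_resolventDiff (hb t ht))
    (hd.integrable_resolventDiff (hb t ht)) ?_ ?_ (hd.integrable.const_mul _) ?_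
  · exact this.2.differentiableAt
  · have hc := continuousOn_inverse (hb t ht)
    exact hd.aestronglyMeasurable.smul
      (hd.aestronglyMeasurable_of_continuousOn ((hc.mul continuousOn_const).mul hc))
  · filter_upwards [hd.ae_mem] with σ hσ s hs
    have h1 := (hb s hs σ hσ).2
    have h0 := hd.nonneg
    refine (norm_smul_le _ _).trans ?_
    calc _ ≤ M * (C / ‖σ - w‖ * ‖b‖ * (C / ‖σ - w‖)) := by
          gcongr
          · exact hd.bound σ
          · exact (norm_mul_le _ _).trans (by gcongr; exact (norm_mul_le _ _).trans (by gcongr))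
      _ = _ := by field_simp
  · filter_upwards [hd.ae_mem] with σ hσ s hs
    exact hderiv σ hσ s hs

end IsCauchyData

/-! ### Power series with values in a Banach algebra -/

/-- `X` is the value at `e` of the power series that represents `f` in the disc of radius `d`. -/
def IsPowerSeriesValue (d : ℝ) (e : 𝔅) (f : ℂ → ℂ) (X : 𝔅) : Prop :=
  ∃ c : ℕ → ℂ, (∀ x : ℂ, ‖x‖ < d → HasSum (fun n => c n * x ^ n) (f x)) ∧
    HasSum (fun n => c n • e ^ n) X

namespace IsPowerSeriesValue

variable {d : ℝ} {e X Y : 𝔅} {f g : ℂ → ℂ}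

theorem one : IsPowerSeriesValue d e (fun _ => 1) 1 := by
  refine ⟨fun n => if n = 0 then 1 else 0, fun x _ => ?_, ?_⟩
  · convert! hasSum_single (α := ℂ) 0 ?_ using 1
    · simp
    · intro n hn; simp [hn]
  · convert! hasSum_single (α := 𝔅) 0 ?_ using 1
    · simp
    · intro n hn; simp [hn]

theorem add (hf : IsPowerSeriesValue d e f X) (hg : IsPowerSeriesValue d e g Y) :
    IsPowerSeriesValue d e (fun x => f x + g x) (X + Y) := by
  obtain ⟨c, hc, hX⟩ := hf
  obtain ⟨c', hc', hY⟩ := hg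
  refine ⟨fun n => c n + c' n, fun x hx => ?_, ?_⟩
  · simpa only [add_mul] using (hc x hx).add (hc' x hx)
  · simpa only [add_smul] using hX.add hY

theorem const_mul (hf : IsPowerSeriesValue d e f X) (k : ℂ) :
    IsPowerSeriesValue d e (fun x => k * f x) (k • X) := by
  obtain ⟨c, hc, hX⟩ := hf
  refine ⟨fun n => k * c n, fun x hx => ?_, ?_⟩
  · simpa only [mul_assoc] using (hc x hx).mul_left k
  · simpa only [mul_smul] using hX.const_smul k

theorem id_mul (hf : IsPowerSeriesValue d e f X) :
    IsPowerSeriesValue d e (fun x => x * f x) (X * e) := by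
  obtain ⟨c, hc, hX⟩ := hf
  -- Multiplication by `x` shifts the coefficients and puts `0` in front.
  refine ⟨fun n => Nat.casesOn n 0 c, fun x hx => ?_, ?_⟩
  · rw [← hasSum_nat_add_iff' 1]
    have h : HasSum (fun n => c n * x ^ (n + 1)) (x * f x) := by
      convert! (hc x hx).mul_left x using 1
      funext n; rw [pow_succ]; ring
    simpa using h
  · rw [← hasSum_nat_add_iff' 1]
    have h : HasSum (fun n => c n • e ^ (n + 1)) (X * e) := by
      simpa only [pow_succ, smul_mul_assoc] using hX.mul_right e
    simpa using h

/-- Together with `eq_zero` this carries a polynomial identity between scalar power series to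
elements near `w` without a functional calculus. -/
theorem mul_aeval (hf : IsPowerSeriesValue d e f X) (w : ℂ) (q : Polynomial ℂ) :
    IsPowerSeriesValue d e (fun x => f x * q.eval (w + x))
      (X * Polynomial.aeval (algebraMap ℂ 𝔅 w + e) q) := by
  induction q using Polynomial.induction_on with
  | C k =>
    have := hf.const_mul k
    simp only [Polynomial.eval_C, Polynomial.aeval_C]
    rw [Algebra.algebraMap_eq_smul_one, mul_smul_comm, mul_one]
    simpa only [mul_comm] using this
  | add p q hp hq =>
    have := hp.add hq
    simpa only [Polynomial.eval_add, map_add, mul_add] using this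
  | monomial n k ih =>
    have h := (ih.const_mul w).add ih.id_mul
    convert! h using 1
    · funext x
      simp only [Polynomial.eval_mul, Polynomial.eval_C, Polynomial.eval_pow, Polynomial.eval_X]
      ring
    · rw [pow_succ, ← mul_assoc, map_mul _ _ Polynomial.X, Polynomial.aeval_X, mul_add,
        ← Algebra.commutes, ← Algebra.smul_def, mul_add, mul_smul_comm, mul_assoc]

/-- The coefficients are determined by the function, so those of zero vanish. -/
theorem eq_zero (hf : IsPowerSeriesValue d e f X) (hd : 0 < d) (h0 : ∀ x, ‖x‖ < d → f x = 0) :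
    X = 0 := by
  obtain ⟨c, hc, hX⟩ := hf
  have hc0 : c = 0 := by
    set p := FormalMultilinearSeries.ofScalars ℂ c with hp
    have h1 : HasFPowerSeriesAt (0 : ℂ → ℂ) p 0 := by
      rw [hasFPowerSeriesAt_iff]
      filter_upwards [Metric.ball_mem_nhds (0 : ℂ) hd] with x hx
      have hx' : ‖x‖ < d := by simpa using hx
      have := hc x hx'
      rw [h0 x hx'] at this
      simpa [hp, FormalMultilinearSeries.coeff_ofScalars, mul_comm] using this
    have h2 := h1.eq_zero
    funext n
    have h3 : p.coeff n = c n := FormalMultilinearSeries.coeff_ofScalars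
    rw [← h3, h2]
    simp [FormalMultilinearSeries.coeff]
  rw [hc0] at hX
  simpa using hX.unique (by simp : HasSum (fun n : ℕ => (0 : ℕ → ℂ) n • e ^ n) 0)

end IsPowerSeriesValue

/-! ### Expansion of the Cauchy transform near `w` and its continuation -/

theorem hasSum_resolventDiff [CompleteSpace 𝔅] {σ : ℂ} {d : ℝ} {e : 𝔅} (hd : 0 < d)
    (hσ : d ≤ ‖σ - w‖) (he : ‖e‖ < d) :
    HasSum (fun n : ℕ => ((σ - w)⁻¹) ^ (n + 2) • e ^ (n + 1))
      (resolventDiff w σ (algebraMap ℂ 𝔅 w + e)) := by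
  have hpos : 0 < ‖σ - w‖ := hd.trans_le hσ
  have h0 : σ - w ≠ 0 := norm_pos_iff.1 hpos
  set x : 𝔅 := (σ - w)⁻¹ • e with hx
  have hx1 : ‖x‖ < 1 := by
    refine (norm_smul_le _ _).trans_lt ?_
    rw [norm_inv, inv_mul_lt_iff₀ hpos, mul_one]
    exact he.trans_le hσ
  have hgeo : HasSum (fun n : ℕ => x ^ n) (Ring.inverse (1 - x)) := by
    rw [NormedRing.inverse_one_sub x hx1]
    exact (summable_geometric_of_norm_lt_one hx1).hasSum
  have hfac : algebraMap ℂ 𝔅 σ - (algebraMap ℂ 𝔅 w + e) = (σ - w) • (1 - x) := by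
    rw [smul_sub, hx, smul_inv_smul₀ h0, ← sub_sub, ← map_sub, Algebra.algebraMap_eq_smul_one]
  have hu : IsUnit (1 - x) := isUnit_one_sub_of_norm_lt_one hx1
  have hinv : Ring.inverse (algebraMap ℂ 𝔅 σ - (algebraMap ℂ 𝔅 w + e)) =
      (σ - w)⁻¹ • Ring.inverse (1 - x) := by
    rw [hfac]
    obtain ⟨u, hu⟩ := hu
    rw [← hu, Ring.inverse_unit]
    have : (σ - w) • (u : 𝔅) = ((Units.mk0 (σ - w) h0) • u : 𝔅ˣ) := rfl
    rw [this, Ring.inverse_unit]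
    simp [Units.smul_def]
  have h1 := (hgeo.const_smul (σ - w)⁻¹)
  rw [← hinv] at h1
  -- The constant term of the geometric series is what the normalization at `w` subtracts, whence
  -- the exponents `n + 2` and `n + 1`.
  have h2 := (hasSum_nat_add_iff' 1).2 h1
  simp only [Finset.sum_range_one, pow_zero] at h2
  rw [resolventDiff, Algebra.algebraMap_eq_smul_one (σ - w)⁻¹]
  convert! h2 using 1
  funext n
  rw [hx, smul_pow, smul_smul, ← pow_succ']

theorem hasSum_cauchyTransform [CompleteSpace 𝔅] (hdat : IsCauchyData m S w h M)
    {d : ℝ} (hd : 0 < d) (hS : ∀ σ ∈ S, d ≤ ‖σ - w‖) {e : 𝔅} (he : ‖e‖ < d) :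
    HasSum (fun n : ℕ => (∫ σ, h σ * ((σ - w)⁻¹) ^ (n + 2) ∂m) • e ^ (n + 1))
      (cauchyTransform m w h (algebraMap ℂ 𝔅 w + e)) := by
  have hmeas : ∀ n : ℕ, AEStronglyMeasurable (fun σ => h σ * ((σ - w)⁻¹) ^ (n + 2)) m := fun n =>
    hdat.aestronglyMeasurable.mul
      (by fun_prop : Measurable fun σ : ℂ => ((σ - w)⁻¹) ^ (n + 2)).aestronglyMeasurable
  have hbd : ∀ n : ℕ, ∀ᵐ σ ∂m, ‖h σ * ((σ - w)⁻¹) ^ (n + 2)‖ ≤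
      M * d⁻¹ ^ n * (‖σ - w‖ ^ 2)⁻¹ := by
    intro n
    filter_upwards [hdat.ae_mem] with σ hσ
    have h1 : ‖σ - w‖⁻¹ ≤ d⁻¹ := inv_anti₀ hd (hS σ hσ)
    have := hdat.nonneg
    rw [norm_mul, norm_pow, norm_inv, pow_add, inv_pow _ 2, ← mul_assoc]
    gcongr
    exact hdat.bound σ
  have hint : ∀ n : ℕ, Integrable (fun σ => h σ * ((σ - w)⁻¹) ^ (n + 2)) m := fun n =>
    (hdat.integrable.const_mul (M * d⁻¹ ^ n)).mono' (hmeas n) (hbd n)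
  set I := ∫ σ, (‖σ - w‖ ^ 2)⁻¹ ∂m with hI
  have h1 := hasSum_integral_of_summable_integral_norm (μ := m)
    (F := fun (n : ℕ) σ => (h σ * ((σ - w)⁻¹) ^ (n + 2)) • e ^ (n + 1))
    (fun n => (hint n).smul_const _) ?_
  · have h2 : ∫ σ, ∑' n : ℕ, (h σ * ((σ - w)⁻¹) ^ (n + 2)) • e ^ (n + 1) ∂m =
        cauchyTransform m w h (algebraMap ℂ 𝔅 w + e) := by
      refine integral_congr_ae ?_
      filter_upwards [hdat.ae_mem] with σ hσ
      have := (hasSum_resolventDiff (w := w) (e := e) hd (hS σ hσ) he).const_smul (h σ)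
      simp only [smul_smul] at this
      exact this.tsum_eq
    rw [h2] at h1
    simpa only [integral_smul_const] using h1
  · have hr : ‖e‖ / d < 1 := (div_lt_one hd).2 he
    have hsum : Summable fun n : ℕ => M * I * ‖e‖ * (‖e‖ / d) ^ n :=
      (summable_geometric_of_lt_one (by positivity) hr).mul_left _
    refine Summable.of_nonneg_of_le (fun n => integral_nonneg fun σ => norm_nonneg _)
      (fun n => ?_) hsum
    have h3 : ∫ σ, ‖(h σ * ((σ - w)⁻¹) ^ (n + 2)) • e ^ (n + 1)‖ ∂m ≤
        ∫ σ, M * d⁻¹ ^ n * ‖e‖ ^ (n + 1) * (‖σ - w‖ ^ 2)⁻¹ ∂m := by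
      refine integral_mono_ae ((hint n).smul_const _).norm (hdat.integrable.const_mul _) ?_
      filter_upwards [hbd n] with σ hσ
      calc _ ≤ ‖h σ * ((σ - w)⁻¹) ^ (n + 2)‖ * ‖e ^ (n + 1)‖ := norm_smul_le _ _
        _ ≤ (M * d⁻¹ ^ n * (‖σ - w‖ ^ 2)⁻¹) * ‖e‖ ^ (n + 1) := by
            gcongr
            · exact (norm_nonneg _).trans hσ
            -- The exponent must be positive: `𝔅` is not assumed to have `‖1‖ = 1`.
            · exact norm_pow_le' e (Nat.succ_pos n)
        _ = _ := by ring
    refine h3.trans (le_of_eq ?_)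
    rw [integral_const_mul, ← hI, div_pow, inv_pow, pow_succ]
    field_simp

theorem isPowerSeriesValue_cauchyTransform [CompleteSpace 𝔅] (hdat : IsCauchyData m S w h M)
    {d : ℝ} (hd : 0 < d) (hS : ∀ σ ∈ S, d ≤ ‖σ - w‖) {e : 𝔅} (he : ‖e‖ < d) :
    IsPowerSeriesValue d e (fun x => cauchyTransform m w h (w + x))
      (cauchyTransform m w h (algebraMap ℂ 𝔅 w + e)) := by
  refine ⟨fun n => Nat.casesOn n 0 fun k => ∫ σ, h σ * ((σ - w)⁻¹) ^ (k + 2) ∂m,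
    fun x hx => ?_, ?_⟩
  · rw [← hasSum_nat_add_iff' 1]
    simpa using hasSum_cauchyTransform hdat hd hS hx
  · rw [← hasSum_nat_add_iff' 1]
    simpa using hasSum_cauchyTransform hdat hd hS he

/-- A Cauchy transform that agrees with a rational function near `w` does so at `w + b`, if the
segment from `w` to `w + b` avoids the singularities. -/
theorem cauchyTransform_mul_aeval_eq [CompleteSpace 𝔅] (hdat : IsCauchyData m S w h M)
    {d : ℝ} (hd : 0 < d) (hS : ∀ σ ∈ S, d ≤ ‖σ - w‖) {U : Set ℂ} (hU : IsOpen U)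
    (hUc : IsPreconnected U) (h0 : 0 ∈ U) (h1 : 1 ∈ U) (hC : 0 ≤ C)
    (hb : ∀ t ∈ U, ResolventBound S w C (algebraMap ℂ 𝔅 w + t • b)) (p q : Polynomial ℂ)
    (hpq : ∀ x : ℂ, ‖x‖ < d → cauchyTransform m w h (w + x) * q.eval (w + x) = p.eval (w + x)) :
    cauchyTransform m w h (algebraMap ℂ 𝔅 w + b) * Polynomial.aeval (algebraMap ℂ 𝔅 w + b) q =
      Polynomial.aeval (algebraMap ℂ 𝔅 w + b) p := by
  have hpoly : ∀ r : Polynomial ℂ,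
      Differentiable ℂ fun t : ℂ => Polynomial.aeval (algebraMap ℂ 𝔅 w + t • b) r := by
    intro r
    simp only [Polynomial.aeval_eq_sum_range]
    fun_prop
  have hl : DifferentiableOn ℂ (fun t : ℂ => cauchyTransform m w h (algebraMap ℂ 𝔅 w + t • b) *
      Polynomial.aeval (algebraMap ℂ 𝔅 w + t • b) q) U := fun t ht =>
    ((hdat.differentiableAt_cauchyTransform hU hC hb ht).mul (hpoly q t)).differentiableWithinAt
  have hnear : (fun t : ℂ => cauchyTransform m w h (algebraMap ℂ 𝔅 w + t • b) *
      Polynomial.aeval (algebraMap ℂ 𝔅 w + t • b) q) =ᶠ[𝓝 0]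
      fun t : ℂ => Polynomial.aeval (algebraMap ℂ 𝔅 w + t • b) p := by
    have hsm : ∀ᶠ t : ℂ in 𝓝 0, ‖t • b‖ < d := by
      have : Tendsto (fun t : ℂ => ‖t • b‖) (𝓝 0) (𝓝 0) := by
        have hc : Continuous fun t : ℂ => ‖t • b‖ := by fun_prop
        simpa using hc.tendsto 0
      exact this.eventually (gt_mem_nhds hd)
    filter_upwards [hsm] with t ht
    -- For small `t` the difference of the two sides is the value of a power series that represents
    -- zero.
    have hv := ((isPowerSeriesValue_cauchyTransform hdat hd hS ht).mul_aeval w q).add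
      ((IsPowerSeriesValue.one.mul_aeval w p).const_mul (-1))
    have := hv.eq_zero hd fun x hx => by rw [hpq x hx]; ring
    rw [one_mul, neg_one_smul] at this
    exact add_neg_eq_zero.1 this
  -- Both sides are analytic in `t` on the connected set `U`; the identity theorem leads from `t =
  -- 0` to `t = 1`.
  have hEq := (hl.analyticOnNhd hU).eqOn_of_preconnected_of_eventuallyEq
    ((hpoly p).differentiableOn.analyticOnNhd hU) hUc h0 hnear h1
  simpa using hEq

end Cauchy

end

section

open InnerProductSpace

variable {Ω : Set ℂ} {z w : ℂ}

/-! ### The double-layer potential as a sum of Cauchy transforms -/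

/-- The density of the Cauchy transform associated with a boundary function. -/
def boundaryDensity (g : frontier Ω →ᵇ ℂ) (σ : ℂ) : ℂ :=
  extendBoundary g σ * (1 / (2 * Real.pi) * outerNormal Ω σ)

theorem norm_boundaryDensity_le (g : frontier Ω →ᵇ ℂ) (σ : ℂ) : ‖boundaryDensity g σ‖ ≤ ‖g‖ := by
  have h1 : ‖(1 / (2 * Real.pi) : ℂ)‖ ≤ 1 := by
    rw [norm_div, norm_one, norm_mul, Complex.norm_real, Real.norm_of_nonneg Real.pi_pos.le,
      Complex.norm_ofNat, div_le_one (by have := Real.pi_pos; positivity)]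
    linarith [Real.pi_gt_three]
  rw [boundaryDensity, norm_mul, norm_mul]
  calc _ ≤ ‖g‖ * (1 * 1) := by
        gcongr
        · exact norm_extendBoundary_le g σ
        · exact norm_outerNormal_le Ω σ
    _ = ‖g‖ := by ring

theorem isCauchyData_boundaryDensity (hopen : IsOpen Ω) (hconv : Convex ℝ Ω) (hw : w ∈ Ω)
    (g : frontier Ω →ᵇ ℂ) :
    IsCauchyData (μH[1].restrict (frontier Ω)) (frontier Ω) w (boundaryDensity g) ‖g‖ where
  measurableSet := measurableSet_frontier' Ω
  restrict_eq := by rw [Measure.restrict_restrict (measurableSet_frontier' Ω), inter_self]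
  integrable := integrableOn_inv_sq_frontier hopen hconv hw
  aestronglyMeasurable :=
    ((continuousOn_extendBoundary g).aestronglyMeasurable (measurableSet_frontier' Ω)).mul
      ((aestronglyMeasurable_outerNormal hopen hconv hw).const_mul _)
  bound := norm_boundaryDensity_le g
  ne := fun _ hσ => ne_of_mem_frontier hopen hσ hw

theorem extendBoundary_star (g : frontier Ω →ᵇ ℂ) (σ : ℂ) :
    extendBoundary (star g) σ = (starRingEnd ℂ) (extendBoundary g σ) := by
  by_cases h : σ ∈ frontier Ω
  · rw [show σ = ((⟨σ, h⟩ : frontier Ω) : ℂ) from rfl, extendBoundary_coe, extendBoundary_coe]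
    rfl
  · have hn : ¬ ∃ a : frontier Ω, (a : ℂ) = σ := by rintro ⟨a, rfl⟩; exact h a.2
    rw [extendBoundary, extendBoundary, Function.extend_apply' _ _ _ hn,
      Function.extend_apply' _ _ _ hn]
    simp

/-- Points outside `Ω` are uniformly far from the points near a compact subset of `Ω`. -/
theorem exists_pos_mul_norm_sub_le (hopen : IsOpen Ω) {K : Set ℂ} (hK : IsCompact K) (hKΩ : K ⊆ Ω)
    (w : ℂ) : ∃ ε : ℝ, 0 < ε ∧ ∃ c : ℝ, 0 < c ∧ ∀ v ∈ Metric.thickening ε K, ∀ σ ∉ Ω,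
      c * ‖σ - w‖ ≤ ‖σ - v‖ := by
  obtain ⟨δ, hδ, hsub⟩ := hK.exists_thickening_subset_open hopen hKΩ
  obtain ⟨R, hR⟩ := hK.isBounded.exists_norm_le
  set R' := |R| + δ + ‖w‖ with hR'
  have hR'0 : 0 ≤ R' := by positivity
  refine ⟨δ / 2, by positivity, δ / 2 / (δ / 2 + R'), by positivity, fun v hv σ hσ => ?_⟩
  obtain ⟨k, hk, hvk⟩ := Metric.mem_thickening_iff.1 hv
  have h1 : δ / 2 ≤ ‖σ - v‖ := by
    by_contra! h
    apply hσ
    apply hsub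
    refine Metric.mem_thickening_iff.2 ⟨k, hk, ?_⟩
    have := dist_triangle σ v k
    rw [← dist_eq_norm] at h
    linarith
  have h2 : ‖v - w‖ ≤ R' := by
    have e1 : ‖v‖ ≤ ‖v - k‖ + ‖k‖ := by simpa using norm_add_le (v - k) k
    have e2 := norm_sub_le v w
    have e3 := (hR k hk).trans (le_abs_self R)
    rw [dist_eq_norm] at hvk
    linarith
  have h3 : ‖σ - w‖ ≤ ‖σ - v‖ + ‖v - w‖ := by simpa using norm_add_le (σ - v) (v - w)
  have hpos : 0 < δ / 2 + R' := by positivity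
  rw [div_mul_eq_mul_div, div_le_iff₀ hpos]
  nlinarith

theorem differentiableOn_cauchyTransform (hopen : IsOpen Ω) (hconv : Convex ℝ Ω) (hw : w ∈ Ω)
    (g : frontier Ω →ᵇ ℂ) :
    DifferentiableOn ℂ (fun z : ℂ =>
      cauchyTransform (μH[1].restrict (frontier Ω)) w (boundaryDensity g) z) Ω := by
  intro z hz
  obtain ⟨ε, hε, c, hc, H⟩ := exists_pos_mul_norm_sub_le hopen (isCompact_singleton (x := z))
    (singleton_subset_iff.2 hz) w
  -- Scalars are the case `𝔅 = ℂ` of the algebra lemma, with `t` itself written as `0 + t • 1`.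
  have hb : ∀ t ∈ Metric.ball z ε, ResolventBound (frontier Ω) w c⁻¹ ((0 : ℂ) + t • (1 : ℂ)) := by
    intro t ht σ hσ
    have hσΩ : σ ∉ Ω := fun h => ne_of_mem_frontier hopen hσ h rfl
    have h1 := H t (by rwa [Metric.thickening_singleton]) σ hσΩ
    have h2 : 0 < ‖σ - w‖ := norm_pos_iff.2 (sub_ne_zero.2 (ne_of_mem_frontier hopen hσ hw))
    have h3 : 0 < ‖σ - t‖ := lt_of_lt_of_le (by positivity) h1
    simp only [zero_add, smul_eq_mul, mul_one, Algebra.algebraMap_self, RingHom.id_apply]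
    refine ⟨isUnit_iff_ne_zero.2 (norm_pos_iff.1 h3), ?_⟩
    rw [Ring.inverse_eq_inv', norm_inv, ← one_div, ← one_div, div_div, div_le_div_iff₀ h3
      (by positivity)]
    linarith
  have := (isCauchyData_boundaryDensity hopen hconv hw g).differentiableAt_cauchyTransform
    Metric.isOpen_ball (by positivity) hb (Metric.mem_ball_self hε)
  simpa using this.differentiableWithinAt

theorem resolventBound_of_mem (hopen : IsOpen Ω) (hw : w ∈ Ω) (hz : z ∈ Ω) :
    ∃ C, ResolventBound (frontier Ω) w C z := by
  obtain ⟨ε, hε, c, hc, H⟩ := exists_pos_mul_norm_sub_le hopen (isCompact_singleton (x := z))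
    (singleton_subset_iff.2 hz) w
  refine ⟨c⁻¹, fun σ hσ => ?_⟩
  have hσΩ : σ ∉ Ω := fun h => ne_of_mem_frontier hopen hσ h rfl
  have h1 := H z (by rw [Metric.thickening_singleton]; exact Metric.mem_ball_self hε) σ hσΩ
  have h2 : 0 < ‖σ - w‖ := norm_pos_iff.2 (sub_ne_zero.2 (ne_of_mem_frontier hopen hσ hw))
  have h3 : 0 < ‖σ - z‖ := lt_of_lt_of_le (by positivity) h1
  refine ⟨isUnit_iff_ne_zero.2 (norm_pos_iff.1 h3), ?_⟩
  simp only [Algebra.algebraMap_self, RingHom.id_apply]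
  rw [Ring.inverse_eq_inv', norm_inv, ← one_div, ← one_div, div_div, div_le_div_iff₀ h3
    (by positivity)]
  linarith

/-- The two halves of the kernel need not be integrable separately. Subtracting the kernel at `w`
makes them so, and the conjugate half with density `g` is the conjugate of a transform with density
built from `ḡ`. -/
theorem doubleLayer_eq_cauchyTransform (hopen : IsOpen Ω) (hconv : Convex ℝ Ω) (hw : w ∈ Ω)
    (hz : z ∈ Ω) (g : frontier Ω →ᵇ ℂ) :
    doubleLayer Ω g z = doubleLayer Ω g w +
      cauchyTransform (μH[1].restrict (frontier Ω)) w (boundaryDensity g) z +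
      (starRingEnd ℂ)
        (cauchyTransform (μH[1].restrict (frontier Ω)) w (boundaryDensity (star g)) z) := by
  obtain ⟨C, hC⟩ := resolventBound_of_mem hopen hw hz
  have hFm := (continuousOn_extendBoundary g).aestronglyMeasurable
    (μ := (μH[1] : Measure ℂ)) (measurableSet_frontier' Ω)
  have hk : ∀ z ∈ Ω, Integrable (fun σ => extendBoundary g σ * kernel Ω σ z)
      ((μH[1] : Measure ℂ).restrict (frontier Ω)) := fun z hz =>
    (integrableOn_kernel hopen hconv hz).bdd_mul hFm
      (Eventually.of_forall (norm_extendBoundary_le g))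
  have h1 := (isCauchyData_boundaryDensity hopen hconv hw g).integrable_resolventDiff hC
  have h2 := (isCauchyData_boundaryDensity hopen hconv hw (star g)).integrable_resolventDiff hC
  have h2' : Integrable (fun σ => (starRingEnd ℂ) (boundaryDensity (star g) σ •
      resolventDiff w σ z)) ((μH[1] : Measure ℂ).restrict (frontier Ω)) :=
    (LinearIsometryEquiv.integrable_comp_iff Complex.conjLIE).2 h2
  have h12 : Integrable (fun σ => boundaryDensity g σ • resolventDiff w σ z +
      (starRingEnd ℂ) (boundaryDensity (star g) σ • resolventDiff w σ z))
      ((μH[1] : Measure ℂ).restrict (frontier Ω)) := h1.add h2'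
  rw [doubleLayer_eq_integral, doubleLayer_eq_integral, cauchyTransform, cauchyTransform,
    ← integral_conj, add_assoc, ← integral_add h1 h2', ← integral_add (hk w hw) h12]
  refine integral_congr_ae ?_
  filter_upwards [ae_restrict_mem (measurableSet_frontier' Ω)] with σ hσ
  have e1 : resolventDiff w σ z = (σ - z)⁻¹ - (σ - w)⁻¹ := by
    simp [resolventDiff]
  simp only [e1, boundaryDensity, extendBoundary_star, kernel, smul_eq_mul, map_mul,
    Complex.conj_conj, map_sub, map_inv₀, map_div₀, map_one, Complex.conj_ofReal, map_ofNat]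
  ring

theorem harmonicOnNhd_doubleLayer (hopen : IsOpen Ω) (hconv : Convex ℝ Ω)
    (g : frontier Ω →ᵇ ℂ) : HarmonicOnNhd (doubleLayer Ω g) Ω := by
  intro z hz
  have h1 := (differentiableOn_cauchyTransform hopen hconv hz g).analyticAt (hopen.mem_nhds hz)
  have h2 := (differentiableOn_cauchyTransform hopen hconv hz (star g)).analyticAt
    (hopen.mem_nhds hz)
  refine (harmonicAt_congr_nhds ?_).2
    (((harmonicAt_const (doubleLayer Ω g z)).add h1.harmonicAt).add h2.harmonicAt_conj)
  filter_upwards [hopen.mem_nhds hz] with z' hz'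
  exact doubleLayer_eq_cauchyTransform hopen hconv hz hz' g

/-! ### The maximum principle -/

/-- A harmonic function plus `δ |z - c|²` has no local maximum at `c`. -/
theorem not_harmonic_max {v : ℂ → ℝ} {c : ℂ} {r δ : ℝ} (hr : 0 < r) (hδ : 0 < δ)
    (hv : HarmonicOnNhd v (Metric.closedBall c r))
    (h : ∀ x ∈ Metric.sphere c r, v x + δ * r ^ 2 ≤ v c) : False := by
  have habs : |r| = r := abs_of_pos hr
  have h1 : Real.circleAverage v c r = v c :=
    InnerProductSpace.HarmonicOnNhd.circleAverage_eq (by rwa [habs])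
  have h2 : Real.circleAverage v c r ≤ v c - δ * r ^ 2 := by
    refine Real.circleAverage_mono_on_of_le_circle ?_ ?_
    · refine ContinuousOn.circleIntegrable hr.le ?_
      exact hv.continuousOn.mono Metric.sphere_subset_closedBall
    · intro x hx
      rw [habs] at hx
      linarith [h x hx]
  nlinarith [sq_pos_of_pos hr]

/-- The maximum principle of Phragmén and Lindelöf for a bounded harmonic function in a convex
domain that is not the whole plane. -/
theorem harmonic_nonpos (hopen : IsOpen Ω) (hconv : Convex ℝ Ω) (hne : Ω ≠ univ) {v : ℂ → ℝ}
    (hc : ContinuousOn v (closure Ω)) (hv : HarmonicOnNhd v Ω) {M : ℝ} (hM : ∀ z ∈ Ω, v z ≤ M)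
    (h0 : ∀ z ∈ frontier Ω, v z ≤ 0) {z₀ : ℂ} (hz₀ : z₀ ∈ Ω) : v z₀ ≤ 0 := by
  obtain ⟨σ, hσ⟩ := (ne_univ_iff_exists_notMem Ω).1 hne
  obtain ⟨ν, hν⟩ := exists_isOuterNormal hopen hconv ⟨z₀, hz₀⟩ hσ
  -- The barrier: `ζ` maps `closure Ω` into `Re ≥ 1`, so `log |ζ|` is nonnegative and harmonic, and
  -- it tends to infinity at infinity.
  set ζ : ℂ → ℂ := fun x => 1 - (starRingEnd ℂ) ν * (x - σ) with hζ
  have hζre : ∀ x ∈ closure Ω, 1 ≤ ‖ζ x‖ := by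
    intro x hx
    have := hν.re_le_of_mem_closure hx
    refine le_trans ?_ (Complex.re_le_norm _)
    simp only [hζ, Complex.sub_re, Complex.one_re]
    linarith
  have hζan : ∀ x, AnalyticAt ℂ ζ x := fun x => by
    have : Differentiable ℂ ζ := by fun_prop
    exact this.analyticAt x
  have hζc : Continuous ζ := by fun_prop
  set L : ℂ → ℝ := fun x => Real.log ‖ζ x‖ with hL
  have hL0 : ∀ x ∈ closure Ω, 0 ≤ L x := fun x hx => Real.log_nonneg (hζre x hx)
  have hLh : HarmonicOnNhd L Ω := fun x hx => (hζan x).harmonicAt_log_norm (by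
    have := hζre x (subset_closure hx)
    intro h; rw [h, norm_zero] at this; linarith)
  have hLc : ContinuousOn L (closure Ω) := by
    refine ContinuousOn.log hζc.norm.continuousOn fun x hx => ?_
    have := hζre x hx
    positivity
  have hLbig : ∀ B : ℝ, ∀ x : ℂ, Real.exp B + ‖σ‖ + 1 ≤ ‖x‖ → B ≤ L x := by
    intro B x hx
    have h1 : Real.exp B ≤ ‖ζ x‖ := by
      have e1 : ‖(starRingEnd ℂ) ν * (x - σ)‖ = ‖x - σ‖ := by
        rw [norm_mul, RCLike.norm_conj, hν.1, one_mul]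
      have e2 := norm_sub_norm_le ((starRingEnd ℂ) ν * (x - σ)) 1
      rw [norm_sub_rev _ (1 : ℂ), e1, norm_one] at e2
      have e3 := norm_sub_norm_le x σ
      have e4 : ‖ζ x‖ = ‖1 - (starRingEnd ℂ) ν * (x - σ)‖ := rfl
      linarith
    rw [hL]
    exact (Real.le_log_iff_exp_le (lt_of_lt_of_le (Real.exp_pos B) h1)).2 h1
  have key : ∀ ε : ℝ, 0 < ε → ∃ R : ℝ, ∀ δ : ℝ, 0 < δ → v z₀ - ε * L z₀ ≤ δ * R ^ 2 := by
    intro ε hε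
    -- On `|x| = R` the barrier already exceeds `M/ε`. As `R` does not depend on `δ`, first `δ` and
    -- then `ε` can tend to `0`.
    set R : ℝ := Real.exp (M / ε) + ‖σ‖ + 1 + ‖z₀‖ with hR
    have hRpos : 0 < R := by positivity
    refine ⟨R, fun δ hδ => ?_⟩
    set f : ℂ → ℝ := fun x => v x - ε * L x + δ * ‖x‖ ^ 2 with hf
    set K := closure Ω ∩ Metric.closedBall 0 R with hK
    have hKc : IsCompact K := (isCompact_closedBall 0 R).inter_left isClosed_closure
    have hz₀K : z₀ ∈ K := ⟨subset_closure hz₀, by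
      rw [mem_closedBall_zero_iff, hR]; linarith [Real.exp_pos (M / ε), norm_nonneg σ]⟩
    have hfc : ContinuousOn f K := by
      have h1 := hc.mono (inter_subset_left : K ⊆ closure Ω)
      have h2 := hLc.mono (inter_subset_left : K ⊆ closure Ω)
      fun_prop
    obtain ⟨x, hxK, hx⟩ := hKc.exists_isMaxOn ⟨z₀, hz₀K⟩ hfc
    have hxR : ‖x‖ ≤ R := mem_closedBall_zero_iff.1 hxK.2
    have hfx : f x ≤ δ * R ^ 2 := by
      have hquad : δ * ‖x‖ ^ 2 ≤ δ * R ^ 2 := by gcongr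
      by_cases hxΩ : x ∈ Ω
      · rcases hxR.lt_or_eq with hlt | heq
        · exfalso
          have hopen2 : IsOpen (Ω ∩ Metric.ball 0 R) := hopen.inter Metric.isOpen_ball
          obtain ⟨r, hr, hball⟩ := Metric.nhds_basis_closedBall.mem_iff.1
            (hopen2.mem_nhds ⟨hxΩ, mem_ball_zero_iff.2 hlt⟩)
          -- The real part of `q` is the linear part of `|y|²` at `x`. It is harmonic, and the
          -- remainder is `r²` on the circle, so an interior maximum of `f` contradicts the mean
          -- value property.
          set q : ℂ → ℂ := fun y => 2 * (starRingEnd ℂ) x * (y - x) with hq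
          have hqh : HarmonicOnNhd (fun y => (q y).re) (Metric.closedBall x r) := fun y _ => by
            have : Differentiable ℂ q := by fun_prop
            exact (this.analyticAt y).harmonicAt_re
          have hH : HarmonicOnNhd (v - ε • L + δ • fun y => (q y).re) (Metric.closedBall x r) :=
            (((hv.mono (hball.trans inter_subset_left)).sub
              (hLh.mono (hball.trans inter_subset_left)).const_smul)).add hqh.const_smul
          refine not_harmonic_max hr hδ hH fun y hy => ?_
          have hyK : y ∈ K := by
            have := hball (Metric.sphere_subset_closedBall hy)
            exact ⟨subset_closure this.1, Metric.ball_subset_closedBall this.2⟩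
          have hmax : f y ≤ f x := hx hyK
          have hyr : ‖y - x‖ = r := by rwa [mem_sphere_iff_norm] at hy
          have hexp : ‖y‖ ^ 2 = ‖x‖ ^ 2 + (q y).re + r ^ 2 := by
            rw [← hyr, Complex.sq_norm, Complex.sq_norm, Complex.sq_norm]
            simp only [hq, Complex.normSq_apply, Complex.mul_re, Complex.mul_im, Complex.sub_re,
              Complex.sub_im, Complex.conj_re, Complex.conj_im, Complex.re_ofNat, Complex.im_ofNat]
            ring
          simp only [hf] at hmax
          rw [hexp] at hmax
          have hq0 : (q x).re = 0 := by simp [hq]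
          simp only [Pi.add_apply, Pi.sub_apply, Pi.smul_apply, smul_eq_mul, hq0]
          linarith
        · have h1 : M / ε ≤ L x := hLbig _ x (by rw [heq, hR]; linarith [norm_nonneg z₀])
          rw [div_le_iff₀ hε] at h1
          have h2 := hM x hxΩ
          simp only [hf]
          linarith
      · have h1 : x ∈ frontier Ω := by rw [hopen.frontier_eq]; exact ⟨hxK.1, hxΩ⟩
        have h2 := h0 x h1
        have h3 := mul_nonneg hε.le (hL0 x hxK.1)
        simp only [hf]
        linarith
    have h4 : f z₀ ≤ f x := hx hz₀K
    have h5 : v z₀ - ε * L z₀ ≤ f z₀ := by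
      simp only [hf]
      have : 0 ≤ δ * ‖z₀‖ ^ 2 := by positivity
      linarith
    linarith
  have key2 : ∀ ε : ℝ, 0 < ε → v z₀ ≤ ε * L z₀ := by
    intro ε hε
    obtain ⟨R, hR⟩ := key ε hε
    have : v z₀ - ε * L z₀ ≤ 0 := by
      refine le_of_forall_pos_le_add fun η hη => ?_
      have h1 := hR (η / (R ^ 2 + 1)) (by positivity)
      have h2 : η / (R ^ 2 + 1) * R ^ 2 ≤ η := by
        rw [div_mul_eq_mul_div, div_le_iff₀ (by positivity)]
        nlinarith [sq_nonneg R]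
      linarith
    linarith
  refine le_of_forall_pos_le_add fun η hη => ?_
  have hL1 : 0 < L z₀ + 1 := by linarith [hL0 z₀ (subset_closure hz₀)]
  have h1 := key2 (η / (L z₀ + 1)) (by positivity)
  have h2 : η / (L z₀ + 1) * L z₀ ≤ η := by
    rw [div_mul_eq_mul_div, div_le_iff₀ hL1]
    nlinarith
  linarith

/-- Apply the maximum principle to the real and imaginary parts and their negatives. -/
theorem harmonic_eq_zero (hopen : IsOpen Ω) (hconv : Convex ℝ Ω) (hne : Ω ≠ univ) {v : ℂ → ℂ}
    (hc : ContinuousOn v (closure Ω)) (hv : HarmonicOnNhd v Ω) {M : ℝ} (hM : ∀ z ∈ Ω, ‖v z‖ ≤ M)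
    (h0 : ∀ z ∈ frontier Ω, v z = 0) {z₀ : ℂ} (hz₀ : z₀ ∈ Ω) : v z₀ = 0 := by
  have key : ∀ l : ℂ →L[ℝ] ℝ, ‖l‖ ≤ 1 → l (v z₀) ≤ 0 := by
    intro l hl
    refine harmonic_nonpos hopen hconv hne (v := l ∘ v) (l.continuous.comp_continuousOn hc)
      (hv.comp_CLM l) (M := M) (fun z hz => ?_) (fun z hz => ?_) hz₀
    · refine (le_abs_self _).trans ((l.le_opNorm _).trans ?_)
      have := hM z hz
      nlinarith [norm_nonneg (v z), norm_nonneg l]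
    · simp [h0 z hz]
  have hre : ‖Complex.reCLM‖ ≤ 1 := Complex.reCLM_norm.le
  have him : ‖Complex.imCLM‖ ≤ 1 := Complex.imCLM_norm.le
  have h1 := key Complex.reCLM hre
  have h2 := key (-Complex.reCLM) (by rwa [norm_neg])
  have h3 := key Complex.imCLM him
  have h4 := key (-Complex.imCLM) (by rwa [norm_neg])
  simp only [_root_.neg_apply, Complex.reCLM_apply, Complex.imCLM_apply] at h1 h2 h3 h4
  exact Complex.ext (by simp; linarith) (by simp; linarith)

/-! ### The Neumann problem -/

/-- Solving the Neumann problem amounts to inverting `I + P`. -/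
theorem isNeumannSolution_iff (hopen : IsOpen Ω) (hconv : Convex ℝ Ω) (hne : Ω ≠ univ)
    (hw : w ∈ Ω) {r : ℂ → ℂ} (hr : IsDatum Ω r) (g : frontier Ω →ᵇ ℂ) :
    IsNeumannSolution Ω r g ↔ ∀ z : frontier Ω, g z + boundaryOp Ω g z = 2 * r z := by
  have hTc := continuousOn_angularAverage hopen hconv hw
    (continuousOn_extendBoundary g) (fun σ _ => norm_extendBoundary_le g σ)
  have hT : ∀ z ∈ Ω, doubleLayer Ω g z = angularAverage Ω w (extendBoundary g) z :=
    fun z hz => doubleLayer_eq_angularAverage hopen hconv hw hz g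
  constructor
  · intro h z
    rw [add_boundaryOp_eq_angularAverage hopen hconv hw]
    -- Both sides are continuous on the closure, so equality in `Ω` passes to the boundary.
    have hEq : EqOn (angularAverage Ω w (extendBoundary g)) (fun z => 2 * r z) Ω := by
      intro z hz
      rw [← hT z hz]
      simp only [h z hz]
      ring
    exact hEq.of_subset_closure hTc (hr.continuousOn.const_mul 2) subset_closure Subset.rfl z.2.1
  · intro h z hz
    obtain ⟨M, hM⟩ := hr.bounded
    -- Conversely, the difference is bounded and harmonic with zero boundary values.
    set u : ℂ → ℂ := fun z => angularAverage Ω w (extendBoundary g) z - 2 * r z with hu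
    have hz0 : u z = 0 := by
      refine harmonic_eq_zero hopen hconv hne (v := u)
        (M := ‖g‖ * (volume.real (hitAngles Ω w) / Real.pi) + 2 * M)
        (hTc.sub (hr.continuousOn.const_mul 2)) (fun x hx => ?_) (fun x hx => ?_) (fun x hx => ?_) hz
      · refine (harmonicAt_congr_nhds ?_).2 ((harmonicOnNhd_doubleLayer hopen hconv g x hx).sub
          ((hr.harmonic x hx).const_smul (c := 2)))
        filter_upwards [hopen.mem_nhds hx] with y hy
        simp [hu, hT y hy]
      · refine (norm_sub_le _ _).trans (add_le_add (norm_angularAverage_le hopen hconv hw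
          (subset_closure hx) (fun σ _ => norm_extendBoundary_le g σ)) ?_)
        rw [norm_mul, Complex.norm_ofNat]
        have := hM x hx
        gcongr
      · have := h ⟨x, hx⟩
        rw [add_boundaryOp_eq_angularAverage hopen hconv hw] at this
        simp only [hu, this, sub_self]
    rw [hT z hz]
    simp only [hu] at hz0
    linear_combination (-1 / 2 : ℂ) * hz0

theorem frontier_nonempty (hne : Ω ≠ univ) (hw : w ∈ Ω) : (frontier Ω).Nonempty := by
  rw [nonempty_iff_ne_empty]
  intro h
  rcases isClopen_iff.1 (isClopen_iff_frontier_eq_empty.2 h) with h | h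
  · rw [h] at hw; exact hw
  · exact hne h

theorem exists_isNeumannSolution (hopen : IsOpen Ω) (hconv : Convex ℝ Ω) (hne : Ω ≠ univ)
    (hw : w ∈ Ω) (hP : IsInvertibleIdAddP Ω) {r : ℂ → ℂ} (hr : IsDatum Ω r) :
    ∃! g : frontier Ω →ᵇ ℂ, IsNeumannSolution Ω r g := by
  obtain ⟨M, hM⟩ := hr.bounded
  have hMcl : ∀ z ∈ closure Ω, ‖r z‖ ≤ M := fun z hz =>
    le_on_closure hM hr.continuousOn.norm continuousOn_const hz
  let h : frontier Ω →ᵇ ℂ := BoundedContinuousFunction.ofNormedAddCommGroup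
    (fun z => 2 * r z)
    (continuous_const.mul (hr.continuousOn.mono frontier_subset_closure).domRestrict) (2 * M)
    (fun z => by
      rw [norm_mul, Complex.norm_ofNat]
      have := hMcl z z.2.1
      gcongr)
  obtain ⟨g, hg, hu⟩ := hP.bijective h
  exact ⟨g, (isNeumannSolution_iff hopen hconv hne hw hr g).2 hg,
    fun g' hg' => hu g' ((isNeumannSolution_iff hopen hconv hne hw hr g').1 hg')⟩

end

section

variable {Ω : Set ℂ} {z w : ℂ} {H : Type*} [NormedAddCommGroup H] [InnerProductSpace ℂ H]

/-! ### Resolvents and the numerical range -/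

theorem exists_mem_numRange_inner (A : H →L[ℂ] H) {x : H} (hx : x ≠ 0) :
    ∃ v ∈ numRange A, inner ℂ x (A x) = ((‖x‖ ^ 2 : ℝ) : ℂ) * v := by
  have h0 : ‖x‖ ≠ 0 := norm_ne_zero_iff.2 hx
  refine ⟨_, ⟨((‖x‖⁻¹ : ℝ) : ℂ) • x, ?_, rfl⟩, ?_⟩
  · rw [norm_smul, Complex.norm_real, norm_inv, norm_norm, inv_mul_cancel₀ h0]
  · have h1 : (‖x‖ : ℂ) ≠ 0 := by exact_mod_cast h0
    rw [map_smul, inner_smul_left, inner_smul_right, Complex.conj_ofReal]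
    push_cast
    field_simp

theorem isBounded_numRange (A : H →L[ℂ] H) : Bornology.IsBounded (numRange A) := by
  refine isBounded_iff_forall_norm_le.2 ⟨‖A‖, ?_⟩
  rintro _ ⟨x, hx, rfl⟩
  refine (norm_inner_le_norm _ _).trans ?_
  simpa [hx] using A.le_opNorm x

theorem mul_le_norm_inner_sub {A : H →L[ℂ] H} {σ : ℂ} {κ : ℝ}
    (h : ∀ v ∈ numRange A, κ ≤ ‖σ - v‖) (x : H) :
    ‖x‖ ^ 2 * κ ≤ ‖inner ℂ ((algebraMap ℂ (H →L[ℂ] H) σ - A) x) x‖ := by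
  rcases eq_or_ne x 0 with rfl | hx
  · simp
  obtain ⟨v, hv, hxv⟩ := exists_mem_numRange_inner A hx
  have e : inner ℂ x ((algebraMap ℂ (H →L[ℂ] H) σ - A) x) = ((‖x‖ ^ 2 : ℝ) : ℂ) * (σ - v) := by
    rw [_root_.sub_apply, inner_sub_right, hxv, Algebra.algebraMap_eq_smul_one, _root_.smul_apply,
      one_apply_eq_self, inner_smul_right, inner_self_eq_norm_sq_to_K]
    push_cast
    simp
    ring
  rw [← inner_conj_symm, RCLike.norm_conj, e, norm_mul, Complex.norm_real,
    Real.norm_of_nonneg (sq_nonneg _)]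
  have := h v hv
  gcongr

/-- Lax-Milgram: `|⟨(σ - A)x, x⟩| ≥ κ‖x‖²` when `σ` has distance at least `κ` from the numerical
range. -/
theorem isUnit_algebraMap_sub [CompleteSpace H] {A : H →L[ℂ] H} {σ : ℂ} {κ : ℝ} (hκ : 0 < κ)
    (h : ∀ v ∈ numRange A, κ ≤ ‖σ - v‖) : IsUnit (algebraMap ℂ (H →L[ℂ] H) σ - A) :=
  ContinuousLinearMap.isUnit_of_forall_le_norm_inner_map _ (c := ⟨κ, hκ.le⟩) hκ
    (mul_le_norm_inner_sub h)

theorem apply_inverse_apply {B : H →L[ℂ] H} (hB : IsUnit B) (x : H) : B (Ring.inverse B x) = x := by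
  have := congrArg (fun T : H →L[ℂ] H => T x) (Ring.mul_inverse_cancel B hB)
  simpa using this

theorem norm_inverse_algebraMap_sub_le [CompleteSpace H] {A : H →L[ℂ] H} {σ : ℂ} {κ : ℝ}
    (hκ : 0 < κ) (h : ∀ v ∈ numRange A, κ ≤ ‖σ - v‖) :
    ‖Ring.inverse (algebraMap ℂ (H →L[ℂ] H) σ - A)‖ ≤ κ⁻¹ := by
  refine ContinuousLinearMap.opNorm_le_bound _ (by positivity) fun x => ?_
  set y := Ring.inverse (algebraMap ℂ (H →L[ℂ] H) σ - A) x with hy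
  have h1 := mul_le_norm_inner_sub h y
  rw [hy, apply_inverse_apply (isUnit_algebraMap_sub hκ h), ← hy] at h1
  have h2 := h1.trans (norm_inner_le_norm x y)
  rcases (norm_nonneg y).eq_or_lt with h0 | h0
  · rw [← h0]; positivity
  · rw [inv_mul_eq_div, le_div_iff₀ hκ]
    nlinarith

theorem exists_mem_numRange_of_affine {A : H →L[ℂ] H} {w t v : ℂ}
    (hv : v ∈ numRange (algebraMap ℂ (H →L[ℂ] H) w + t • (A - algebraMap ℂ (H →L[ℂ] H) w))) :
    ∃ u ∈ numRange A, v = w + t * (u - w) := by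
  obtain ⟨x, hx, rfl⟩ := hv
  refine ⟨_, ⟨x, hx, rfl⟩, ?_⟩
  simp [Algebra.algebraMap_eq_smul_one, inner_self_eq_norm_sq_to_K, hx]

/-- The operators on the segment from `w` to `A` have resolvents of minimal growth outside `Ω`,
uniformly near that segment. -/
theorem exists_resolventBound [CompleteSpace H] (hopen : IsOpen Ω) (hconv : Convex ℝ Ω)
    (hw : w ∈ Ω) {A : H →L[ℂ] H} (hA : closure (numRange A) ⊆ Ω) :
    ∃ U : Set ℂ, IsOpen U ∧ IsPreconnected U ∧ 0 ∈ U ∧ 1 ∈ U ∧ ∃ C : ℝ, 0 ≤ C ∧ ∀ t ∈ U,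
      ResolventBound Ωᶜ w C
        (algebraMap ℂ (H →L[ℂ] H) w + t • (A - algebraMap ℂ (H →L[ℂ] H) w)) := by
  -- The union of the segments from `w` to the closed numerical range is compact and, by convexity,
  -- in `Ω`. It contains the numerical ranges of all operators on the segment from `w` to `A`.
  set K : Set ℂ := (fun p : ℝ × ℂ => w + p.1 * (p.2 - w)) '' (Icc 0 1 ×ˢ closure (numRange A))
    with hK
  have hKc : IsCompact K :=
    (isCompact_Icc.prod (isBounded_numRange A).isCompact_closure).image (by fun_prop)
  have hKΩ : K ⊆ Ω := by
    rintro _ ⟨⟨θ, u⟩, ⟨hθ, hu⟩, rfl⟩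
    simpa using hconv.add_smul_sub_mem hw (hA hu) hθ
  obtain ⟨ε, hε, c, hc, hdist⟩ := exists_pos_mul_norm_sub_le hopen hKc hKΩ w
  obtain ⟨B, hB⟩ := (isBounded_numRange A).exists_norm_le
  -- A strict bound for `|u - w|` on the numerical range, so that moving `t` by less than `ε/B'`
  -- moves the numerical values by less than `ε`.
  set B' := |B| + ‖w‖ + 1 with hB'
  have hB'0 : 0 < B' := by positivity
  set S : Set ℂ := segment ℝ 0 1 with hS
  have hSU : S ⊆ Metric.thickening (ε / B') S := Metric.self_subset_thickening (by positivity) S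
  refine ⟨Metric.thickening (ε / B') S, Metric.isOpen_thickening,
    ((convex_segment (𝕜 := ℝ) (0 : ℂ) 1).thickening _).isPreconnected, hSU (left_mem_segment ℝ 0 1),
    hSU (right_mem_segment ℝ 0 1), c⁻¹, by positivity, fun t ht σ hσ => ?_⟩
  have hpos : 0 < ‖σ - w‖ := norm_pos_iff.2 (sub_ne_zero.2 fun h => hσ (h ▸ hw))
  have hκ : ∀ v ∈ numRange (algebraMap ℂ (H →L[ℂ] H) w + t • (A - algebraMap ℂ (H →L[ℂ] H) w)),
      c * ‖σ - w‖ ≤ ‖σ - v‖ := by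
    intro v hv
    obtain ⟨u, hu, rfl⟩ := exists_mem_numRange_of_affine hv
    refine hdist _ ?_ σ hσ
    obtain ⟨s, hs, hts⟩ := Metric.mem_thickening_iff.1 ht
    obtain ⟨θ, hθ, rfl⟩ : ∃ θ : ℝ, θ ∈ Icc (0 : ℝ) 1 ∧ (θ : ℂ) = s := by
      rw [hS, segment_eq_image] at hs
      obtain ⟨θ, hθ, rfl⟩ := hs
      exact ⟨θ, hθ, by simp⟩
    refine Metric.mem_thickening_iff.2 ⟨w + θ * (u - w), ?_, ?_⟩
    · exact ⟨(θ, u), ⟨hθ, subset_closure hu⟩, rfl⟩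
    · rw [dist_eq_norm] at hts ⊢
      have h1 : ‖u - w‖ < B' := by
        have e1 := norm_sub_le u w
        have e2 := (hB u hu).trans (le_abs_self B)
        rw [hB']
        linarith
      have h2 : w + t * (u - w) - (w + θ * (u - w)) = (t - θ) * (u - w) := by ring
      rw [h2, norm_mul]
      calc ‖t - θ‖ * ‖u - w‖ ≤ ‖t - θ‖ * B' := by gcongr
        _ < ε / B' * B' := by gcongr
        _ = ε := by field_simp
  refine ⟨isUnit_algebraMap_sub (by positivity) hκ,
    (norm_inverse_algebraMap_sub_le (by positivity) hκ).trans (le_of_eq ?_)⟩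
  rw [mul_inv, div_eq_mul_inv]

theorem ResolventBound.mono {𝔅 : Type*} [NormedRing 𝔅] [NormedAlgebra ℂ 𝔅] {S S' : Set ℂ} {C : ℝ}
    {a : 𝔅} (h : ResolventBound S w C a) (hS : S' ⊆ S) : ResolventBound S' w C a :=
  fun σ hσ => h σ (hS hσ)

theorem frontier_subset_compl (hopen : IsOpen Ω) : frontier Ω ⊆ Ωᶜ := by
  rw [hopen.frontier_eq]; exact fun _ h => h.2

theorem resolventBound_of_numRange [CompleteSpace H] (hopen : IsOpen Ω) (hconv : Convex ℝ Ω)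
    (hw : w ∈ Ω) {A : H →L[ℂ] H} (hA : closure (numRange A) ⊆ Ω) :
    ∃ C, ResolventBound Ωᶜ w C A := by
  obtain ⟨U, -, -, -, h1, C, -, hb⟩ := exists_resolventBound hopen hconv hw hA
  exact ⟨C, by simpa using hb 1 h1⟩

/-- Factor `q`: if the product were not invertible, a root of `q` would lie in the spectrum of `A`,
but all roots lie outside `Ω`. -/
theorem isUnit_aeval_of_numRange [CompleteSpace H] (hopen : IsOpen Ω) (hconv : Convex ℝ Ω)
    (hw : w ∈ Ω) {A : H →L[ℂ] H} (hA : closure (numRange A) ⊆ Ω) {q : Polynomial ℂ}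
    (hq : ∀ z ∈ Ω, q.eval z ≠ 0) : IsUnit (Polynomial.aeval A q) := by
  obtain ⟨C, hC⟩ := resolventBound_of_numRange hopen hconv hw hA
  have hq0 : q ≠ 0 := fun h => hq w hw (by simp [h])
  rw [(IsAlgClosed.splits q).eq_prod_roots, map_mul, Polynomial.aeval_C]
  refine ((isUnit_iff_ne_zero.2 (Polynomial.leadingCoeff_ne_zero.2 hq0)).map
    (algebraMap ℂ (H →L[ℂ] H))).mul ?_
  by_contra h
  obtain ⟨k, hk, hk0⟩ := spectrum.exists_mem_of_not_isUnit_aeval_prod h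
  exact hk (hC k fun hkΩ => hq k hkΩ hk0).1

/-! ### Cauchy transforms of operators -/

theorem cauchyTransform_self (m : Measure ℂ) (w : ℂ) (h : ℂ → ℂ) : cauchyTransform m w h w = 0 := by
  simp [cauchyTransform, resolventDiff]

theorem cauchyTransform_mul_aeval_eq_of_numRange [CompleteSpace H] (hopen : IsOpen Ω)
    (hconv : Convex ℝ Ω) (hw : w ∈ Ω) {A : H →L[ℂ] H} (hA : closure (numRange A) ⊆ Ω)
    (g : frontier Ω →ᵇ ℂ) (p q : Polynomial ℂ)
    (hpq : ∀ z ∈ Ω, cauchyTransform (μH[1].restrict (frontier Ω)) w (boundaryDensity g) z *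
      q.eval z = p.eval z) :
    cauchyTransform (μH[1].restrict (frontier Ω)) w (boundaryDensity g) A * Polynomial.aeval A q =
      Polynomial.aeval A p := by
  obtain ⟨U, hU, hUc, h0, h1, C, hC, hb⟩ := exists_resolventBound hopen hconv hw hA
  obtain ⟨d, hd, hball⟩ := Metric.isOpen_iff.1 hopen w hw
  have := cauchyTransform_mul_aeval_eq (isCauchyData_boundaryDensity hopen hconv hw g) hd
    (fun σ hσ => ?_) hU hUc h0 h1 hC (fun t ht => (hb t ht).mono (frontier_subset_compl hopen)) p q
    (fun x hx => hpq _ (hball (by simpa using hx)))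
  · simpa using this
  · by_contra! h
    exact frontier_subset_compl hopen hσ (hball (by rwa [mem_ball_iff_norm]))

/-- A function that is holomorphic together with its conjugate is locally constant. -/
theorem eq_of_differentiableOn_conj {U : Set ℂ} (hU : IsOpen U) (hUc : IsPreconnected U)
    {F : ℂ → ℂ} (h1 : DifferentiableOn ℂ F U)
    (h2 : DifferentiableOn ℂ (fun z => (starRingEnd ℂ) (F z)) U) {x y : ℂ} (hx : x ∈ U)
    (hy : y ∈ U) : F x = F y := by
  refine hU.is_const_of_deriv_eq_zero hUc h1 (fun z hz => ?_) hx hy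
  have e1 := (h1.differentiableAt (hU.mem_nhds hz)).hasDerivAt.hasFDerivAt.restrictScalars ℝ
  have e2 := (h2.differentiableAt (hU.mem_nhds hz)).hasDerivAt.hasFDerivAt.restrictScalars ℝ
  have e3 := (Complex.conjCLE.toContinuousLinearMap.hasFDerivAt.comp z e1).unique e2
  -- The real derivative of the conjugate is both conjugate linear and complex linear; comparing at
  -- `1` and `i` makes it zero.
  have e4 := DFunLike.congr_fun e3 1
  have e5 := DFunLike.congr_fun e3 Complex.I
  simp at e4 e5
  rw [← e4] at e5
  have e6 : (2 * Complex.I) * (starRingEnd ℂ) (deriv F z) = 0 := by linear_combination -e5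
  simpa using e6

/-- The conjugated transform is the difference of holomorphic functions, so the transform of `ḡ` is
constant, and it vanishes at `w`. -/
theorem cauchyTransform_eq_of_doubleLayer_eq (hopen : IsOpen Ω) (hconv : Convex ℝ Ω) (hw : w ∈ Ω)
    {g : frontier Ω →ᵇ ℂ} {f : ℂ → ℂ} (hf : DifferentiableOn ℂ f Ω)
    (hg : ∀ z ∈ Ω, doubleLayer Ω g z = f z) (hz : z ∈ Ω) :
    cauchyTransform (μH[1].restrict (frontier Ω)) w (boundaryDensity g) z =
        f z - doubleLayer Ω g w ∧
      cauchyTransform (μH[1].restrict (frontier Ω)) w (boundaryDensity (star g)) z = 0 := by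
  have h := fun z hz => doubleLayer_eq_cauchyTransform hopen hconv hw (z := z) hz g
  have h2 : cauchyTransform (μH[1].restrict (frontier Ω)) w (boundaryDensity (star g)) z = 0 := by
    rw [← cauchyTransform_self (μH[1].restrict (frontier Ω)) w (boundaryDensity (star g))]
    refine eq_of_differentiableOn_conj hopen hconv.isPreconnected
      (differentiableOn_cauchyTransform hopen hconv hw (star g)) ?_ hz hw
    refine ((hf.sub_const (doubleLayer Ω g w)).sub
      (differentiableOn_cauchyTransform hopen hconv hw g)).congr fun x hx => ?_
    simp only [Pi.sub_apply]
    rw [← hg x hx, h x hx]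
    ring
  refine ⟨?_, h2⟩
  have := h z hz
  rw [h2, map_zero, add_zero, hg z hz] at this
  rw [this]
  ring

/-! ### The operator-valued double-layer potential -/

/-- The operator `(1 / 2π) (ν (σ - A)⁻¹ + ν̄ (σ̄ - A*)⁻¹)`. -/
def kernelOp [CompleteSpace H] (Ω : Set ℂ) (A : H →L[ℂ] H) (σ : ℂ) : H →L[ℂ] H :=
  (1 / (2 * Real.pi) * outerNormal Ω σ) • Ring.inverse (algebraMap ℂ (H →L[ℂ] H) σ - A) +
    star ((1 / (2 * Real.pi) * outerNormal Ω σ) • Ring.inverse (algebraMap ℂ (H →L[ℂ] H) σ - A))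

/-- With `R` the resolvent at `σ`, `⟨x, Rx⟩` is `‖Rx‖²` times the conjugate of `σ - v` for some `v`
in the closure of `Ω`. The supporting half-plane at `σ` gives the sign of the real part. -/
theorem kernelOp_nonneg [CompleteSpace H] (hopen : IsOpen Ω) (hconv : Convex ℝ Ω) (hw : w ∈ Ω)
    {A : H →L[ℂ] H} (hA : closure (numRange A) ⊆ Ω) {σ : ℂ} (hσ : σ ∈ frontier Ω) :
    0 ≤ kernelOp Ω A σ := by
  obtain ⟨C, hC⟩ := resolventBound_of_numRange hopen hconv hw hA
  have hu := (hC σ (frontier_subset_compl hopen hσ)).1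
  rw [ContinuousLinearMap.nonneg_iff_isPositive, ContinuousLinearMap.isPositive_def']
  refine ⟨?_, fun x => ?_⟩
  · rw [kernelOp]; exact IsSelfAdjoint.add_star_self _
  set R := Ring.inverse (algebraMap ℂ (H →L[ℂ] H) σ - A) with hR
  have hx : (algebraMap ℂ (H →L[ℂ] H) σ - A) (R x) = x := apply_inverse_apply hu x
  obtain ⟨v, hv, hRx⟩ : ∃ v ∈ closure Ω, inner ℂ x (R x) =
      ((‖R x‖ ^ 2 : ℝ) : ℂ) * (starRingEnd ℂ) (σ - v) := by
    rcases eq_or_ne (R x) 0 with h0 | h0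
    · exact ⟨w, subset_closure hw, by simp [h0]⟩
    · obtain ⟨v, hv, e⟩ := exists_mem_numRange_inner A h0
      refine ⟨v, subset_closure (hA (subset_closure hv)), ?_⟩
      have e' : inner ℂ x (R x) =
          inner ℂ ((algebraMap ℂ (H →L[ℂ] H) σ - A) (R x)) (R x) := by rw [hx]
      rw [e', ← inner_conj_symm, _root_.sub_apply, inner_sub_right, e,
        Algebra.algebraMap_eq_smul_one, _root_.smul_apply, one_apply_eq_self, inner_smul_right,
        inner_self_eq_norm_sq_to_K]
      simp only [map_sub, map_mul, Complex.conj_ofReal, map_pow, Complex.coe_algebraMap]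
      push_cast
      ring
  have hre := re_conj_outerNormal_mul_le (σ := σ) hv
  set k : ℂ := 1 / (2 * Real.pi) * outerNormal Ω σ with hk
  have e1 : (kernelOp Ω A σ).reApplyInnerSelf x = 2 * (k * inner ℂ x (R x)).re := by
    rw [ContinuousLinearMap.reApplyInnerSelf_apply, kernelOp, ← hk, ← hR, _root_.add_apply, inner_add_left,
      ContinuousLinearMap.star_eq_adjoint, ContinuousLinearMap.adjoint_inner_left,
      ← inner_conj_symm, _root_.smul_apply, inner_smul_right]
    simp only [map_add, RCLike.conj_re]
    simp [two_mul]
  have e2 : k * inner ℂ x (R x) = ((‖R x‖ ^ 2 / (2 * Real.pi) : ℝ) : ℂ) *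
      (starRingEnd ℂ) (-((starRingEnd ℂ) (outerNormal Ω σ) * (v - σ))) := by
    rw [hRx, hk]
    simp only [map_neg, map_mul, map_sub, Complex.conj_conj]
    push_cast
    ring
  rw [e1, e2, Complex.re_ofReal_mul, Complex.conj_re, Complex.neg_re]
  have := Real.pi_pos
  have : 0 ≤ ‖R x‖ ^ 2 / (2 * Real.pi) := by positivity
  nlinarith

/-- The operator version of the scalar decomposition, with adjoints in place of conjugates; the
scalar kernel at `w` is again split off for convergence. -/
theorem integral_smul_kernelOp [CompleteSpace H] (hopen : IsOpen Ω) (hconv : Convex ℝ Ω)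
    (hw : w ∈ Ω) {A : H →L[ℂ] H} (hA : closure (numRange A) ⊆ Ω) (g : frontier Ω →ᵇ ℂ) :
    Integrable (fun σ => extendBoundary g σ • kernelOp Ω A σ)
        ((μH[1] : Measure ℂ).restrict (frontier Ω)) ∧
      ∫ σ in frontier Ω, extendBoundary g σ • kernelOp Ω A σ ∂μH[1] =
        algebraMap ℂ (H →L[ℂ] H) (doubleLayer Ω g w) +
          cauchyTransform (μH[1].restrict (frontier Ω)) w (boundaryDensity g) A +
          star (cauchyTransform (μH[1].restrict (frontier Ω)) w (boundaryDensity (star g)) A) := by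
  obtain ⟨C, hC⟩ := resolventBound_of_numRange hopen hconv hw hA
  replace hC := hC.mono (frontier_subset_compl hopen)
  have hFm := (continuousOn_extendBoundary g).aestronglyMeasurable
    (μ := (μH[1] : Measure ℂ)) (measurableSet_frontier' Ω)
  have hk : Integrable (fun σ => extendBoundary g σ * kernel Ω σ w)
      ((μH[1] : Measure ℂ).restrict (frontier Ω)) :=
    (integrableOn_kernel hopen hconv hw).bdd_mul hFm
      (Eventually.of_forall (norm_extendBoundary_le g))
  have hk' : Integrable (fun σ => algebraMap ℂ (H →L[ℂ] H) (extendBoundary g σ * kernel Ω σ w))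
      ((μH[1] : Measure ℂ).restrict (frontier Ω)) :=
    ContinuousLinearMap.integrable_comp (algebraMapCLM ℂ (H →L[ℂ] H)) hk
  have h1 := (isCauchyData_boundaryDensity hopen hconv hw g).integrable_resolventDiff hC
  have h2 := (isCauchyData_boundaryDensity hopen hconv hw (star g)).integrable_resolventDiff hC
  have h2' : Integrable (fun σ => star (boundaryDensity (star g) σ • resolventDiff w σ A))
      ((μH[1] : Measure ℂ).restrict (frontier Ω)) :=
    ContinuousLinearMap.integrable_comp (starL' ℝ (A := H →L[ℂ] H)).toContinuousLinearMap h2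
  have hEq : ∀ σ, extendBoundary g σ • kernelOp Ω A σ =
      algebraMap ℂ (H →L[ℂ] H) (extendBoundary g σ * kernel Ω σ w) +
        boundaryDensity g σ • resolventDiff w σ A +
        star (boundaryDensity (star g) σ • resolventDiff w σ A) := by
    intro σ
    simp only [kernelOp, boundaryDensity, resolventDiff, extendBoundary_star, kernel, star_smul,
      star_sub, star_mul', smul_sub, smul_add, smul_smul, Algebra.algebraMap_eq_smul_one,
      RCLike.star_def, star_one, map_inv₀, map_sub, map_div₀, map_mul, Complex.conj_conj, map_one,
      map_ofNat, Complex.conj_ofReal]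
    simp only [smul_mul_assoc, one_mul, smul_smul]
    module
  have h12 : Integrable (fun σ => algebraMap ℂ (H →L[ℂ] H) (extendBoundary g σ * kernel Ω σ w) +
      boundaryDensity g σ • resolventDiff w σ A) ((μH[1] : Measure ℂ).restrict (frontier Ω)) :=
    hk'.add h1
  simp only [hEq]
  refine ⟨h12.add h2', ?_⟩
  have e1 : ∫ σ in frontier Ω, algebraMap ℂ (H →L[ℂ] H) (extendBoundary g σ * kernel Ω σ w) ∂μH[1]
      = algebraMap ℂ (H →L[ℂ] H) (doubleLayer Ω g w) := by
    rw [doubleLayer_eq_integral]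
    exact (algebraMapCLM ℂ (H →L[ℂ] H)).integral_comp_comm hk
  have e2 : ∫ σ in frontier Ω, star (boundaryDensity (star g) σ • resolventDiff w σ A) ∂μH[1]
      = star (cauchyTransform (μH[1].restrict (frontier Ω)) w (boundaryDensity (star g)) A) :=
    (starL' ℝ (A := H →L[ℂ] H)).toContinuousLinearMap.integral_comp_comm h2
  rw [integral_add h12 h2', integral_add hk' h1, e1, e2, ← cauchyTransform]

/-- If the double-layer potential of `g` is the rational function `p / q` in `Ω`, the
operator-valued double-layer potential of `g` is `p(A) q(A)⁻¹`. -/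
theorem integral_smul_kernelOp_eq [CompleteSpace H] (hopen : IsOpen Ω) (hconv : Convex ℝ Ω)
    (hw : w ∈ Ω) {A : H →L[ℂ] H} (hA : closure (numRange A) ⊆ Ω) (g : frontier Ω →ᵇ ℂ)
    (p q : Polynomial ℂ) (hq : ∀ z ∈ Ω, q.eval z ≠ 0)
    (hpq : ∀ z ∈ Ω, doubleLayer Ω g z = p.eval z / q.eval z) :
    ∫ σ in frontier Ω, extendBoundary g σ • kernelOp Ω A σ ∂μH[1] =
      Polynomial.aeval A p * Ring.inverse (Polynomial.aeval A q) := by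
  have hf : DifferentiableOn ℂ (fun z => p.eval z / q.eval z) Ω :=
    p.differentiable.differentiableOn.div q.differentiable.differentiableOn hq
  have hct := fun z hz => cauchyTransform_eq_of_doubleLayer_eq hopen hconv hw hf hpq (z := z) hz
  -- The transform of `g` is `p/q` minus its value at `w`, whose numerator over `q` is this
  -- polynomial.
  have h1 := cauchyTransform_mul_aeval_eq_of_numRange hopen hconv hw hA g
    (p - Polynomial.C (doubleLayer Ω g w) * q) q fun z hz => by
      rw [(hct z hz).1, Polynomial.eval_sub, Polynomial.eval_mul, Polynomial.eval_C, sub_mul,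
        div_mul_cancel₀ _ (hq z hz)]
  -- The transform of `ḡ` is the rational function `0/1`, so its operator value is `0` and the
  -- adjoint term disappears.
  have h2 := cauchyTransform_mul_aeval_eq_of_numRange hopen hconv hw hA (star g) 0 1 fun z hz => by
      rw [(hct z hz).2]; simp
  rw [map_one, mul_one, map_zero] at h2
  have hu := isUnit_aeval_of_numRange hopen hconv hw hA hq
  rw [(integral_smul_kernelOp hopen hconv hw hA g).2, h2, star_zero, add_zero,
    ← hu.mul_left_inj, mul_assoc, Ring.inverse_mul_cancel _ hu, mul_one, add_mul, h1, map_sub,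
    map_mul, Polynomial.aeval_C, add_sub_cancel]

end

section

open scoped ComplexConjugate

variable {Ω : Set ℂ} {z w : ℂ} {H : Type*} [NormedAddCommGroup H] [InnerProductSpace ℂ H]

/-! ### Matrices with operator entries -/

theorem opNorm_le_of_norm_inner_le {E F : Type*} [NormedAddCommGroup E] [InnerProductSpace ℂ E]
    [NormedAddCommGroup F] [InnerProductSpace ℂ F] (L : E →L[ℂ] F) {K : ℝ} (hK : 0 ≤ K)
    (h : ∀ x y, ‖inner ℂ y (L x)‖ ≤ K / 2 * (‖x‖ ^ 2 + ‖y‖ ^ 2)) : ‖L‖ ≤ K := by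
  refine L.opNorm_le_bound hK fun x => ?_
  rcases (norm_nonneg x).eq_or_lt with hx | hx
  · rw [norm_eq_zero.1 hx.symm]; simp
  rcases (norm_nonneg (L x)).eq_or_lt with hL | hL
  · rw [← hL]; positivity
  -- The test vector has the norm of `x`, so the arithmetic mean loses nothing against the product.
  have h1 := h x (((‖x‖ / ‖L x‖ : ℝ) : ℂ) • L x)
  rw [inner_smul_left, norm_mul, RCLike.norm_conj, inner_self_eq_norm_sq_to_K, norm_smul,
    Complex.norm_real, Real.norm_of_nonneg (by positivity), div_mul_cancel₀ _ hL.ne', norm_pow,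
    RCLike.norm_ofReal, abs_norm] at h1
  have h2 : ‖x‖ / ‖L x‖ * ‖L x‖ ^ 2 = ‖x‖ * ‖L x‖ := by field_simp
  rw [h2] at h1
  nlinarith

/-- The matrix `G` has norm at most `Γ` as an operator between Euclidean spaces. -/
def IsMatrixBound {m n : ℕ} (G : Fin m → Fin n → ℂ) (Γ : ℝ) : Prop :=
  ∀ (ξ : Fin n → ℂ) (η : Fin m → ℂ),
    ‖∑ i, ∑ j, G i j * (conj (η i) * ξ j)‖ ≤ Γ / 2 * (∑ j, ‖ξ j‖ ^ 2 + ∑ i, ‖η i‖ ^ 2)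

variable {m n : ℕ}

/-- Scalar matrices act with the same norm on vectors with entries in a Hilbert space. -/
theorem IsMatrixBound.norm_sum_inner_le {G : Fin m → Fin n → ℂ} {Γ : ℝ} (hG : IsMatrixBound G Γ)
    (x : Fin n → H) (y : Fin m → H) :
    ‖∑ i, ∑ j, G i j * inner ℂ (y i) (x j)‖ ≤ Γ / 2 * (∑ j, ‖x j‖ ^ 2 + ∑ i, ‖y i‖ ^ 2) := by
  -- In an orthonormal basis of the span, the claim is the sum over the coordinates of the scalar
  -- inequality.
  set E : Submodule ℂ H := Submodule.span ℂ (range x ∪ range y) with hE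
  have : FiniteDimensional ℂ E :=
    FiniteDimensional.span_of_finite ℂ ((finite_range x).union (finite_range y))
  let b := stdOrthonormalBasis ℂ E
  let x' : Fin n → E := fun j => ⟨x j, Submodule.subset_span (Or.inl ⟨j, rfl⟩)⟩
  let y' : Fin m → E := fun i => ⟨y i, Submodule.subset_span (Or.inr ⟨i, rfl⟩)⟩
  have h1 : ∑ i, ∑ j, G i j * inner ℂ (y i) (x j) =
      ∑ k, ∑ i, ∑ j, G i j * (conj (inner ℂ (b k) (y' i)) * inner ℂ (b k) (x' j)) := by
    have : ∀ i j, inner ℂ (y i) (x j) = ∑ k, inner ℂ (y' i) (b k) * inner ℂ (b k) (x' j) :=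
      fun i j => (b.sum_inner_mul_inner (y' i) (x' j)).symm
    simp only [this, inner_conj_symm, Finset.mul_sum]
    rw [Finset.sum_comm (s := (Finset.univ : Finset (Fin (Module.finrank ℂ E))))]
    refine Finset.sum_congr rfl fun i _ => Finset.sum_comm
  have h2 : ∀ j, ‖x j‖ ^ 2 = ∑ k, ‖inner ℂ (b k) (x' j)‖ ^ 2 := fun j =>
    (b.sum_sq_norm_inner_right (x' j)).symm
  have h3 : ∀ i, ‖y i‖ ^ 2 = ∑ k, ‖inner ℂ (b k) (y' i)‖ ^ 2 := fun i =>
    (b.sum_sq_norm_inner_right (y' i)).symm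
  rw [h1]
  refine (norm_sum_le _ _).trans ((Finset.sum_le_sum fun k _ => hG _ _).trans (le_of_eq ?_))
  simp only [h2, h3]
  rw [← Finset.mul_sum, Finset.sum_add_distrib]
  congr 2 <;> exact Finset.sum_comm

/-- Write `M = S²` with `S` self-adjoint and apply the previous inequality to the vectors `S(x j)`
and `S(y i)`. -/
theorem IsMatrixBound.norm_sum_inner_apply_le [CompleteSpace H] {G : Fin m → Fin n → ℂ} {Γ : ℝ}
    (hG : IsMatrixBound G Γ) {M : H →L[ℂ] H} (hM : 0 ≤ M) (x : Fin n → H) (y : Fin m → H) :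
    ‖∑ i, ∑ j, G i j * inner ℂ (y i) (M (x j))‖ ≤
      Γ / 2 * (∑ j, (inner ℂ (x j) (M (x j))).re + ∑ i, (inner ℂ (y i) (M (y i))).re) := by
  set S := CFC.sqrt M with hS
  have hSS : S * S = M := CFC.sqrt_mul_sqrt_self M hM
  have hSa : IsSelfAdjoint S := (CFC.sqrt_nonneg M).isSelfAdjoint
  have h1 : ∀ u v : H, inner ℂ u (M v) = inner ℂ (S u) (S v) := by
    intro u v
    rw [← hSS, show (S * S) v = S (S v) from rfl, ← ContinuousLinearMap.adjoint_inner_left,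
      ← ContinuousLinearMap.star_eq_adjoint, hSa.star_eq]
  have h2 : ∀ u : H, (inner ℂ u (M u)).re = ‖S u‖ ^ 2 := by
    intro u
    rw [h1]
    exact inner_self_eq_norm_sq (𝕜 := ℂ) (S u)
  simp only [h2]
  simpa only [h1] using hG.norm_sum_inner_le (fun j => S (x j)) (fun i => S (y i))

/-- The right side of the pointwise bound is linear in `M σ`, so it integrates exactly to the total
mass `τ`. This is why the matrix bound is stated with sums of squares. -/
theorem norm_sum_inner_integral_le [CompleteSpace H] {m₀ : Measure ℂ} {M : ℂ → H →L[ℂ] H}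
    {G : Fin m → Fin n → ℂ → ℂ} {Γ τ : ℝ} (hM : ∀ᵐ σ ∂m₀, 0 ≤ M σ) (hMi : Integrable M m₀)
    (hMτ : ∫ σ, M σ ∂m₀ = (τ : ℂ) • (1 : H →L[ℂ] H))
    (hGi : ∀ i j, Integrable (fun σ => G i j σ • M σ) m₀)
    (hG : ∀ᵐ σ ∂m₀, IsMatrixBound (fun i j => G i j σ) Γ) (x : Fin n → H) (y : Fin m → H) :
    ‖∑ i, ∑ j, inner ℂ (y i) ((∫ σ, G i j σ • M σ ∂m₀) (x j))‖ ≤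
      Γ * τ / 2 * (∑ j, ‖x j‖ ^ 2 + ∑ i, ‖y i‖ ^ 2) := by
  let φ : H → H → (H →L[ℂ] H) →L[ℂ] ℂ := fun u v =>
    innerSL ℂ u ∘L ContinuousLinearMap.apply ℂ H v
  have hφ : ∀ u v T, φ u v T = inner ℂ u (T v) := fun u v T => rfl
  have hint : ∀ i j, Integrable (fun σ => G i j σ * inner ℂ (y i) (M σ (x j))) m₀ := fun i j => by
    simpa [hφ] using (φ (y i) (x j)).integrable_comp (hGi i j)
  have h1 : ∀ i j, inner ℂ (y i) ((∫ σ, G i j σ • M σ ∂m₀) (x j)) =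
      ∫ σ, G i j σ * inner ℂ (y i) (M σ (x j)) ∂m₀ := fun i j => by
    rw [← hφ, ← (φ (y i) (x j)).integral_comp_comm (hGi i j)]
    simp [hφ]
  have hre : ∀ u : H, Integrable (fun σ => (inner ℂ u (M σ u)).re) m₀ := fun u =>
    Complex.reCLM.integrable_comp ((φ u u).integrable_comp hMi)
  have h2 : ∀ u : H, ∫ σ, (inner ℂ u (M σ u)).re ∂m₀ = τ * ‖u‖ ^ 2 := fun u => by
    have e1 := Complex.reCLM.integral_comp_comm ((φ u u).integrable_comp hMi)
    rw [(φ u u).integral_comp_comm hMi, hMτ] at e1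
    refine e1.trans ?_
    rw [hφ, _root_.smul_apply, one_apply_eq_self, inner_smul_right, Complex.reCLM_apply,
      Complex.re_ofReal_mul]
    congr 1
    exact inner_self_eq_norm_sq (𝕜 := ℂ) u
  simp only [h1]
  rw [← Finset.sum_congr rfl fun i _ => integral_finsetSum Finset.univ fun j _ => hint i j,
    ← integral_finsetSum Finset.univ fun i _ => integrable_finsetSum _ fun j _ => hint i j]
  refine (norm_integral_le_of_norm_le (((integrable_finsetSum Finset.univ fun j _ => hre (x j)).add
    (integrable_finsetSum Finset.univ fun i _ => hre (y i))).const_mul (Γ / 2)) ?_).trans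
    (le_of_eq ?_)
  · filter_upwards [hM, hG] with σ h1 h2
    exact h2.norm_sum_inner_apply_le h1 x y
  · rw [integral_const_mul]
    simp only [Pi.add_apply]
    rw [integral_add (integrable_finsetSum Finset.univ fun j _ => hre (x j))
      (integrable_finsetSum Finset.univ fun i _ => hre (y i)),
      integral_finsetSum _ fun j _ => hre (x j), integral_finsetSum _ fun i _ => hre (y i)]
    simp only [h2, ← Finset.mul_sum]
    ring

theorem inner_blockOp (T : Matrix (Fin m) (Fin n) (H →L[ℂ] H)) (x : PiLp 2 fun _ : Fin n => H)
    (y : PiLp 2 fun _ : Fin m => H) :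
    inner ℂ y (blockOp T x) = ∑ i, ∑ j, inner ℂ (y i) (T i j (x j)) := by
  rw [PiLp.inner_apply]
  refine Finset.sum_congr rfl fun i _ => ?_
  rw [← inner_sum]
  congr 1
  simp [blockOp]

open scoped Matrix.Norms.L2Operator in
theorem isMatrixBound_of_norm_le_one {R : Matrix (Fin m) (Fin n) ℂ} (hR : ‖R‖ ≤ 1) :
    IsMatrixBound R 1 := by
  intro ξ η
  set x : EuclideanSpace ℂ (Fin n) := WithLp.toLp 2 ξ with hx
  set y : EuclideanSpace ℂ (Fin m) := WithLp.toLp 2 η with hy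
  have h1 : ∑ i, ∑ j, R i j * (conj (η i) * ξ j) =
      inner ℂ y ((EuclideanSpace.equiv (Fin m) ℂ).symm (R.mulVec x)) := by
    rw [PiLp.inner_apply]
    refine Finset.sum_congr rfl fun i _ => ?_
    simp only [RCLike.inner_apply, hy, hx]
    simp [Matrix.mulVec, dotProduct, Finset.sum_mul]
    refine Finset.sum_congr rfl fun j _ => ?_
    ring
  have h2 : ‖x‖ ^ 2 = ∑ j, ‖ξ j‖ ^ 2 := by rw [EuclideanSpace.norm_sq_eq]
  have h3 : ‖y‖ ^ 2 = ∑ i, ‖η i‖ ^ 2 := by rw [EuclideanSpace.norm_sq_eq]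
  rw [h1, ← h2, ← h3]
  have h4 := (norm_inner_le_norm (𝕜 := ℂ) y _).trans
    (mul_le_mul_of_nonneg_left (R.l2_opNorm_mulVec x) (norm_nonneg y))
  refine h4.trans ?_
  have h5 : ‖y‖ * (‖R‖ * ‖x‖) ≤ ‖y‖ * (1 * ‖x‖) := by gcongr
  nlinarith [sq_nonneg (‖x‖ - ‖y‖)]

theorem IsMatrixBound.norm_apply_le {G : Fin m → Fin n → ℂ} {Γ : ℝ} (hG : IsMatrixBound G Γ)
    (i : Fin m) (j : Fin n) : ‖G i j‖ ≤ Γ := by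
  have h := hG (Pi.single j 1) (Pi.single i 1)
  have e1 : ∀ {k : ℕ} (i : Fin k), ∑ l, ‖(Pi.single i 1 : Fin k → ℂ) l‖ ^ 2 = 1 := by
    intro k i
    rw [Finset.sum_eq_single i (fun l _ hl => by simp [hl]) (by simp)]
    simp
  rw [e1, e1, Finset.sum_eq_single i (fun l _ hl => by simp [hl]) (by simp),
    Finset.sum_eq_single j (fun l _ hl => by simp [hl]) (by simp)] at h
  simp at h
  linarith

/-! ### Rational functions bounded in `Ω` -/

theorem ratEval_eq (r : RatFunc ℂ) (z : ℂ) : ratEval r z = r.num.eval z / r.denom.eval z := rfl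

/-- At a zero of the denominator `ratEval` is `0`, so the hypothesis says nothing there. But `|num|
≤ |denom|` holds on a dense part of `Ω`, hence on the closure, and a common zero contradicts
coprimality. -/
theorem denom_eval_ne_zero (hopen : IsOpen Ω) {r : RatFunc ℂ} (hr : ∀ z ∈ Ω, ‖ratEval r z‖ ≤ 1)
    (hz : z ∈ closure Ω) : r.denom.eval z ≠ 0 := by
  set D : Set ℂ := {z | r.denom.eval z = 0}ᶜ with hD
  have hfin : {z | r.denom.eval z = 0}.Finite := by
    refine r.denom.roots.toFinset.finite_toSet.subset fun z hz => ?_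
    simpa [r.denom_ne_zero] using hz
  have hdense : Dense D := hfin.countable.dense_compl ℂ
  have hle : ‖r.num.eval z‖ ≤ ‖r.denom.eval z‖ := by
    refine le_on_closure (s := Ω ∩ D) (f := fun z => ‖r.num.eval z‖)
      (g := fun z => ‖r.denom.eval z‖) (fun x hx => ?_) (by fun_prop) (by fun_prop) ?_
    · have h1 := hr x hx.1
      rw [ratEval_eq, norm_div, div_le_one (norm_pos_iff.2 hx.2)] at h1
      exact h1
    · exact closure_minimal (hdense.open_subset_closure_inter hopen) isClosed_closure hz
  intro h0
  rw [h0, norm_zero, norm_le_zero_iff] at hle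
  obtain ⟨a, b, hab⟩ := r.isCoprime_num_denom
  have := congrArg (Polynomial.eval z) hab
  simp [h0, hle] at this

theorem isDatum_ratEval (hopen : IsOpen Ω) {r : RatFunc ℂ} (hr : ∀ z ∈ Ω, ‖ratEval r z‖ ≤ 1) :
    IsDatum Ω (ratEval r) where
  continuousOn := by
    have : ContinuousOn (fun z => r.num.eval z / r.denom.eval z) (closure Ω) :=
      ContinuousOn.div (by fun_prop) (by fun_prop) fun z hz => denom_eval_ne_zero hopen hr hz
    exact this
  harmonic := by
    have : DifferentiableOn ℂ (fun z => r.num.eval z / r.denom.eval z) Ω :=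
      r.num.differentiable.differentiableOn.div r.denom.differentiable.differentiableOn
        fun z hz => denom_eval_ne_zero hopen hr (subset_closure hz)
    exact fun z hz => (this.analyticAt (hopen.mem_nhds hz)).harmonicAt
  bounded := ⟨1, hr⟩

theorem norm_ratEval_le_of_mem_closure (hopen : IsOpen Ω) {r : RatFunc ℂ}
    (hr : ∀ z ∈ Ω, ‖ratEval r z‖ ≤ 1) (hz : z ∈ closure Ω) : ‖ratEval r z‖ ≤ 1 :=
  le_on_closure hr (isDatum_ratEval hopen hr).continuousOn.norm continuousOn_const hz

/-! ### The constants -/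

theorem isWellPosed_of_bound (hopen : IsOpen Ω) (hconv : Convex ℝ Ω) (hne : Ω ≠ univ)
    (hw : w ∈ Ω) (hP : IsInvertibleIdAddP Ω) {K : ℝ} (hK : ∀ (g : frontier Ω →ᵇ ℂ) (C : ℝ),
      (∀ z, ‖g z + boundaryOp Ω g z‖ ≤ C) → ‖g‖ ≤ K * C) : IsWellPosed Ω where
  existsUnique := fun _ hr => exists_isNeumannSolution hopen hconv hne hw hP hr
  stable := by
    refine ⟨2 * K, fun r hr g hg M hM => ?_⟩
    rw [isNeumannSolution_iff hopen hconv hne hw hr] at hg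
    refine (hK g (2 * M) fun z => ?_).trans (le_of_eq (by ring))
    rw [hg z, norm_mul, Complex.norm_ofNat]
    have := hM z z.2
    gcongr

theorem constN_le_of_bound (hopen : IsOpen Ω) {K : ℝ} (hK : ∀ (g : frontier Ω →ᵇ ℂ) (C : ℝ),
      (∀ z, ‖g z + boundaryOp Ω g z‖ ≤ C) → ‖g‖ ≤ K * C) :
    constN Ω ≤ ENNReal.ofReal (K * 2) := by
  refine iSup_le fun r => iSup_le fun hr => iSup_le fun g => iSup_le fun hg =>
    ENNReal.ofReal_le_ofReal (hK g 2 fun z => ?_)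
  rw [hg z, norm_mul, Complex.norm_ofNat]
  have := norm_ratEval_le_of_mem_closure hopen hr z.2.1
  linarith

/-- The double-layer potential of the constant `1` is constant in `Ω`. -/
theorem doubleLayer_one (hopen : IsOpen Ω) (hconv : Convex ℝ Ω) (hw : w ∈ Ω) (hz : z ∈ Ω) :
    doubleLayer Ω 1 z = ((volume.real (hitAngles Ω w) / Real.pi : ℝ) : ℂ) := by
  have h1 : ∫ θ in hitAngles Ω w, extendBoundary (1 : frontier Ω →ᵇ ℂ) (rayEnd Ω z θ) =
      ∫ θ in hitAngles Ω w, (1 : ℂ) := by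
    refine setIntegral_congr_fun (measurableSet_hitAngles hopen hconv hw) fun θ hθ => ?_
    exact extendBoundary_coe 1 ⟨_, rayEnd_mem_frontier hopen hconv hw (subset_closure hz) hθ⟩
  rw [doubleLayer_eq_angularAverage hopen hconv hw hz, angularAverage, h1]
  simp
  ring

/-- `I + P` acts entrywise and is linear, so for fixed `ξ`, `η` the scalar bound applies to the
single function `∑ η̄ᵢ ξⱼ gᵢⱼ`; no constant is lost for matrices. -/
theorem isMatrixBound_of_boundary (hopen : IsOpen Ω) (hconv : Convex ℝ Ω) (hw : w ∈ Ω)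
    (hfr : (frontier Ω).Nonempty) {K : ℝ} (hK : ∀ (g : frontier Ω →ᵇ ℂ) (C : ℝ),
      (∀ z, ‖g z + boundaryOp Ω g z‖ ≤ C) → ‖g‖ ≤ K * C)
    {g : Fin m → Fin n → frontier Ω →ᵇ ℂ} {r : Fin m → Fin n → ℂ → ℂ}
    (hg : ∀ i j z, g i j z + boundaryOp Ω (g i j) z = 2 * r i j z)
    (hr : ∀ z ∈ frontier Ω, IsMatrixBound (fun i j => r i j z) 1) (z : frontier Ω) :
    IsMatrixBound (fun i j => g i j z) (2 * K) := by
  intro ξ η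
  obtain ⟨P, hP, -⟩ := exists_boundaryCLM hopen hconv hw hfr
  set G : frontier Ω →ᵇ ℂ := ∑ i, ∑ j, (conj (η i) * ξ j) • g i j with hG
  have hGz : ∀ z, G z = ∑ i, ∑ j, g i j z * (conj (η i) * ξ j) := fun z => by
    simp [hG, BoundedContinuousFunction.sum_apply, mul_comm]
  have hPz : ∀ z, P G z = ∑ i, ∑ j, P (g i j) z * (conj (η i) * ξ j) := fun z => by
    simp [hG, map_sum, BoundedContinuousFunction.sum_apply, mul_comm]
  have h1 := hK G (∑ j, ‖ξ j‖ ^ 2 + ∑ i, ‖η i‖ ^ 2) fun z => by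
    have e : G z + boundaryOp Ω G z = 2 * ∑ i, ∑ j, r i j z * (conj (η i) * ξ j) := by
      rw [← hP, hGz, hPz, ← Finset.sum_add_distrib, Finset.mul_sum]
      refine Finset.sum_congr rfl fun i _ => ?_
      rw [← Finset.sum_add_distrib, Finset.mul_sum]
      refine Finset.sum_congr rfl fun j _ => ?_
      rw [hP, ← add_mul, hg]
      ring
    rw [e, norm_mul, Complex.norm_ofNat]
    linarith [hr z z.2 ξ η]
  rw [← hGz]
  refine (G.norm_coe_le_norm z).trans (h1.trans (le_of_eq (by ring)))

/-- `2R(A)` is the integral of a matrix function of norm at most `2K` against the positive operators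
`kernelOp`, of total mass `τ`. -/
theorem constCb_le_of_bound (hopen : IsOpen Ω) (hconv : Convex ℝ Ω) (hne : Ω ≠ univ) (hw : w ∈ Ω)
    (hP : IsInvertibleIdAddP Ω) {K : ℝ} (hK0 : 0 ≤ K) (hK : ∀ (g : frontier Ω →ᵇ ℂ) (C : ℝ),
      (∀ z, ‖g z + boundaryOp Ω g z‖ ≤ C) → ‖g‖ ≤ K * C) :
    constCb.{u} Ω ≤ ENNReal.ofReal (K * (volume.real (hitAngles Ω w) / Real.pi)) := by
  refine iSup_le fun H => iSup_le fun _ => iSup_le fun _ => iSup_le fun _ => iSup_le fun A =>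
    iSup_le fun hA => iSup_le fun m => iSup_le fun n => iSup_le fun R => iSup_le fun hR =>
    ENNReal.ofReal_le_ofReal ?_
  have hpi := Real.pi_pos
  have hRb : ∀ z ∈ Ω, IsMatrixBound (fun i j => ratEval (R i j) z) 1 := fun z hz =>
    isMatrixBound_of_norm_le_one (hR z hz)
  have hRe : ∀ i j, ∀ z ∈ Ω, ‖ratEval (R i j) z‖ ≤ 1 := fun i j z hz =>
    (hRb z hz).norm_apply_le i j
  have hdat := fun i j => isDatum_ratEval hopen (hRe i j)
  choose g hg _ using fun i j => exists_isNeumannSolution hopen hconv hne hw hP (hdat i j)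
  have hRfr : ∀ z ∈ frontier Ω, IsMatrixBound (fun i j => ratEval (R i j) z) 1 := by
    intro z hz ξ η
    refine le_on_closure (f := fun z => ‖∑ i, ∑ j, ratEval (R i j) z * (conj (η i) * ξ j)‖)
      (fun z hz => hRb z hz ξ η) ?_ continuousOn_const hz.1
    exact (continuousOn_finsetSum _ fun i _ => continuousOn_finsetSum _ fun j _ =>
      (hdat i j).continuousOn.mul continuousOn_const).norm
  have hgb := isMatrixBound_of_boundary hopen hconv hw (frontier_nonempty hne hw) hK
    (fun i j => (isNeumannSolution_iff hopen hconv hne hw (hdat i j) (g i j)).1 (hg i j)) hRfr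
  have hT : ∀ i j, ∫ σ in frontier Ω, extendBoundary (g i j) σ • kernelOp Ω A σ ∂μH[1] =
      (2 : ℂ) • ratApply (R i j) A := by
    intro i j
    rw [integral_smul_kernelOp_eq hopen hconv hw hA (g i j) (Polynomial.C 2 * (R i j).num)
      (R i j).denom (fun z hz => denom_eval_ne_zero hopen (hRe i j) (subset_closure hz))
      fun z hz => ?_, map_mul, Polynomial.aeval_C, ratApply, mul_assoc, Algebra.smul_def]
    have := hg i j z hz
    rw [ratEval_eq] at this
    rw [Polynomial.eval_mul, Polynomial.eval_C, mul_div_assoc, this]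
    ring
  have hae : ∀ᵐ σ ∂((μH[1] : Measure ℂ).restrict (frontier Ω)), σ ∈ frontier Ω :=
    ae_restrict_mem (measurableSet_frontier' Ω)
  have hone : (fun σ => extendBoundary (1 : frontier Ω →ᵇ ℂ) σ • kernelOp Ω A σ)
      =ᵐ[(μH[1] : Measure ℂ).restrict (frontier Ω)] kernelOp Ω A := by
    filter_upwards [hae] with σ hσ
    rw [show extendBoundary (1 : frontier Ω →ᵇ ℂ) σ = 1 from extendBoundary_coe 1 ⟨σ, hσ⟩,
      one_smul]
  set τ : ℝ := volume.real (hitAngles Ω w) / Real.pi with hτ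
  have hτ0 : 0 ≤ τ := by positivity
  -- The potential of `1` is the constant polynomial `τ` in `Ω`, so its operator version is `τ`
  -- times the identity.
  have hMτ : ∫ σ in frontier Ω, kernelOp Ω A σ ∂μH[1] = (τ : ℂ) • (1 : H →L[ℂ] H) := by
    rw [← integral_congr_ae hone, integral_smul_kernelOp_eq hopen hconv hw hA 1
      (Polynomial.C (τ : ℂ)) 1 (by simp) fun z hz => by
        rw [doubleLayer_one hopen hconv hw hz]; simp [hτ]]
    simp [Algebra.algebraMap_eq_smul_one]
  refine opNorm_le_of_norm_inner_le _ (by positivity) fun x y => ?_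
  have h := norm_sum_inner_integral_le (Γ := 2 * K) (τ := τ)
    (G := fun i j => extendBoundary (g i j))
    (hae.mono fun σ hσ => kernelOp_nonneg hopen hconv hw hA hσ)
    ((integral_smul_kernelOp hopen hconv hw hA 1).1.congr hone) hMτ
    (fun i j => (integral_smul_kernelOp hopen hconv hw hA (g i j)).1)
    (hae.mono fun σ hσ => by
      have := hgb ⟨σ, hσ⟩
      simpa only [← extendBoundary_coe] using this) x y
  simp only [hT] at h
  have e : ∑ i, ∑ j, inner ℂ (y i) (((2 : ℂ) • ratApply (R i j) A) (x j)) =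
      2 * inner ℂ y (blockOp (R.map fun r => ratApply r A) x) := by
    rw [inner_blockOp, Finset.mul_sum]
    refine Finset.sum_congr rfl fun i _ => ?_
    rw [Finset.mul_sum]
    refine Finset.sum_congr rfl fun j _ => ?_
    rw [_root_.smul_apply, inner_smul_right, Matrix.map_apply]
  rw [e, norm_mul, Complex.norm_ofNat, ← PiLp.norm_sq_eq_of_L2, ← PiLp.norm_sq_eq_of_L2] at h
  linarith

theorem sector_nonempty (a : ℂ) (β : ℝ) {α : ℝ} (hα : 0 < α) : (sector a β α).Nonempty := by
  refine ⟨a + Complex.exp (β * Complex.I), ?_, ?_⟩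
  · simp [Complex.exp_ne_zero]
  · rw [add_sub_cancel_left, ← Complex.exp_add, add_neg_cancel, Complex.exp_zero, Complex.arg_one,
      abs_zero]
    exact hα

end

end CNeumann

end

/-! ### Domains containing a sector: `K = π/(2α)` and total mass at most `2 - 2α/π` -/

theorem mainTheorem6 (Ω : Set ℂ) (hopen : IsOpen Ω) (hconv : Convex ℝ Ω)
    (hne : Ω ≠ Set.univ) (α : ℝ) (hα0 : 0 < α) (hα1 : α ≤ Real.pi / 2)
    (hsector : ∃ (a : ℂ) (β : ℝ), CNeumann.sector a β α ⊆ Ω) :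
    CNeumann.IsWellPosed Ω ∧ CNeumann.IsInvertibleIdAddP Ω ∧
      CNeumann.constN Ω ≤ ENNReal.ofReal (Real.pi / α) ∧
      CNeumann.constCb.{u} Ω ≤ ENNReal.ofReal ((Real.pi - α) / α) := by
  obtain ⟨a, β, hs⟩ := hsector
  obtain ⟨w, hw⟩ := (CNeumann.sector_nonempty a β hα0).mono hs
  have hvol := CNeumann.volume_real_hitAngles_le hopen hconv hw hα0 hα1 hs
  obtain ⟨hP, hK⟩ := CNeumann.isInvertibleIdAddP_of_le hopen hconv hw
    (CNeumann.frontier_nonempty hne hw) hα0 hvol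
  have hpi := Real.pi_pos
  have hK0 : 0 ≤ Real.pi / (2 * α) := by positivity
  refine ⟨CNeumann.isWellPosed_of_bound hopen hconv hne hw hP hK, hP,
    (CNeumann.constN_le_of_bound hopen hK).trans (ENNReal.ofReal_le_ofReal (le_of_eq ?_)),
    (CNeumann.constCb_le_of_bound hopen hconv hne hw hP hK0 hK).trans
      (ENNReal.ofReal_le_ofReal ?_)⟩
  · field_simp
  · calc Real.pi / (2 * α) * (MeasureTheory.volume.real (CNeumann.hitAngles Ω w) / Real.pi)
        ≤ Real.pi / (2 * α) * ((2 * Real.pi - 2 * α) / Real.pi) := by gcongr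
      _ = (Real.pi - α) / α := by field_simp
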